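/- Let $R$ be a commutative QF ring (noetherian and self-injective), and let $C$, $D$ be $R$-coalgebras that are projective as $R$-modules. Write $\mathcal M^D$ (resp. ${}^D\mathcal M$) for the category of right (resp. left) $D$-comodules, $\mathrm{Com}_D$ for colinear maps, $\otimes=\otimes_R$, and $M\square_C N=\ker(\varrho_M\otimes \mathrm{id}-\mathrm{id}\otimes\varrho_N : M\otimes N\to M\otimes C\otimes N)$. A right $D$-comodule $X$ is quasi-finite if $-\otimes X:R\text{-Mod}\to\mathcal M^D$ has a left adjoint; this left adjoint is denoted $h_D(X,-)$, with unit $\eta_M:M\to h_D(X,M)\otimes X$, and $e_D(X)=h_D(X,X)$ is the coendomorphism coalgebra, whose comultiplication satisfies $(\Delta\otimes \mathrm{id})\eta_X=(\mathrm{id}\otimes\eta_X)\eta_X$ and whose counit satisfies $(\varepsilon\otimes\mathrm{id})\eta_X=\mathrm{id}$. If $X$ is a $C$-$D$-bicomodule with left coaction $\varrho^-_X:X\to C\otimes X$, then $h_D(X,M)$ is a right $C$-comodule by the unique $\varrho$ with $(\varrho\otimes\mathrm{id})\eta_M=(\mathrm{id}\otimes\varrho_X^-)\eta_M$, and $h_D(X,D)$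 is a $D$-$C$-bicomodule, with left coaction $\lambda$ determined by $(\lambda\otimes\mathrm{id})\eta_D=(\mathrm{id}\otimes\eta_D)\Delta_D$. Left comodules are treated symmetrically: ${}_CX$ is quasi-finite if $X\otimes-:R\text{-Mod}\to{}^C\mathcal M$ has a left adjoint $h_C(X,-)$, with unit $\eta$, and $e_C(X)=h_C(X,X)$. Let $X$ be a $C$-$D$-bicomodule. The following are equivalent: 1. $X$ is invertible, i.e. $-\square_C X:\mathcal M^C\to\mathcal M^D$ is an equivalence; 2. $X\square_D-:{}^D\mathcal M\to{}^C\mathcal M$ is an equivalence; 3. $X_D$ is quasi-finite and an injective cogenerator of $\mathcal M^D$, and $e_D(X)\cong C$ as coalgebras compatibly with the coactions on $X$, i.e. there is a coalgebra isomorphism $\varphi:e_D(X)\to C$ with $(\varphi\otimes\mathrm{id})\eta_X=\varrho^-_X$; 4. ${}_CX$ is quasi-finite and an injective cogenerator of ${}^C\mathcal M$, and $e_C(X)\cong D$ as coalgebras compatibly with the coactions on $X$, i.e. there is a coalgebra isomorphism $\varphi:e_C(X)\to D$ with $(\mathrm{id}\otimes\varphi)\eta_X=\varrho^+_X$, where $\varrho^+_X:X\to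 X\otimes D$ is the right coaction. If these conditions hold, then the functor $-\square_C X:\mathcal M^C\to\mathcal M^D$ is an equivalence with inverse $$h_D(X,-)\;\cong\;-\square_D h_D(X,D):\mathcal M^D\to\mathcal M^C .$$ Moreover, for every $M\in\mathcal M^D$, with $\{M_\lambda\}_{\lambda\in\Lambda}$ the family (ordered by inclusion) of subcomodules of $M$ that are finitely presented as $R$-modules, $$h_D(X,M)\;\cong\;\varinjlim_{\Lambda}\mathrm{Com}_D(M_\lambda,X)^*\;\cong\;\varinjlim_{\Lambda}\,(X\square_D M_\lambda^*)^*$$ as $R$-modules, where $(-)^*=\mathrm{Hom}_R(-,R)$. These isomorphisms are the canonical ones. The adjunction bijection $h_D(X,M_\lambda)^*\cong\mathrm{Com}_D(M_\lambda,X)$ induces isomorphisms $h_D(X,M_\lambda)\cong\mathrm{Com}_D(M_\lambda,X)^*$, under which the first isomorphism is induced by the maps $h_D(X,M_\lambda)\to h_D(X,M)$; the second is induced by the isomorphisms $X\square_D M_\lambda^*\cong\mathrm{Com}_D(M_\lambda,X)$, $\sum_i x_i\otimes f_i\mapsto\bigl(m\mapsto \sum_i f_i(m)x_i\bigr)$.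 -/

import Mathlib

open CategoryTheory TensorProduct

universe u

noncomputable section

/-- A quasi-Frobenius (QF) commutative ring: noetherian and self-injective. -/
def IsQFRing (R : Type u) [CommRing R] : Prop :=
  IsNoetherianRing R ∧ Module.Injective R R

/-- A right `D`-comodule structure on the `R`-module `M`. -/
structure RCoact (R D M : Type u) [CommRing R] [AddCommGroup D] [Module R D]
    [Coalgebra R D] [AddCommGroup M] [Module R M] where
  map : M →ₗ[R] M ⊗[R] D
  coassoc : (TensorProduct.assoc R M D D).toLinearMap ∘ₗ map.rTensor D ∘ₗ map =
    (Coalgebra.comul (R := R) (A := D)).lTensor M ∘ₗ map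
  counit : (TensorProduct.rid R M).toLinearMap ∘ₗ
    (Coalgebra.counit (R := R) (A := D)).lTensor M ∘ₗ map = LinearMap.id

/-- A left `C`-comodule structure on the `R`-module `M`. -/
structure LCoact (R C M : Type u) [CommRing R] [AddCommGroup C] [Module R C]
    [Coalgebra R C] [AddCommGroup M] [Module R M] where
  map : M →ₗ[R] C ⊗[R] M
  coassoc : map.lTensor C ∘ₗ map = (TensorProduct.assoc R C C M).toLinearMap ∘ₗ
    (Coalgebra.comul (R := R) (A := C)).rTensor M ∘ₗ map
  counit : (TensorProduct.lid R M).toLinearMap ∘ₗ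
    (Coalgebra.counit (R := R) (A := C)).rTensor M ∘ₗ map = LinearMap.id

section Basic

variable {R : Type u} [CommRing R]
variable {C : Type u} [AddCommGroup C] [Module R C] [Coalgebra R C]
variable {D : Type u} [AddCommGroup D] [Module R D] [Coalgebra R D]
variable {M N P : Type u} [AddCommGroup M] [Module R M] [AddCommGroup N] [Module R N]
  [AddCommGroup P] [Module R P]
variable {W V X : Type u} [AddCommGroup W] [Module R W] [AddCommGroup V] [Module R V]
  [AddCommGroup X] [Module R X]

namespace RCoact

/-- `Com_D(M,N)`: the `R`-module of `D`-colinear maps. -/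
def com (m : RCoact R D M) (n : RCoact R D N) : Submodule R (M →ₗ[R] N) where
  carrier := {f | n.map ∘ₗ f = f.rTensor D ∘ₗ m.map}
  add_mem' {f g} hf hg := by
    simp only [Set.mem_ofPred_eq] at *
    rw [LinearMap.comp_add, hf, hg, LinearMap.rTensor_add, LinearMap.add_comp]
  zero_mem' := by simp
  smul_mem' r f hf := by
    simp only [Set.mem_ofPred_eq] at *
    rw [LinearMap.comp_smul, hf, LinearMap.rTensor_smul, LinearMap.smul_comp]

theorem mem_com {m : RCoact R D M} {n : RCoact R D N} {f : M →ₗ[R] N} :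
    f ∈ com m n ↔ n.map ∘ₗ f = f.rTensor D ∘ₗ m.map := Iff.rfl

theorem id_mem_com (m : RCoact R D M) : LinearMap.id ∈ com m m := by
  rw [mem_com]; simp

theorem comp_mem_com {m : RCoact R D M} {n : RCoact R D N} {p : RCoact R D P}
    {f : M →ₗ[R] N} {g : N →ₗ[R] P}
    (hf : f ∈ com m n) (hg : g ∈ com n p) : g ∘ₗ f ∈ com m p := by
  rw [mem_com] at *
  rw [← LinearMap.comp_assoc, hg, LinearMap.comp_assoc, hf, LinearMap.rTensor_comp,
    LinearMap.comp_assoc]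

theorem symm_mem_com {m : RCoact R D M} {n : RCoact R D N} (e : M ≃ₗ[R] N)
    (he : e.toLinearMap ∈ com m n) : e.symm.toLinearMap ∈ com n m := by
  rw [mem_com] at *
  have h2 : e.symm.toLinearMap.rTensor D ∘ₗ e.toLinearMap.rTensor D = LinearMap.id := by
    rw [← LinearMap.rTensor_comp]; simp
  calc m.map ∘ₗ e.symm.toLinearMap
      = e.symm.toLinearMap.rTensor D ∘ₗ (e.toLinearMap.rTensor D ∘ₗ m.map) ∘ₗ
          e.symm.toLinearMap := by
        rw [← LinearMap.comp_assoc, ← LinearMap.comp_assoc, h2, LinearMap.id_comp]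
    _ = e.symm.toLinearMap.rTensor D ∘ₗ (n.map ∘ₗ e.toLinearMap) ∘ₗ e.symm.toLinearMap := by
        rw [he]
    _ = _ := by rw [LinearMap.comp_assoc]; simp

/-- The coalgebra `D` as a right comodule over itself. -/
def self (R D : Type u) [CommRing R] [AddCommGroup D] [Module R D]
    [Coalgebra R D] : RCoact R D D where
  map := Coalgebra.comul
  coassoc := Coalgebra.coassoc
  counit := by
    rw [Coalgebra.lTensor_counit_comp_comul]; ext x; simp

/-- The right comodule `W ⊗ X`, with the coaction of `X`. -/
def tens (W : Type u) [AddCommGroup W] [Module R W] (x : RCoact R D X) :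
    RCoact R D (W ⊗[R] X) where
  map := (TensorProduct.assoc R W X D).symm.toLinearMap ∘ₗ x.map.lTensor W
  coassoc := by
    have e1 : (TensorProduct.assoc R (W ⊗[R] X) D D).toLinearMap ∘ₗ
        ((TensorProduct.assoc R W X D).symm.toLinearMap ∘ₗ x.map.lTensor W).rTensor D ∘ₗ
        (TensorProduct.assoc R W X D).symm.toLinearMap =
        (TensorProduct.assoc R W X (D ⊗[R] D)).symm.toLinearMap ∘ₗ
          ((TensorProduct.assoc R X D D).toLinearMap ∘ₗ x.map.rTensor D).lTensor W := by
      refine TensorProduct.ext' fun w t => ?_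
      induction t using TensorProduct.induction_on with
      | zero => simp
      | tmul y d =>
        simp only [LinearMap.comp_apply, LinearEquiv.coe_coe, assoc_symm_tmul,
          LinearMap.rTensor_tmul, LinearMap.lTensor_tmul]
        generalize x.map y = s
        induction s using TensorProduct.induction_on with
        | zero => simp
        | tmul => simp
        | add x y hx hy => simp only [tmul_add, map_add, add_tmul, hx, hy]
      | add x y hx hy => simp only [tmul_add, map_add, hx, hy]
    have e2 : (Coalgebra.comul (R := R) (A := D)).lTensor (W ⊗[R] X) ∘ₗ
        (TensorProduct.assoc R W X D).symm.toLinearMap =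
        (TensorProduct.assoc R W X (D ⊗[R] D)).symm.toLinearMap ∘ₗ
          ((Coalgebra.comul (R := R) (A := D)).lTensor X).lTensor W := by
      refine TensorProduct.ext' fun w t => ?_
      induction t using TensorProduct.induction_on with
      | zero => simp
      | tmul y d => simp
      | add x y hx hy => simp only [tmul_add, map_add, hx, hy]
    have h := congrArg (LinearMap.lTensor W) x.coassoc
    simp only [LinearMap.lTensor_comp] at h e1
    rw [← LinearMap.comp_assoc _ _ (LinearMap.rTensor D _),
      ← LinearMap.comp_assoc _ _ (TensorProduct.assoc R (W ⊗[R] X) D D).toLinearMap, e1,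
      ← LinearMap.comp_assoc _ _ (LinearMap.lTensor (W ⊗[R] X) _), e2, LinearMap.comp_assoc,
      LinearMap.comp_assoc, LinearMap.comp_assoc, h]
  counit := by
    have e1 : (TensorProduct.rid R (W ⊗[R] X)).toLinearMap ∘ₗ
        (Coalgebra.counit (R := R) (A := D)).lTensor (W ⊗[R] X) ∘ₗ
          (TensorProduct.assoc R W X D).symm.toLinearMap =
        ((TensorProduct.rid R X).toLinearMap ∘ₗ
          (Coalgebra.counit (R := R) (A := D)).lTensor X).lTensor W := by
      refine TensorProduct.ext' fun w t => ?_
      induction t using TensorProduct.induction_on with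
      | zero => simp
      | tmul y d => simp
      | add x y hx hy => simp only [tmul_add, map_add, hx, hy]
    have h := congrArg (LinearMap.lTensor W) x.counit
    rw [← LinearMap.comp_assoc _ _ (LinearMap.lTensor (W ⊗[R] X) _), ← LinearMap.comp_assoc, e1,
      ← LinearMap.lTensor_comp, LinearMap.comp_assoc, h, LinearMap.lTensor_id]

theorem rTensor_mem_com (x : RCoact R D X) (f : W →ₗ[R] V) :
    f.rTensor X ∈ com (tens W x) (tens V x) := by
  rw [mem_com]
  refine TensorProduct.ext' fun w y => ?_
  simp only [tens, LinearMap.comp_apply, LinearMap.rTensor_tmul,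
    LinearMap.lTensor_tmul, LinearEquiv.coe_coe]
  generalize x.map y = t
  induction t using TensorProduct.induction_on with
  | zero => simp
  | tmul => simp
  | add x y hx hy => simp only [tmul_add, map_add, hx, hy]

theorem lTensor_mem_com (W : Type u) [AddCommGroup W] [Module R W]
    {m : RCoact R D M} {n : RCoact R D N} {f : M →ₗ[R] N} (hf : f ∈ com m n) :
    f.lTensor W ∈ com (tens W m) (tens W n) := by
  rw [mem_com] at *
  refine TensorProduct.ext' fun w y => ?_
  have h := LinearMap.congr_fun hf y
  simp only [LinearMap.comp_apply] at h
  simp only [tens, LinearMap.comp_apply,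
    LinearMap.lTensor_tmul, LinearEquiv.coe_coe, h]
  generalize m.map y = t
  induction t using TensorProduct.induction_on with
  | zero => simp
  | tmul => simp
  | add x y hx hy => simp only [tmul_add, map_add, hx, hy]

theorem assoc_mem_com (W V : Type u) [AddCommGroup W] [Module R W] [AddCommGroup V] [Module R V]
    (x : RCoact R D X) : (TensorProduct.assoc R W V X).toLinearMap ∈
      com (tens (W ⊗[R] V) x) (tens W (tens V x)) := by
  rw [mem_com]
  refine TensorProduct.ext_threefold fun w v y => ?_
  simp only [tens, LinearMap.comp_apply,
    LinearMap.lTensor_tmul, LinearEquiv.coe_coe, assoc_tmul]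
  generalize x.map y = t
  induction t using TensorProduct.induction_on with
  | zero => simp
  | tmul => simp
  | add x y hx hy => simp only [tmul_add, map_add, hx, hy]

/-- A submodule `K` of `M` is a subcomodule if the coaction maps `K` into the image of `K ⊗ D`. -/
def IsSubcomodule (m : RCoact R D M) (K : Submodule R M) : Prop :=
  ∀ x ∈ K, m.map x ∈ LinearMap.range (K.subtype.rTensor D)

section Flat

variable [Module.Flat R D]

theorem subtype_rTensor_inj (R D : Type u) [CommRing R] [AddCommGroup D] [Module R D]
    [Module.Flat R D] {M : Type u} [AddCommGroup M] [Module R M] (K : Submodule R M) :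
    Function.Injective (K.subtype.rTensor D) :=
  Module.Flat.rTensor_preserves_injective_linearMap _ K.injective_subtype

/-- The coaction of a subcomodule. -/
def subMap (m : RCoact R D M) (K : Submodule R M) (hK : m.IsSubcomodule K) : K →ₗ[R] K ⊗[R] D :=
  (LinearEquiv.ofInjective (K.subtype.rTensor D) (subtype_rTensor_inj R D K)).symm.toLinearMap ∘ₗ
    (m.map ∘ₗ K.subtype).codRestrict _ (fun x => hK x x.2)

theorem subMap_spec (m : RCoact R D M) (K : Submodule R M) (hK : m.IsSubcomodule K) :
    K.subtype.rTensor D ∘ₗ m.subMap K hK = m.map ∘ₗ K.subtype := by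
  ext x
  simp only [subMap, LinearMap.comp_apply, LinearEquiv.coe_coe]
  exact congrArg Subtype.val (LinearEquiv.apply_symm_apply
    (LinearEquiv.ofInjective (K.subtype.rTensor D) (subtype_rTensor_inj R D K)) _)

/-- A subcomodule as a comodule: the unique structure for which the inclusion is colinear. -/
def sub (m : RCoact R D M) (K : Submodule R M) (hK : m.IsSubcomodule K) : RCoact R D K where
  map := m.subMap K hK
  coassoc := by
    have hj := subMap_spec m K hK
    rw [← LinearMap.cancel_left (subtype_rTensor_inj R (D ⊗[R] D) K)]
    have e1 : K.subtype.rTensor (D ⊗[R] D) ∘ₗ (TensorProduct.assoc R K D D).toLinearMap =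
        (TensorProduct.assoc R M D D).toLinearMap ∘ₗ (K.subtype.rTensor D).rTensor D :=
      TensorProduct.ext_threefold fun _ _ _ => rfl
    have e2 : K.subtype.rTensor (D ⊗[R] D) ∘ₗ (Coalgebra.comul (R := R) (A := D)).lTensor K =
        (Coalgebra.comul (R := R) (A := D)).lTensor M ∘ₗ K.subtype.rTensor D :=
      TensorProduct.ext' fun _ _ => rfl
    calc _ = ((TensorProduct.assoc R M D D).toLinearMap ∘ₗ
            (K.subtype.rTensor D ∘ₗ m.subMap K hK).rTensor D) ∘ₗ m.subMap K hK := by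
          rw [LinearMap.rTensor_comp, ← LinearMap.comp_assoc _ _
            (TensorProduct.assoc R M D D).toLinearMap, ← e1]; rfl
      _ = ((TensorProduct.assoc R M D D).toLinearMap ∘ₗ m.map.rTensor D) ∘ₗ
            (K.subtype.rTensor D ∘ₗ m.subMap K hK) := by
          conv_lhs => rw [hj, LinearMap.rTensor_comp]
          rfl
      _ = ((TensorProduct.assoc R M D D).toLinearMap ∘ₗ m.map.rTensor D ∘ₗ m.map) ∘ₗ
            K.subtype := by rw [hj]; rfl
      _ = (Coalgebra.comul (R := R) (A := D)).lTensor M ∘ₗ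
            (K.subtype.rTensor D ∘ₗ m.subMap K hK) := by rw [m.coassoc, hj]; rfl
      _ = _ := by rw [← LinearMap.comp_assoc, ← e2]; rfl
  counit := by
    have hj := subMap_spec m K hK
    rw [← LinearMap.cancel_left K.injective_subtype]
    have e1 : K.subtype ∘ₗ (TensorProduct.rid R K).toLinearMap ∘ₗ
        (Coalgebra.counit (R := R) (A := D)).lTensor K =
        (TensorProduct.rid R M).toLinearMap ∘ₗ (Coalgebra.counit (R := R) (A := D)).lTensor M ∘ₗ
          K.subtype.rTensor D :=
      TensorProduct.ext' fun _ _ => by simp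
    calc _ = (K.subtype ∘ₗ (TensorProduct.rid R K).toLinearMap ∘ₗ
        (Coalgebra.counit (R := R) (A := D)).lTensor K) ∘ₗ m.subMap K hK := rfl
      _ = ((TensorProduct.rid R M).toLinearMap ∘ₗ
          (Coalgebra.counit (R := R) (A := D)).lTensor M) ∘ₗ
          (K.subtype.rTensor D ∘ₗ m.subMap K hK) := by rw [e1]; rfl
      _ = ((TensorProduct.rid R M).toLinearMap ∘ₗ
          (Coalgebra.counit (R := R) (A := D)).lTensor M ∘ₗ m.map) ∘ₗ K.subtype := by rw [hj]; rfl
      _ = _ := by rw [m.counit]; rfl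

/-- A map into a subcomodule is colinear as soon as it is colinear into the comodule. -/
theorem mem_com_sub {n : RCoact R D N} (m : RCoact R D M) (K : Submodule R M)
    (hK : m.IsSubcomodule K) (f : N →ₗ[R] K) (hf : K.subtype ∘ₗ f ∈ com n m) :
    f ∈ com n (m.sub K hK) := by
  rw [mem_com] at *
  rw [← LinearMap.cancel_left (subtype_rTensor_inj R D K)]
  change K.subtype.rTensor D ∘ₗ m.subMap K hK ∘ₗ f = _
  rw [← LinearMap.comp_assoc, subMap_spec, LinearMap.comp_assoc, hf, LinearMap.rTensor_comp,
    LinearMap.comp_assoc]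

theorem subtype_mem_com (m : RCoact R D M) (K : Submodule R M) (hK : m.IsSubcomodule K) :
    K.subtype ∈ com (m.sub K hK) m := (subMap_spec m K hK).symm

/-- Kernels of colinear maps are subcomodules. -/
theorem isSubcomodule_ker {m : RCoact R D M} {n : RCoact R D N} {f : M →ₗ[R] N}
    (hf : f ∈ com m n) : m.IsSubcomodule (LinearMap.ker f) := by
  intro x hx
  have hex := Module.Flat.rTensor_exact D (LinearMap.exact_subtype_ker_map f)
  refine (hex _).1 ?_
  have h := LinearMap.congr_fun (mem_com.1 hf) x
  simp only [LinearMap.comp_apply, LinearMap.mem_ker.1 hx, map_zero] at h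
  exact h.symm

end Flat

end RCoact

namespace LCoact

/-- The `R`-module of colinear maps between left comodules. -/
def com (m : LCoact R C M) (n : LCoact R C N) : Submodule R (M →ₗ[R] N) where
  carrier := {f | n.map ∘ₗ f = f.lTensor C ∘ₗ m.map}
  add_mem' {f g} hf hg := by
    simp only [Set.mem_ofPred_eq] at *
    rw [LinearMap.comp_add, hf, hg, LinearMap.lTensor_add, LinearMap.add_comp]
  zero_mem' := by simp
  smul_mem' r f hf := by
    simp only [Set.mem_ofPred_eq] at *
    rw [LinearMap.comp_smul, hf, LinearMap.lTensor_smul, LinearMap.smul_comp]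

theorem mem_com {m : LCoact R C M} {n : LCoact R C N} {f : M →ₗ[R] N} :
    f ∈ com m n ↔ n.map ∘ₗ f = f.lTensor C ∘ₗ m.map := Iff.rfl

theorem id_mem_com (m : LCoact R C M) : LinearMap.id ∈ com m m := by
  rw [mem_com]; simp

theorem comp_mem_com {m : LCoact R C M} {n : LCoact R C N} {p : LCoact R C P}
    {f : M →ₗ[R] N} {g : N →ₗ[R] P}
    (hf : f ∈ com m n) (hg : g ∈ com n p) : g ∘ₗ f ∈ com m p := by
  rw [mem_com] at *
  rw [← LinearMap.comp_assoc, hg, LinearMap.comp_assoc, hf, LinearMap.lTensor_comp,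
    LinearMap.comp_assoc]

theorem symm_mem_com {m : LCoact R C M} {n : LCoact R C N} (e : M ≃ₗ[R] N)
    (he : e.toLinearMap ∈ com m n) : e.symm.toLinearMap ∈ com n m := by
  rw [mem_com] at *
  have h2 : e.symm.toLinearMap.lTensor C ∘ₗ e.toLinearMap.lTensor C = LinearMap.id := by
    rw [← LinearMap.lTensor_comp]; simp
  calc m.map ∘ₗ e.symm.toLinearMap
      = e.symm.toLinearMap.lTensor C ∘ₗ (e.toLinearMap.lTensor C ∘ₗ m.map) ∘ₗ
          e.symm.toLinearMap := by
        rw [← LinearMap.comp_assoc, ← LinearMap.comp_assoc, h2, LinearMap.id_comp]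
    _ = e.symm.toLinearMap.lTensor C ∘ₗ (n.map ∘ₗ e.toLinearMap) ∘ₗ e.symm.toLinearMap := by
        rw [he]
    _ = _ := by rw [LinearMap.comp_assoc]; simp

/-- The coalgebra `C` as a left comodule over itself. -/
def self (R C : Type u) [CommRing R] [AddCommGroup C] [Module R C]
    [Coalgebra R C] : LCoact R C C where
  map := Coalgebra.comul
  coassoc := Coalgebra.coassoc.symm
  counit := by
    rw [Coalgebra.rTensor_counit_comp_comul]; ext x; simp

/-- The left comodule `X ⊗ W`, with the coaction of `X`. -/
def tens (x : LCoact R C X) (W : Type u) [AddCommGroup W] [Module R W] :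
    LCoact R C (X ⊗[R] W) where
  map := (TensorProduct.assoc R C X W).toLinearMap ∘ₗ x.map.rTensor W
  coassoc := by
    have e1 : ((TensorProduct.assoc R C X W).toLinearMap ∘ₗ x.map.rTensor W).lTensor C ∘ₗ
        (TensorProduct.assoc R C X W).toLinearMap =
        (TensorProduct.assoc R C X W).toLinearMap.lTensor C ∘ₗ
          (TensorProduct.assoc R C (C ⊗[R] X) W).toLinearMap ∘ₗ
          (x.map.lTensor C).rTensor W :=
      TensorProduct.ext_threefold fun _ _ _ => by simp
    have e2 : (TensorProduct.assoc R C C (X ⊗[R] W)).toLinearMap ∘ₗ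
        (Coalgebra.comul (R := R) (A := C)).rTensor (X ⊗[R] W) ∘ₗ
        (TensorProduct.assoc R C X W).toLinearMap =
        (TensorProduct.assoc R C X W).toLinearMap.lTensor C ∘ₗ
          (TensorProduct.assoc R C (C ⊗[R] X) W).toLinearMap ∘ₗ
          ((TensorProduct.assoc R C C X).toLinearMap ∘ₗ
            (Coalgebra.comul (R := R) (A := C)).rTensor X).rTensor W := by
      refine TensorProduct.ext_threefold fun c y w => ?_
      simp only [LinearMap.comp_apply, LinearEquiv.coe_coe, assoc_tmul, LinearMap.rTensor_tmul]
      generalize (Coalgebra.comul (R := R) c) = t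
      induction t using TensorProduct.induction_on with
      | zero => simp
      | tmul => simp
      | add x y hx hy => simp only [add_tmul, map_add, hx, hy]
    have h := congrArg (LinearMap.rTensor W) x.coassoc
    simp only [LinearMap.rTensor_comp] at h e2
    rw [← LinearMap.comp_assoc, e1, LinearMap.comp_assoc, LinearMap.comp_assoc, h,
      ← LinearMap.comp_assoc _ (TensorProduct.assoc R C X W).toLinearMap,
      ← LinearMap.comp_assoc _ (LinearMap.comp _ _), e2]
    rfl
  counit := by
    have e1 : (TensorProduct.lid R (X ⊗[R] W)).toLinearMap ∘ₗ
        (Coalgebra.counit (R := R) (A := C)).rTensor (X ⊗[R] W) ∘ₗ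
          (TensorProduct.assoc R C X W).toLinearMap =
        ((TensorProduct.lid R X).toLinearMap ∘ₗ
          (Coalgebra.counit (R := R) (A := C)).rTensor X).rTensor W :=
      TensorProduct.ext_threefold fun _ _ _ => by simp [smul_tmul']
    have h := congrArg (LinearMap.rTensor W) x.counit
    rw [← LinearMap.comp_assoc _ _ (LinearMap.rTensor (X ⊗[R] W) _), ← LinearMap.comp_assoc, e1,
      ← LinearMap.rTensor_comp, LinearMap.comp_assoc, h, LinearMap.rTensor_id]

theorem lTensor_mem_com (x : LCoact R C X) (f : W →ₗ[R] V) :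
    f.lTensor X ∈ com (tens x W) (tens x V) := by
  rw [mem_com]
  refine TensorProduct.ext' fun y w => ?_
  simp only [tens, LinearMap.comp_apply, LinearMap.rTensor_tmul,
    LinearMap.lTensor_tmul, LinearEquiv.coe_coe]
  generalize x.map y = t
  induction t using TensorProduct.induction_on with
  | zero => simp
  | tmul => simp
  | add x y hx hy => simp only [add_tmul, map_add, hx, hy]

theorem rTensor_mem_com (W : Type u) [AddCommGroup W] [Module R W]
    {m : LCoact R C M} {n : LCoact R C N} {f : M →ₗ[R] N} (hf : f ∈ com m n) :
    f.rTensor W ∈ com (tens m W) (tens n W) := by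
  rw [mem_com] at *
  refine TensorProduct.ext' fun y w => ?_
  have h := LinearMap.congr_fun hf y
  simp only [LinearMap.comp_apply] at h
  simp only [tens, LinearMap.comp_apply,
    LinearMap.rTensor_tmul, LinearEquiv.coe_coe, h]
  generalize m.map y = t
  induction t using TensorProduct.induction_on with
  | zero => simp
  | tmul => simp
  | add x y hx hy => simp only [add_tmul, map_add, hx, hy]

theorem assoc_mem_com (x : LCoact R C X) (V W : Type u) [AddCommGroup W] [Module R W]
    [AddCommGroup V] [Module R V] : (TensorProduct.assoc R X V W).toLinearMap ∈
      com (tens (tens x V) W) (tens x (V ⊗[R] W)) := by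
  rw [mem_com]
  refine TensorProduct.ext_threefold fun y v w => ?_
  simp only [tens, LinearMap.comp_apply,
    LinearMap.rTensor_tmul, LinearEquiv.coe_coe, assoc_tmul]
  generalize x.map y = t
  induction t using TensorProduct.induction_on with
  | zero => simp
  | tmul => simp
  | add x y hx hy => simp only [add_tmul, map_add, hx, hy]

/-- A submodule `K` of `M` is a subcomodule if the coaction maps `K` into the image of `C ⊗ K`. -/
def IsSubcomodule (m : LCoact R C M) (K : Submodule R M) : Prop :=
  ∀ x ∈ K, m.map x ∈ LinearMap.range (K.subtype.lTensor C)

section Flat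

variable [Module.Flat R C]

theorem subtype_lTensor_inj (R C : Type u) [CommRing R] [AddCommGroup C] [Module R C]
    [Module.Flat R C] {M : Type u} [AddCommGroup M] [Module R M] (K : Submodule R M) :
    Function.Injective (K.subtype.lTensor C) :=
  Module.Flat.lTensor_preserves_injective_linearMap _ K.injective_subtype

/-- The coaction of a subcomodule. -/
def subMap (m : LCoact R C M) (K : Submodule R M) (hK : m.IsSubcomodule K) : K →ₗ[R] C ⊗[R] K :=
  (LinearEquiv.ofInjective (K.subtype.lTensor C) (subtype_lTensor_inj R C K)).symm.toLinearMap ∘ₗ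
    (m.map ∘ₗ K.subtype).codRestrict _ (fun x => hK x x.2)

theorem subMap_spec (m : LCoact R C M) (K : Submodule R M) (hK : m.IsSubcomodule K) :
    K.subtype.lTensor C ∘ₗ m.subMap K hK = m.map ∘ₗ K.subtype := by
  ext x
  simp only [subMap, LinearMap.comp_apply, LinearEquiv.coe_coe]
  exact congrArg Subtype.val (LinearEquiv.apply_symm_apply
    (LinearEquiv.ofInjective (K.subtype.lTensor C) (subtype_lTensor_inj R C K)) _)

/-- A subcomodule as a comodule: the unique structure for which the inclusion is colinear. -/
def sub (m : LCoact R C M) (K : Submodule R M) (hK : m.IsSubcomodule K) : LCoact R C K where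
  map := m.subMap K hK
  coassoc := by
    have hj := subMap_spec m K hK
    have hinj : Function.Injective ((K.subtype.lTensor C).lTensor C) :=
      Module.Flat.lTensor_preserves_injective_linearMap _ (subtype_lTensor_inj R C K)
    rw [← LinearMap.cancel_left hinj]
    have e1 : (K.subtype.lTensor C).lTensor C ∘ₗ (TensorProduct.assoc R C C K).toLinearMap =
        (TensorProduct.assoc R C C M).toLinearMap ∘ₗ K.subtype.lTensor (C ⊗[R] C) :=
      TensorProduct.ext_threefold fun _ _ _ => rfl
    have e2 : K.subtype.lTensor (C ⊗[R] C) ∘ₗ (Coalgebra.comul (R := R) (A := C)).rTensor K =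
        (Coalgebra.comul (R := R) (A := C)).rTensor M ∘ₗ K.subtype.lTensor C :=
      TensorProduct.ext' fun _ _ => rfl
    calc _ = (K.subtype.lTensor C ∘ₗ m.subMap K hK).lTensor C ∘ₗ m.subMap K hK := by
          rw [LinearMap.lTensor_comp]; rfl
      _ = m.map.lTensor C ∘ₗ (K.subtype.lTensor C ∘ₗ m.subMap K hK) := by
          conv_lhs => rw [hj, LinearMap.lTensor_comp]
          rfl
      _ = (m.map.lTensor C ∘ₗ m.map) ∘ₗ K.subtype := by rw [hj]; rfl
      _ = ((TensorProduct.assoc R C C M).toLinearMap ∘ₗ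
            (Coalgebra.comul (R := R) (A := C)).rTensor M) ∘ₗ
            (K.subtype.lTensor C ∘ₗ m.subMap K hK) := by rw [m.coassoc, hj]; rfl
      _ = (TensorProduct.assoc R C C M).toLinearMap ∘ₗ (K.subtype.lTensor (C ⊗[R] C) ∘ₗ
            (Coalgebra.comul (R := R) (A := C)).rTensor K) ∘ₗ m.subMap K hK := by rw [e2]; rfl
      _ = _ := by
          rw [← LinearMap.comp_assoc (m.subMap K hK) (LinearMap.rTensor _ _), 
            ← LinearMap.comp_assoc _ _ ((K.subtype.lTensor C).lTensor C), ← LinearMap.comp_assoc,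
            ← LinearMap.comp_assoc, ← LinearMap.comp_assoc, e1]
  counit := by
    have hj := subMap_spec m K hK
    rw [← LinearMap.cancel_left K.injective_subtype]
    have e1 : K.subtype ∘ₗ (TensorProduct.lid R K).toLinearMap ∘ₗ
        (Coalgebra.counit (R := R) (A := C)).rTensor K =
        (TensorProduct.lid R M).toLinearMap ∘ₗ (Coalgebra.counit (R := R) (A := C)).rTensor M ∘ₗ
          K.subtype.lTensor C :=
      TensorProduct.ext' fun _ _ => by simp
    calc _ = (K.subtype ∘ₗ (TensorProduct.lid R K).toLinearMap ∘ₗ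
        (Coalgebra.counit (R := R) (A := C)).rTensor K) ∘ₗ m.subMap K hK := rfl
      _ = ((TensorProduct.lid R M).toLinearMap ∘ₗ
          (Coalgebra.counit (R := R) (A := C)).rTensor M) ∘ₗ
          (K.subtype.lTensor C ∘ₗ m.subMap K hK) := by rw [e1]; rfl
      _ = ((TensorProduct.lid R M).toLinearMap ∘ₗ
          (Coalgebra.counit (R := R) (A := C)).rTensor M ∘ₗ m.map) ∘ₗ K.subtype := by rw [hj]; rfl
      _ = _ := by rw [m.counit]; rfl

/-- A map into a subcomodule is colinear as soon as it is colinear into the comodule. -/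
theorem mem_com_sub {n : LCoact R C N} (m : LCoact R C M) (K : Submodule R M)
    (hK : m.IsSubcomodule K) (f : N →ₗ[R] K) (hf : K.subtype ∘ₗ f ∈ com n m) :
    f ∈ com n (m.sub K hK) := by
  rw [mem_com] at *
  rw [← LinearMap.cancel_left (subtype_lTensor_inj R C K)]
  change K.subtype.lTensor C ∘ₗ m.subMap K hK ∘ₗ f = _
  rw [← LinearMap.comp_assoc, subMap_spec, LinearMap.comp_assoc, hf, LinearMap.lTensor_comp,
    LinearMap.comp_assoc]

theorem subtype_mem_com (m : LCoact R C M) (K : Submodule R M) (hK : m.IsSubcomodule K) :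
    K.subtype ∈ com (m.sub K hK) m := (subMap_spec m K hK).symm

/-- Kernels of colinear maps are subcomodules. -/
theorem isSubcomodule_ker {m : LCoact R C M} {n : LCoact R C N} {f : M →ₗ[R] N}
    (hf : f ∈ com m n) : m.IsSubcomodule (LinearMap.ker f) := by
  intro x hx
  have hex := Module.Flat.lTensor_exact C (LinearMap.exact_subtype_ker_map f)
  refine (hex _).1 ?_
  have h := LinearMap.congr_fun (mem_com.1 hf) x
  simp only [LinearMap.comp_apply, LinearMap.mem_ker.1 hx, map_zero] at h
  exact h.symm

end Flat

end LCoact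


/-- A `C`-`D`-bicomodule structure on `X`: a left `C`-coaction and a right `D`-coaction such that
the left coaction is `D`-colinear. -/
structure BiCoact (R C D X : Type u) [CommRing R] [AddCommGroup C] [Module R C] [Coalgebra R C]
    [AddCommGroup D] [Module R D] [Coalgebra R D] [AddCommGroup X] [Module R X] where
  left : LCoact R C X
  right : RCoact R D X
  colinear : left.map ∈ RCoact.com right (RCoact.tens C right)

theorem BiCoact.colinear' (x : BiCoact R C D X) :
    x.right.map ∈ LCoact.com x.left (x.left.tens D) := by
  have h := RCoact.mem_com.1 x.colinear
  rw [LCoact.mem_com]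
  change (TensorProduct.assoc R C X D).toLinearMap ∘ₗ x.left.map.rTensor D ∘ₗ x.right.map = _
  rw [← h]
  ext y
  simp [RCoact.tens]

/-- The coalgebra `D` as a `D`-`D`-bicomodule. -/
def BiCoact.self (R D : Type u) [CommRing R] [AddCommGroup D] [Module R D]
    [Coalgebra R D] : BiCoact R D D D where
  left := LCoact.self R D
  right := RCoact.self R D
  colinear := by
    rw [RCoact.mem_com]
    ext y
    have h := LinearMap.congr_fun (Coalgebra.coassoc (R := R) (A := D)) y
    simp only [LinearMap.comp_apply, LinearEquiv.coe_coe] at h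
    simp only [LCoact.self, RCoact.self, RCoact.tens, LinearMap.comp_apply, LinearEquiv.coe_coe]
    rw [← h, LinearEquiv.symm_apply_apply]

/-! ### The cotensor product -/

/-- The map `ρ_M ⊗ id - id ⊗ ρ_N : M ⊗ N → M ⊗ C ⊗ N`. -/
def cotensorMap (m : RCoact R C M) (n : LCoact R C N) :
    M ⊗[R] N →ₗ[R] M ⊗[R] (C ⊗[R] N) :=
  (TensorProduct.assoc R M C N).toLinearMap ∘ₗ m.map.rTensor N - n.map.lTensor M

/-- The cotensor product `M □_C N`, as a submodule of `M ⊗ N`. -/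
def cotensor (m : RCoact R C M) (n : LCoact R C N) : Submodule R (M ⊗[R] N) :=
  LinearMap.ker (cotensorMap m n)

theorem mem_cotensor {m : RCoact R C M} {n : LCoact R C N} {t : M ⊗[R] N} :
    t ∈ cotensor m n ↔
      TensorProduct.assoc R M C N (m.map.rTensor N t) = n.map.lTensor M t := by
  simp [cotensor, cotensorMap, sub_eq_zero]

section cotensorMaps

variable {M' N' : Type u} [AddCommGroup M'] [Module R M'] [AddCommGroup N'] [Module R N']

/-- `f □ N : M □_C N → M' □_C N` for a colinear map `f : M → M'`. -/
def cotensorMapLeft {m : RCoact R C M} {m' : RCoact R C M'} (f : M →ₗ[R] M')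
    (hf : f ∈ RCoact.com m m') (n : LCoact R C N) : cotensor m n →ₗ[R] cotensor m' n :=
  (f.rTensor N).restrict fun t ht => by
    rw [mem_cotensor] at *
    have e1 : m'.map.rTensor N ∘ₗ f.rTensor N = (f.rTensor C).rTensor N ∘ₗ m.map.rTensor N := by
      rw [← LinearMap.rTensor_comp, RCoact.mem_com.1 hf, LinearMap.rTensor_comp]
    have e2 : (TensorProduct.assoc R M' C N).toLinearMap ∘ₗ (f.rTensor C).rTensor N =
        f.rTensor (C ⊗[R] N) ∘ₗ (TensorProduct.assoc R M C N).toLinearMap :=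
      TensorProduct.ext_threefold fun _ _ _ => rfl
    have e3 : n.map.lTensor M' ∘ₗ f.rTensor N = f.rTensor (C ⊗[R] N) ∘ₗ n.map.lTensor M :=
      TensorProduct.ext' fun _ _ => rfl
    have e1 := LinearMap.congr_fun e1 t
    have e2 := LinearMap.congr_fun e2 (m.map.rTensor N t)
    have e3 := LinearMap.congr_fun e3 t
    simp only [LinearMap.comp_apply, LinearEquiv.coe_coe] at e1 e2 e3
    rw [e1, e2, e3, ht]

/-- `M □ g : M □_C N → M □_C N'` for a colinear map `g : N → N'`. -/
def cotensorMapRight (m : RCoact R C M) {n : LCoact R C N} {n' : LCoact R C N'}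
    (g : N →ₗ[R] N') (hg : g ∈ LCoact.com n n') : cotensor m n →ₗ[R] cotensor m n' :=
  (g.lTensor M).restrict fun t ht => by
    rw [mem_cotensor] at *
    have e1 : n'.map.lTensor M ∘ₗ g.lTensor M = (g.lTensor C).lTensor M ∘ₗ n.map.lTensor M := by
      rw [← LinearMap.lTensor_comp, LCoact.mem_com.1 hg, LinearMap.lTensor_comp]
    have e2 : (TensorProduct.assoc R M C N').toLinearMap ∘ₗ m.map.rTensor N' ∘ₗ g.lTensor M =
        (g.lTensor C).lTensor M ∘ₗ (TensorProduct.assoc R M C N).toLinearMap ∘ₗ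
          m.map.rTensor N := by
      refine TensorProduct.ext' fun y z => ?_
      simp only [LinearMap.comp_apply, LinearMap.lTensor_tmul, LinearMap.rTensor_tmul,
        LinearEquiv.coe_coe]
      generalize m.map y = s
      induction s using TensorProduct.induction_on with
      | zero => simp
      | tmul => simp
      | add x y hx hy => simp only [add_tmul, map_add, hx, hy]
    have e1 := LinearMap.congr_fun e1 t
    have e2 := LinearMap.congr_fun e2 t
    simp only [LinearMap.comp_apply, LinearEquiv.coe_coe] at e1 e2
    rw [e1, e2, ht]

end cotensorMaps

theorem cotensorMap_mem_rcom (m : RCoact R C M) (x : BiCoact R C D X) :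
    cotensorMap m x.left ∈ RCoact.com (RCoact.tens M x.right)
      (RCoact.tens M (RCoact.tens C x.right)) :=
  Submodule.sub_mem _
    (RCoact.comp_mem_com (RCoact.rTensor_mem_com x.right m.map)
      (RCoact.assoc_mem_com M C x.right))
    (RCoact.lTensor_mem_com M x.colinear)

theorem cotensorMap_mem_lcom (x : BiCoact R C D X) (n : LCoact R D N) :
    cotensorMap x.right n ∈ LCoact.com (x.left.tens N) (x.left.tens (D ⊗[R] N)) :=
  Submodule.sub_mem _
    (LCoact.comp_mem_com (LCoact.rTensor_mem_com N x.colinear')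
      (LCoact.assoc_mem_com x.left D N))
    (LCoact.lTensor_mem_com x.left n.map)

/-- `M □_C X` as a right `D`-comodule, a subcomodule of `M ⊗ X`. -/
def rcotensor [Module.Flat R D] (m : RCoact R C M) (x : BiCoact R C D X) :
    RCoact R D (cotensor m x.left) :=
  (RCoact.tens M x.right).sub _ (RCoact.isSubcomodule_ker (cotensorMap_mem_rcom m x))

/-- `X □_D N` as a left `C`-comodule, a subcomodule of `X ⊗ N`. -/
def lcotensor [Module.Flat R C] (x : BiCoact R C D X) (n : LCoact R D N) :
    LCoact R C (cotensor x.right n) :=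
  (x.left.tens N).sub _ (LCoact.isSubcomodule_ker (cotensorMap_mem_lcom x n))

/-! ### Categories of comodules and functors between them -/

/-- The type of right `D`-comodules. -/
structure RComod (R D : Type u) [CommRing R] [AddCommGroup D] [Module R D] [Coalgebra R D] where
  carrier : Type u
  [instAddCommGroup : AddCommGroup carrier]
  [instModule : Module R carrier]
  coact : RCoact R D carrier

attribute [instance] RComod.instAddCommGroup RComod.instModule

/-- The type of left `C`-comodules. -/
structure LComod (R C : Type u) [CommRing R] [AddCommGroup C] [Module R C] [Coalgebra R C] where
  carrier : Type u
  [instAddCommGroup : AddCommGroup carrier]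
  [instModule : Module R carrier]
  coact : LCoact R C carrier

attribute [instance] LComod.instAddCommGroup LComod.instModule

namespace RComod

/-- The category of right `D`-comodules and colinear maps. -/
instance : Category (RComod R D) where
  Hom M N := RCoact.com M.coact N.coact
  id M := ⟨LinearMap.id, RCoact.id_mem_com M.coact⟩
  comp f g := ⟨g.1 ∘ₗ f.1, RCoact.comp_mem_com f.2 g.2⟩

/-- The linear map underlying a morphism. -/
def lin {M N : RComod R D} (f : M ⟶ N) : M.carrier →ₗ[R] N.carrier :=
  Subtype.val (p := (· ∈ RCoact.com M.coact N.coact)) f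

theorem lin_mem {M N : RComod R D} (f : M ⟶ N) : lin f ∈ RCoact.com M.coact N.coact :=
  Subtype.prop f

/-- A colinear map as a morphism. -/
def homMk {M N : RComod R D} (f : M.carrier →ₗ[R] N.carrier)
    (hf : f ∈ RCoact.com M.coact N.coact) : M ⟶ N := ⟨f, hf⟩

@[ext] theorem hom_ext {M N : RComod R D} {f g : M ⟶ N} (h : lin f = lin g) : f = g :=
  Subtype.ext h

/-- The functor `- ⊗ X` from `R`-modules to right `D`-comodules. -/
def tensorFunctor (x : RCoact R D X) : ModuleCat.{u} R ⥤ RComod R D where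
  obj W := ⟨W ⊗[R] X, RCoact.tens W x⟩
  map f := homMk (f.hom.rTensor X) (RCoact.rTensor_mem_com x f.hom)
  map_id W := hom_ext (LinearMap.rTensor_id X W)
  map_comp f g := hom_ext (LinearMap.rTensor_comp X g.hom f.hom)

/-- The functor `- □_C X` from right `C`-comodules to right `D`-comodules. -/
def cotensorFunctor [Module.Flat R D] (x : BiCoact R C D X) : RComod R C ⥤ RComod R D where
  obj M := ⟨cotensor M.coact x.left, rcotensor M.coact x⟩
  map {M _} f := homMk (cotensorMapLeft (lin f) (lin_mem f) x.left) <|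
    RCoact.mem_com_sub _ _ _ _ <| RCoact.comp_mem_com (f := Submodule.subtype _)
      (RCoact.subtype_mem_com _ _ (RCoact.isSubcomodule_ker (cotensorMap_mem_rcom M.coact x)))
      (RCoact.rTensor_mem_com x.right (lin f))
  map_id M := hom_ext <| LinearMap.ext fun t => Subtype.ext <|
    LinearMap.congr_fun (LinearMap.rTensor_id X M.carrier) t.1
  map_comp f g := hom_ext <| LinearMap.ext fun t => Subtype.ext <|
    LinearMap.congr_fun (LinearMap.rTensor_comp X (lin g) (lin f)) t.1

end RComod

namespace LComod

/-- The category of left `C`-comodules and colinear maps. -/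
instance : Category (LComod R C) where
  Hom M N := LCoact.com M.coact N.coact
  id M := ⟨LinearMap.id, LCoact.id_mem_com M.coact⟩
  comp f g := ⟨g.1 ∘ₗ f.1, LCoact.comp_mem_com f.2 g.2⟩

/-- The linear map underlying a morphism. -/
def lin {M N : LComod R C} (f : M ⟶ N) : M.carrier →ₗ[R] N.carrier :=
  Subtype.val (p := (· ∈ LCoact.com M.coact N.coact)) f

theorem lin_mem {M N : LComod R C} (f : M ⟶ N) : lin f ∈ LCoact.com M.coact N.coact :=
  Subtype.prop f

/-- A colinear map as a morphism. -/
def homMk {M N : LComod R C} (f : M.carrier →ₗ[R] N.carrier)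
    (hf : f ∈ LCoact.com M.coact N.coact) : M ⟶ N := ⟨f, hf⟩

@[ext] theorem hom_ext {M N : LComod R C} {f g : M ⟶ N} (h : lin f = lin g) : f = g :=
  Subtype.ext h

/-- The functor `X ⊗ -` from `R`-modules to left `C`-comodules. -/
def tensorFunctor (x : LCoact R C X) : ModuleCat.{u} R ⥤ LComod R C where
  obj W := ⟨X ⊗[R] W, LCoact.tens x W⟩
  map f := homMk (f.hom.lTensor X) (LCoact.lTensor_mem_com x f.hom)
  map_id W := hom_ext (LinearMap.lTensor_id X W)
  map_comp f g := hom_ext (LinearMap.lTensor_comp X g.hom f.hom)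

/-- The functor `X □_D -` from left `D`-comodules to left `C`-comodules. -/
def cotensorFunctor [Module.Flat R C] (x : BiCoact R C D X) : LComod R D ⥤ LComod R C where
  obj N := ⟨cotensor x.right N.coact, lcotensor x N.coact⟩
  map {M _} f := homMk (cotensorMapRight x.right (lin f) (lin_mem f)) <|
    LCoact.mem_com_sub _ _ _ _ <| LCoact.comp_mem_com (f := Submodule.subtype _)
      (LCoact.subtype_mem_com _ _ (LCoact.isSubcomodule_ker (cotensorMap_mem_lcom x M.coact)))
      (LCoact.lTensor_mem_com x.left (lin f))
  map_id M := hom_ext <| LinearMap.ext fun t => Subtype.ext <|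
    LinearMap.congr_fun (LinearMap.lTensor_id X M.carrier) t.1
  map_comp f g := hom_ext <| LinearMap.ext fun t => Subtype.ext <|
    LinearMap.congr_fun (LinearMap.lTensor_comp X (lin g) (lin f)) t.1

end LComod

/-- A right comodule `X` is quasi-finite if `- ⊗ X : R-Mod ⥤ M^D` has a left adjoint. -/
def RCoact.QuasiFinite (x : RCoact R D X) : Prop := (RComod.tensorFunctor x).IsRightAdjoint

/-- A left comodule `X` is quasi-finite if `X ⊗ - : R-Mod ⥤ ^C M` has a left adjoint. -/
def LCoact.QuasiFinite (x : LCoact R C X) : Prop := (LComod.tensorFunctor x).IsRightAdjoint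

/-- A bicomodule `X` is invertible if `- □_C X : M^C ⥤ M^D` is an equivalence. -/
def BiCoact.Invertible [Module.Flat R D] (x : BiCoact R C D X) : Prop :=
  (RComod.cotensorFunctor x).IsEquivalence


/-! ### The cohom functor

`IsCohom x m η` says that `η : M → H ⊗ X` is a universal colinear map, i.e. that `H` together
with `η` is `h_D(X,M)` with the unit of the adjunction. -/

/-- `η : M → H ⊗ X` is universal among the colinear maps `M → W ⊗ X`. -/
structure IsCohom {H : Type u} [AddCommGroup H] [Module R H] (x : RCoact R D X)
    (m : RCoact R D M) (η : M →ₗ[R] H ⊗[R] X) : Prop where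
  colinear : η ∈ RCoact.com m (RCoact.tens H x)
  exists_lift : ∀ (W : Type u) [AddCommGroup W] [Module R W] (f : M →ₗ[R] W ⊗[R] X),
    f ∈ RCoact.com m (RCoact.tens W x) → ∃ g : H →ₗ[R] W, g.rTensor X ∘ₗ η = f
  hom_ext : ∀ (W : Type u) [AddCommGroup W] [Module R W] (f g : H →ₗ[R] W),
    f.rTensor X ∘ₗ η = g.rTensor X ∘ₗ η → f = g

/-- `η : M → X ⊗ H` is universal among the colinear maps `M → X ⊗ W` of left comodules. -/
structure IsLCohom {H : Type u} [AddCommGroup H] [Module R H] (x : LCoact R C X)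
    (m : LCoact R C M) (η : M →ₗ[R] X ⊗[R] H) : Prop where
  colinear : η ∈ LCoact.com m (LCoact.tens x H)
  exists_lift : ∀ (W : Type u) [AddCommGroup W] [Module R W] (f : M →ₗ[R] X ⊗[R] W),
    f ∈ LCoact.com m (LCoact.tens x W) → ∃ g : H →ₗ[R] W, g.lTensor X ∘ₗ η = f
  hom_ext : ∀ (W : Type u) [AddCommGroup W] [Module R W] (f g : H →ₗ[R] W),
    f.lTensor X ∘ₗ η = g.lTensor X ∘ₗ η → f = g

namespace IsCohom

variable {A H H' : Type u} [AddCommGroup A] [Module R A] [AddCommGroup H] [Module R H]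
  [AddCommGroup H'] [Module R H']

theorem aux_nat (f : H →ₗ[R] H') (l : X →ₗ[R] A ⊗[R] X) :
    (f.rTensor A).rTensor X ∘ₗ (TensorProduct.assoc R H A X).symm.toLinearMap ∘ₗ l.lTensor H =
      (TensorProduct.assoc R H' A X).symm.toLinearMap ∘ₗ l.lTensor H' ∘ₗ f.rTensor X := by
  refine TensorProduct.ext' fun h y => ?_
  simp only [LinearMap.comp_apply, LinearMap.lTensor_tmul, LinearMap.rTensor_tmul,
    LinearEquiv.coe_coe]
  generalize l y = s
  induction s using TensorProduct.induction_on with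
  | zero => simp
  | tmul => simp
  | add x y hx hy => simp only [tmul_add, map_add, hx, hy]

theorem aux_one {η : M →ₗ[R] H ⊗[R] X} {l : X →ₗ[R] A ⊗[R] X} {ρ : H →ₗ[R] H ⊗[R] A}
    (hρ : ρ.rTensor X ∘ₗ η =
      (TensorProduct.assoc R H A X).symm.toLinearMap ∘ₗ l.lTensor H ∘ₗ η) :
    ((TensorProduct.assoc R H A A).toLinearMap ∘ₗ ρ.rTensor A ∘ₗ ρ).rTensor X ∘ₗ η =
      (TensorProduct.assoc R H (A ⊗[R] A) X).symm.toLinearMap ∘ₗ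
        (TensorProduct.assoc R A A X).symm.toLinearMap.lTensor H ∘ₗ
        (l.lTensor A ∘ₗ l).lTensor H ∘ₗ η := by
  have e : (TensorProduct.assoc R H A A).toLinearMap.rTensor X ∘ₗ
      (TensorProduct.assoc R (H ⊗[R] A) A X).symm.toLinearMap ∘ₗ l.lTensor (H ⊗[R] A) ∘ₗ
      (TensorProduct.assoc R H A X).symm.toLinearMap =
      (TensorProduct.assoc R H (A ⊗[R] A) X).symm.toLinearMap ∘ₗ
        (TensorProduct.assoc R A A X).symm.toLinearMap.lTensor H ∘ₗ (l.lTensor A).lTensor H := by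
    refine TensorProduct.ext' fun h t => ?_
    induction t using TensorProduct.induction_on with
    | zero => simp
    | tmul a y =>
      simp only [LinearMap.comp_apply, LinearMap.lTensor_tmul, LinearEquiv.coe_coe,
        assoc_symm_tmul]
      generalize l y = s
      induction s using TensorProduct.induction_on with
      | zero => simp
      | tmul => simp
      | add x y hx hy => simp only [tmul_add, map_add, hx, hy]
    | add x y hx hy => simp only [tmul_add, map_add, hx, hy]
  refine LinearMap.ext fun y => ?_
  have h1 := LinearMap.congr_fun hρ y
  have h2 := LinearMap.congr_fun (aux_nat ρ l) (η y)
  have h3 := LinearMap.congr_fun e (l.lTensor H (η y))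
  simp only [LinearMap.comp_apply, LinearEquiv.coe_coe, LinearMap.rTensor_comp,
    LinearMap.lTensor_comp] at *
  rw [h1, h2, h1, h3]

theorem aux_two {η : M →ₗ[R] H ⊗[R] X} {l : X →ₗ[R] A ⊗[R] X} {ρ : H →ₗ[R] H ⊗[R] A}
    (hρ : ρ.rTensor X ∘ₗ η =
      (TensorProduct.assoc R H A X).symm.toLinearMap ∘ₗ l.lTensor H ∘ₗ η)
    (Δ : A →ₗ[R] A ⊗[R] A) :
    (Δ.lTensor H ∘ₗ ρ).rTensor X ∘ₗ η =
      (TensorProduct.assoc R H (A ⊗[R] A) X).symm.toLinearMap ∘ₗ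
        (TensorProduct.assoc R A A X).symm.toLinearMap.lTensor H ∘ₗ
        ((TensorProduct.assoc R A A X).toLinearMap ∘ₗ Δ.rTensor X ∘ₗ l).lTensor H ∘ₗ η := by
  have e : (Δ.lTensor H).rTensor X ∘ₗ (TensorProduct.assoc R H A X).symm.toLinearMap =
      (TensorProduct.assoc R H (A ⊗[R] A) X).symm.toLinearMap ∘ₗ (Δ.rTensor X).lTensor H := by
    refine TensorProduct.ext' fun h t => ?_
    induction t using TensorProduct.induction_on with
    | zero => simp
    | tmul a y => simp
    | add x y hx hy => simp only [tmul_add, map_add, hx, hy]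
  have e' : (TensorProduct.assoc R A A X).symm.toLinearMap.lTensor H ∘ₗ
      (TensorProduct.assoc R A A X).toLinearMap.lTensor H = LinearMap.id := by
    rw [← LinearMap.lTensor_comp]; simp
  refine LinearMap.ext fun y => ?_
  have h1 := LinearMap.congr_fun hρ y
  have h3 := LinearMap.congr_fun e (l.lTensor H (η y))
  have h4 := LinearMap.congr_fun e' ((Δ.rTensor X).lTensor H (l.lTensor H (η y)))
  simp only [LinearMap.comp_apply, LinearEquiv.coe_coe, LinearMap.rTensor_comp,
    LinearMap.lTensor_comp, LinearMap.id_apply] at *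
  rw [h1, h3, h4]

theorem aux_three {η : M →ₗ[R] H ⊗[R] X} {l : X →ₗ[R] A ⊗[R] X} {ρ : H →ₗ[R] H ⊗[R] A}
    (hρ : ρ.rTensor X ∘ₗ η =
      (TensorProduct.assoc R H A X).symm.toLinearMap ∘ₗ l.lTensor H ∘ₗ η)
    (ε : A →ₗ[R] R)
    (hl : (TensorProduct.lid R X).toLinearMap ∘ₗ ε.rTensor X ∘ₗ l = LinearMap.id) :
    ((TensorProduct.rid R H).toLinearMap ∘ₗ ε.lTensor H ∘ₗ ρ).rTensor X ∘ₗ η =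
      (LinearMap.id : H →ₗ[R] H).rTensor X ∘ₗ η := by
  have e : ((TensorProduct.rid R H).toLinearMap ∘ₗ ε.lTensor H).rTensor X ∘ₗ
      (TensorProduct.assoc R H A X).symm.toLinearMap =
      ((TensorProduct.lid R X).toLinearMap ∘ₗ ε.rTensor X).lTensor H := by
    refine TensorProduct.ext' fun h t => ?_
    induction t using TensorProduct.induction_on with
    | zero => simp
    | tmul a y => simp [smul_tmul']
    | add x y hx hy => simp only [tmul_add, map_add, hx, hy]
  refine LinearMap.ext fun y => ?_
  have h1 := LinearMap.congr_fun hρ y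
  have h3 := LinearMap.congr_fun e (l.lTensor H (η y))
  have h4 := LinearMap.congr_fun (congrArg (LinearMap.lTensor H) hl) (η y)
  simp only [LinearMap.comp_apply, LinearEquiv.coe_coe, LinearMap.rTensor_comp,
    LinearMap.lTensor_comp, LinearMap.id_apply, LinearMap.lTensor_id, LinearMap.rTensor_id] at *
  rw [h1, h3, h4]


variable {H : Type u} [AddCommGroup H] [Module R H] {x : RCoact R D X} {m : RCoact R D M}
  {η : M →ₗ[R] H ⊗[R] X}

/-- The linear map `H → W` corresponding to a colinear map `M → W ⊗ X`. -/
def lift (hη : IsCohom x m η) (f : M →ₗ[R] W ⊗[R] X) (hf : f ∈ RCoact.com m (RCoact.tens W x)) :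
    H →ₗ[R] W := (hη.exists_lift W f hf).choose

theorem lift_spec (hη : IsCohom x m η) (f : M →ₗ[R] W ⊗[R] X)
    (hf : f ∈ RCoact.com m (RCoact.tens W x)) : (hη.lift f hf).rTensor X ∘ₗ η = f :=
  (hη.exists_lift W f hf).choose_spec

theorem assocSymm_mem_com (A : Type u) [AddCommGroup A] [Module R A] (x : RCoact R D X) :
    (TensorProduct.assoc R W A X).symm.toLinearMap ∈
      RCoact.com (RCoact.tens W (RCoact.tens A x)) (RCoact.tens (W ⊗[R] A) x) :=
  RCoact.symm_mem_com _ (RCoact.assoc_mem_com W A x)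

section Coact

/-- If `X` is a `C`-`D`-bicomodule, the right `C`-coaction `ρ` on `h_D(X,M)`, determined by
`(ρ ⊗ id) η = (id ⊗ ρ_X) η` with `ρ_X : X → C ⊗ X` the left coaction of `X`. -/
def coactMap {x : BiCoact R C D X} (hη : IsCohom x.right m η) : H →ₗ[R] H ⊗[R] C :=
  hη.lift ((TensorProduct.assoc R H C X).symm.toLinearMap ∘ₗ x.left.map.lTensor H ∘ₗ η) <|
    RCoact.comp_mem_com (RCoact.comp_mem_com hη.colinear (RCoact.lTensor_mem_com H x.colinear))
      (assocSymm_mem_com C x.right)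

theorem coactMap_spec {x : BiCoact R C D X} (hη : IsCohom x.right m η) :
    hη.coactMap.rTensor X ∘ₗ η =
      (TensorProduct.assoc R H C X).symm.toLinearMap ∘ₗ x.left.map.lTensor H ∘ₗ η :=
  hη.lift_spec _ _

/-- `h_D(X,M)` as a right `C`-comodule, for a `C`-`D`-bicomodule `X`. -/
def coact {x : BiCoact R C D X} (hη : IsCohom x.right m η) : RCoact R C H where
  map := hη.coactMap
  coassoc := hη.hom_ext _ _ _ <| by
    rw [aux_one hη.coactMap_spec, aux_two hη.coactMap_spec, x.left.coassoc]
  counit := by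
    exact hη.hom_ext _ _ _ (aux_three hη.coactMap_spec _ x.left.counit)

/-- The maps between cohom modules induced by colinear maps are `C`-colinear. -/
theorem coact_natural {x : BiCoact R C D X} (hη : IsCohom x.right m η) {n : RCoact R D N}
    {H' : Type u} [AddCommGroup H'] [Module R H'] {η' : N →ₗ[R] H' ⊗[R] X}
    (hη' : IsCohom x.right n η') {f : M →ₗ[R] N} {g : H →ₗ[R] H'}
    (hg : g.rTensor X ∘ₗ η = η' ∘ₗ f) : g ∈ RCoact.com hη.coact hη'.coact := by
  rw [RCoact.mem_com]
  refine hη.hom_ext _ _ _ (LinearMap.ext fun y => ?_)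
  have h1 := LinearMap.congr_fun hη.coactMap_spec y
  have h2 := LinearMap.congr_fun hη'.coactMap_spec (f y)
  have h3 := LinearMap.congr_fun (aux_nat g x.left.map) (η y)
  have h4 := LinearMap.congr_fun hg y
  simp only [coact, LinearMap.comp_apply, LinearMap.rTensor_comp, LinearEquiv.coe_coe] at *
  rw [h1, h3, h4, h2]

end Coact

section Coend

variable {E : Type u} [AddCommGroup E] [Module R E] {η : X →ₗ[R] E ⊗[R] X}

/-- The comultiplication of `e_D(X) = h_D(X,X)`, determined by `(Δ ⊗ id) η = (id ⊗ η) η`. -/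
def comul (hη : IsCohom x x η) : E →ₗ[R] E ⊗[R] E :=
  hη.lift ((TensorProduct.assoc R E E X).symm.toLinearMap ∘ₗ η.lTensor E ∘ₗ η) <|
    RCoact.comp_mem_com (RCoact.comp_mem_com hη.colinear (RCoact.lTensor_mem_com E hη.colinear))
      (assocSymm_mem_com E x)

theorem comul_spec (hη : IsCohom x x η) : hη.comul.rTensor X ∘ₗ η =
    (TensorProduct.assoc R E E X).symm.toLinearMap ∘ₗ η.lTensor E ∘ₗ η :=
  hη.lift_spec _ _

theorem lidSymm_mem_com (x : RCoact R D X) :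
    (TensorProduct.lid R X).symm.toLinearMap ∈ RCoact.com x (RCoact.tens R x) := by
  rw [RCoact.mem_com]
  refine LinearMap.ext fun y => ?_
  simp only [RCoact.tens, LinearMap.comp_apply, LinearEquiv.coe_coe, lid_symm_apply,
    LinearMap.lTensor_tmul]
  generalize x.map y = s
  induction s using TensorProduct.induction_on with
  | zero => simp
  | tmul => simp
  | add x y hx hy => simp only [tmul_add, map_add, hx, hy]

/-- The counit of `e_D(X) = h_D(X,X)`, corresponding to `X ≅ R ⊗ X`. -/
def counit (hη : IsCohom x x η) : E →ₗ[R] R :=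
  hη.lift (TensorProduct.lid R X).symm.toLinearMap (lidSymm_mem_com x)

theorem counit_spec (hη : IsCohom x x η) : hη.counit.rTensor X ∘ₗ η =
    (TensorProduct.lid R X).symm.toLinearMap :=
  hη.lift_spec _ _

/-- The coendomorphism coalgebra `e_D(X) = h_D(X,X)`. -/
abbrev coalgebra (hη : IsCohom x x η) : Coalgebra R E where
  comul := hη.comul
  counit := hη.counit
  coassoc := hη.hom_ext _ _ _ <| by
    have e : (TensorProduct.assoc R E E X).toLinearMap ∘ₗ hη.comul.rTensor X ∘ₗ η =
        η.lTensor E ∘ₗ η := by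
      rw [hη.comul_spec, ← LinearMap.comp_assoc]; simp
    rw [aux_one hη.comul_spec, aux_two hη.comul_spec, e]
  rTensor_counit_comp_comul := hη.hom_ext _ _ _ <| by
    refine LinearMap.ext fun y => ?_
    have e : (hη.counit.rTensor E).rTensor X ∘ₗ
        (TensorProduct.assoc R E E X).symm.toLinearMap ∘ₗ η.lTensor E =
        (TensorProduct.assoc R R E X).symm.toLinearMap ∘ₗ η.lTensor R ∘ₗ hη.counit.rTensor X :=
      aux_nat hη.counit η
    have h1 := LinearMap.congr_fun hη.comul_spec y
    have h2 := LinearMap.congr_fun e (η y)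
    have h3 := LinearMap.congr_fun hη.counit_spec y
    simp only [LinearMap.comp_apply, LinearMap.rTensor_comp, LinearEquiv.coe_coe] at *
    rw [h1, h2, h3]
    simp only [lid_symm_apply, LinearMap.lTensor_tmul]
    generalize η y = s
    induction s using TensorProduct.induction_on with
    | zero => simp
    | tmul => simp
    | add x y hx hy => simp only [tmul_add, map_add, hx, hy]
  lTensor_counit_comp_comul := by
    have h0 : (TensorProduct.lid R X).toLinearMap ∘ₗ hη.counit.rTensor X ∘ₗ η = LinearMap.id := by
      rw [hη.counit_spec]; simp
    have h : (TensorProduct.rid R E).toLinearMap ∘ₗ hη.counit.lTensor E ∘ₗ hη.comul =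
        LinearMap.id := hη.hom_ext _ _ _ (aux_three hη.comul_spec _ h0)
    refine LinearMap.ext fun y => (TensorProduct.rid R E).injective ?_
    simpa using LinearMap.congr_fun h y

/-- For a `C`-`D`-bicomodule `X`: there is an isomorphism of coalgebras `e_D(X) ≅ C` carrying the
canonical left `e_D(X)`-coaction `η` of `X` to the given left `C`-coaction. -/
def CoendIso {x : BiCoact R C D X} (hη : IsCohom x.right x.right η) : Prop :=
  letI := hη.coalgebra
  ∃ φ : E ≃ₗc[R] C, φ.toLinearMap.rTensor X ∘ₗ η = x.left.map

end Coend

section LeftCoact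

variable {E : Type u} [AddCommGroup E] [Module R E] [Coalgebra R E]

/-- If `M` is an `E`-`D`-bicomodule, the left `E`-coaction `l` on `h_D(X,M)`, determined by
`(l ⊗ id) η = (id ⊗ η) ρ_M` with `ρ_M : M → E ⊗ M` the left coaction of `M`. -/
def lcoactMap {m : BiCoact R E D M} (hη : IsCohom x m.right η) : H →ₗ[R] E ⊗[R] H :=
  hη.lift ((TensorProduct.assoc R E H X).symm.toLinearMap ∘ₗ η.lTensor E ∘ₗ m.left.map) <|
    RCoact.comp_mem_com (RCoact.comp_mem_com m.colinear (RCoact.lTensor_mem_com E hη.colinear))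
      (assocSymm_mem_com H x)

theorem lcoactMap_spec {m : BiCoact R E D M} (hη : IsCohom x m.right η) :
    hη.lcoactMap.rTensor X ∘ₗ η =
      (TensorProduct.assoc R E H X).symm.toLinearMap ∘ₗ η.lTensor E ∘ₗ m.left.map :=
  hη.lift_spec _ _

/-- `h_D(X,M)` as a left `E`-comodule, for an `E`-`D`-bicomodule `M`. -/
def lcoact {m : BiCoact R E D M} (hη : IsCohom x m.right η) : LCoact R E H where
  map := hη.lcoactMap
  coassoc := hη.hom_ext _ _ _ <| by
    refine LinearMap.ext fun y => ?_
    have e1 : (hη.lcoactMap.lTensor E).rTensor X ∘ₗ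
        (TensorProduct.assoc R E H X).symm.toLinearMap =
        (TensorProduct.assoc R E (E ⊗[R] H) X).symm.toLinearMap ∘ₗ
          (hη.lcoactMap.rTensor X).lTensor E := by
      refine TensorProduct.ext' fun h t => ?_
      induction t using TensorProduct.induction_on with
      | zero => simp
      | tmul a y => simp
      | add x y hx hy => simp only [tmul_add, map_add, hx, hy]
    have e2 : (TensorProduct.assoc R E E H).toLinearMap.rTensor X ∘ₗ
        ((Coalgebra.comul (R := R) (A := E)).rTensor H).rTensor X ∘ₗ
        (TensorProduct.assoc R E H X).symm.toLinearMap ∘ₗ η.lTensor E =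
        (TensorProduct.assoc R E (E ⊗[R] H) X).symm.toLinearMap ∘ₗ
          (TensorProduct.assoc R E H X).symm.toLinearMap.lTensor E ∘ₗ
          (η.lTensor E).lTensor E ∘ₗ (TensorProduct.assoc R E E M).toLinearMap ∘ₗ
          (Coalgebra.comul (R := R) (A := E)).rTensor M := by
      refine TensorProduct.ext' fun a z => ?_
      simp only [LinearMap.comp_apply, LinearMap.lTensor_tmul, LinearMap.rTensor_tmul,
        LinearEquiv.coe_coe]
      generalize hc : (Coalgebra.comul (R := R) a) = t
      have hs : ∀ s : H ⊗[R] X, ((TensorProduct.assoc R E E H).toLinearMap.rTensor X)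
          (((Coalgebra.comul (R := R) (A := E)).rTensor H).rTensor X
            ((TensorProduct.assoc R E H X).symm (a ⊗ₜ s))) =
          (TensorProduct.assoc R E E H).toLinearMap.rTensor X
            ((TensorProduct.assoc R (E ⊗[R] E) H X).symm (t ⊗ₜ s)) := by
        intro s
        induction s using TensorProduct.induction_on with
        | zero => simp
        | tmul => simp [hc]
        | add x y hx hy => simp only [tmul_add, map_add, hx, hy]
      rw [hs]
      clear hs hc
      induction t using TensorProduct.induction_on with
      | zero => simp
      | tmul b c =>
        simp only [assoc_tmul, LinearMap.lTensor_tmul]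
        generalize η z = s
        induction s using TensorProduct.induction_on with
        | zero => simp
        | tmul => simp
        | add x y hx hy => simp only [tmul_add, map_add, hx, hy]
      | add x y hx hy => simp only [add_tmul, map_add, hx, hy]
    have h1 := LinearMap.congr_fun hη.lcoactMap_spec y
    have h2 := LinearMap.congr_fun e1 (η.lTensor E (m.left.map y))
    have h3 := LinearMap.congr_fun e2 (m.left.map y)
    have h4 := LinearMap.congr_fun (congrArg (LinearMap.lTensor E) hη.lcoactMap_spec)
      (m.left.map y)
    have h5 := LinearMap.congr_fun m.left.coassoc y
    simp only [LinearMap.comp_apply, LinearMap.rTensor_comp, LinearMap.lTensor_comp,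
      LinearEquiv.coe_coe] at *
    rw [h1, h2, h3, h4, h5]
  counit := hη.hom_ext _ _ _ <| by
    refine LinearMap.ext fun y => ?_
    have e : (TensorProduct.lid R H).toLinearMap.rTensor X ∘ₗ
        ((Coalgebra.counit (R := R) (A := E)).rTensor H).rTensor X ∘ₗ
        (TensorProduct.assoc R E H X).symm.toLinearMap ∘ₗ η.lTensor E =
        η ∘ₗ (TensorProduct.lid R M).toLinearMap ∘ₗ
          (Coalgebra.counit (R := R) (A := E)).rTensor M := by
      refine TensorProduct.ext' fun a z => ?_
      simp only [LinearMap.comp_apply, LinearMap.lTensor_tmul, LinearMap.rTensor_tmul,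
        LinearEquiv.coe_coe, lid_tmul, map_smul]
      generalize η z = s
      induction s using TensorProduct.induction_on with
      | zero => simp
      | tmul => simp [smul_tmul']
      | add x y hx hy => simp only [tmul_add, map_add, smul_add, hx, hy]
    have h1 := LinearMap.congr_fun hη.lcoactMap_spec y
    have h3 := LinearMap.congr_fun e (m.left.map y)
    have h5 := LinearMap.congr_fun m.left.counit y
    simp only [LinearMap.comp_apply, LinearMap.rTensor_comp,
      LinearEquiv.coe_coe, LinearMap.rTensor_id, LinearMap.id_apply] at *
    rw [h1, h3, h5]

/-- `h_D(X,M)` as an `E`-`C`-bicomodule, for a `C`-`D`-bicomodule `X` and an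
`E`-`D`-bicomodule `M`. -/
def bicoact {x : BiCoact R C D X} {m : BiCoact R E D M} (hη : IsCohom x.right m.right η) :
    BiCoact R E C H where
  left := hη.lcoact
  right := hη.coact
  colinear := by
    rw [RCoact.mem_com]
    refine hη.hom_ext _ _ _ (LinearMap.ext fun y => ?_)
    have e1 : (TensorProduct.assoc R E H C).symm.toLinearMap.rTensor X ∘ₗ
        (hη.coactMap.lTensor E).rTensor X ∘ₗ (TensorProduct.assoc R E H X).symm.toLinearMap =
        (TensorProduct.assoc R E H C).symm.toLinearMap.rTensor X ∘ₗ
        (TensorProduct.assoc R E (H ⊗[R] C) X).symm.toLinearMap ∘ₗ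
          (hη.coactMap.rTensor X).lTensor E := by
      refine TensorProduct.ext' fun h t => ?_
      induction t using TensorProduct.induction_on with
      | zero => simp
      | tmul a y => simp
      | add x y hx hy => simp only [tmul_add, map_add, hx, hy]
    have e2 : (TensorProduct.assoc R (E ⊗[R] H) C X).symm.toLinearMap ∘ₗ
        x.left.map.lTensor (E ⊗[R] H) ∘ₗ (TensorProduct.assoc R E H X).symm.toLinearMap =
        (TensorProduct.assoc R E H C).symm.toLinearMap.rTensor X ∘ₗ
        (TensorProduct.assoc R E (H ⊗[R] C) X).symm.toLinearMap ∘ₗ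
        (TensorProduct.assoc R H C X).symm.toLinearMap.lTensor E ∘ₗ
        (x.left.map.lTensor H).lTensor E := by
      refine TensorProduct.ext' fun h t => ?_
      induction t using TensorProduct.induction_on with
      | zero => simp
      | tmul a y =>
        simp only [LinearMap.comp_apply, LinearMap.lTensor_tmul, LinearEquiv.coe_coe,
          assoc_symm_tmul]
        generalize x.left.map y = s
        induction s using TensorProduct.induction_on with
        | zero => simp
        | tmul => simp
        | add x y hx hy => simp only [tmul_add, map_add, hx, hy]
      | add x y hx hy => simp only [tmul_add, map_add, hx, hy]
    have h1 := LinearMap.congr_fun hη.lcoactMap_spec y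
    have h2 := LinearMap.congr_fun e1 (η.lTensor E (m.left.map y))
    have h3 := LinearMap.congr_fun e2 (η.lTensor E (m.left.map y))
    have h4 := LinearMap.congr_fun (congrArg (LinearMap.lTensor E) hη.coactMap_spec)
      (m.left.map y)
    have h5 := LinearMap.congr_fun hη.coactMap_spec y
    have h6 := LinearMap.congr_fun (aux_nat hη.lcoactMap x.left.map) (η y)
    simp only [RCoact.tens, coact, lcoact, LinearMap.comp_apply, LinearMap.rTensor_comp,
      LinearMap.lTensor_comp, LinearEquiv.coe_coe] at *
    rw [h1, h2, h4, h5, h6, h1, h3]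

end LeftCoact

end IsCohom

namespace IsLCohom

variable {H : Type u} [AddCommGroup H] [Module R H] {x : LCoact R C X} {m : LCoact R C M}
  {η : M →ₗ[R] X ⊗[R] H}

/-- The linear map `H → W` corresponding to a colinear map `M → X ⊗ W`. -/
def lift (hη : IsLCohom x m η) (f : M →ₗ[R] X ⊗[R] W) (hf : f ∈ LCoact.com m (LCoact.tens x W)) :
    H →ₗ[R] W := (hη.exists_lift W f hf).choose

theorem lift_spec (hη : IsLCohom x m η) (f : M →ₗ[R] X ⊗[R] W)
    (hf : f ∈ LCoact.com m (LCoact.tens x W)) : (hη.lift f hf).lTensor X ∘ₗ η = f :=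
  (hη.exists_lift W f hf).choose_spec

variable {E : Type u} [AddCommGroup E] [Module R E] {η : X →ₗ[R] X ⊗[R] E}

/-- The comultiplication of `e_C(X) = h_C(X,X)`, determined by `(id ⊗ Δ) η = (η ⊗ id) η`. -/
def comul (hη : IsLCohom x x η) : E →ₗ[R] E ⊗[R] E :=
  hη.lift ((TensorProduct.assoc R X E E).toLinearMap ∘ₗ η.rTensor E ∘ₗ η) <|
    LCoact.comp_mem_com (LCoact.comp_mem_com hη.colinear (LCoact.rTensor_mem_com E hη.colinear))
      (LCoact.assoc_mem_com x E E)

theorem comul_spec (hη : IsLCohom x x η) : hη.comul.lTensor X ∘ₗ η =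
    (TensorProduct.assoc R X E E).toLinearMap ∘ₗ η.rTensor E ∘ₗ η :=
  hη.lift_spec _ _

theorem ridSymm_mem_com (x : LCoact R C X) :
    (TensorProduct.rid R X).symm.toLinearMap ∈ LCoact.com x (LCoact.tens x R) := by
  rw [LCoact.mem_com]
  refine LinearMap.ext fun y => ?_
  simp only [LCoact.tens, LinearMap.comp_apply, LinearEquiv.coe_coe, rid_symm_apply,
    LinearMap.rTensor_tmul]
  generalize x.map y = s
  induction s using TensorProduct.induction_on with
  | zero => simp
  | tmul => simp
  | add x y hx hy => simp only [add_tmul, map_add, hx, hy]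

/-- The counit of `e_C(X) = h_C(X,X)`, corresponding to `X ≅ X ⊗ R`. -/
def counit (hη : IsLCohom x x η) : E →ₗ[R] R :=
  hη.lift (TensorProduct.rid R X).symm.toLinearMap (ridSymm_mem_com x)

theorem counit_spec (hη : IsLCohom x x η) : hη.counit.lTensor X ∘ₗ η =
    (TensorProduct.rid R X).symm.toLinearMap :=
  hη.lift_spec _ _

theorem aux_nat (f : E →ₗ[R] W) (l : X →ₗ[R] X ⊗[R] V) :
    (f.lTensor V).lTensor X ∘ₗ (TensorProduct.assoc R X V E).toLinearMap ∘ₗ l.rTensor E =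
      (TensorProduct.assoc R X V W).toLinearMap ∘ₗ l.rTensor W ∘ₗ f.lTensor X := by
  refine TensorProduct.ext' fun y h => ?_
  simp only [LinearMap.comp_apply, LinearMap.lTensor_tmul, LinearMap.rTensor_tmul,
    LinearEquiv.coe_coe]
  generalize l y = s
  induction s using TensorProduct.induction_on with
  | zero => simp
  | tmul => simp
  | add x y hx hy => simp only [add_tmul, map_add, hx, hy]

/-- The coendomorphism coalgebra `e_C(X) = h_C(X,X)` of a left comodule. -/
abbrev coalgebra (hη : IsLCohom x x η) : Coalgebra R E where
  comul := hη.comul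
  counit := hη.counit
  coassoc := hη.hom_ext _ _ _ <| by
    refine LinearMap.ext fun y => ?_
    have e1 : (hη.comul.rTensor E).lTensor X ∘ₗ (TensorProduct.assoc R X E E).toLinearMap =
        (TensorProduct.assoc R X (E ⊗[R] E) E).toLinearMap ∘ₗ
          (hη.comul.lTensor X).rTensor E :=
      TensorProduct.ext_threefold fun _ _ _ => rfl
    have e2 : (TensorProduct.assoc R E E E).toLinearMap.lTensor X ∘ₗ
        (TensorProduct.assoc R X (E ⊗[R] E) E).toLinearMap ∘ₗ
        (TensorProduct.assoc R X E E).toLinearMap.rTensor E ∘ₗ (η.rTensor E).rTensor E =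
        (TensorProduct.assoc R X E (E ⊗[R] E)).toLinearMap ∘ₗ η.rTensor (E ⊗[R] E) ∘ₗ
          (TensorProduct.assoc R X E E).toLinearMap := by
      refine TensorProduct.ext_threefold fun z a b => ?_
      simp only [LinearMap.comp_apply, LinearMap.rTensor_tmul, LinearEquiv.coe_coe, assoc_tmul]
      generalize η z = s
      induction s using TensorProduct.induction_on with
      | zero => simp
      | tmul => simp
      | add x y hx hy => simp only [add_tmul, map_add, hx, hy]
    have h1 := LinearMap.congr_fun hη.comul_spec y
    have h2 := LinearMap.congr_fun e1 (η.rTensor E (η y))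
    have h3 := LinearMap.congr_fun e2 (η.rTensor E (η y))
    have h4 := LinearMap.congr_fun (congrArg (LinearMap.rTensor E) hη.comul_spec) (η y)
    have h5 := LinearMap.congr_fun (aux_nat hη.comul η) (η y)
    simp only [LinearMap.comp_apply, LinearMap.rTensor_comp, LinearMap.lTensor_comp,
      LinearEquiv.coe_coe] at *
    rw [h1, h2, h4, h3, h5, h1]
  rTensor_counit_comp_comul := by
    have h : (TensorProduct.lid R E).toLinearMap ∘ₗ hη.counit.rTensor E ∘ₗ hη.comul =
        LinearMap.id := hη.hom_ext _ _ _ <| by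
      refine LinearMap.ext fun y => ?_
      have e : (TensorProduct.lid R E).toLinearMap.lTensor X ∘ₗ
          (hη.counit.rTensor E).lTensor X ∘ₗ (TensorProduct.assoc R X E E).toLinearMap =
          (TensorProduct.rid R X).toLinearMap.rTensor E ∘ₗ (hη.counit.lTensor X).rTensor E :=
        TensorProduct.ext_threefold fun _ _ _ => by simp [smul_tmul]
      have h1 := LinearMap.congr_fun hη.comul_spec y
      have h2 := LinearMap.congr_fun e (η.rTensor E (η y))
      have h0 : (TensorProduct.rid R X).toLinearMap ∘ₗ hη.counit.lTensor X ∘ₗ η =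
          LinearMap.id := by
        rw [hη.counit_spec]; simp
      have h3 := LinearMap.congr_fun (congrArg (LinearMap.rTensor E) h0) (η y)
      simp only [LinearMap.comp_apply, LinearMap.rTensor_comp, LinearMap.lTensor_comp,
        LinearEquiv.coe_coe, LinearMap.lTensor_id, LinearMap.rTensor_id,
        LinearMap.id_apply] at *
      rw [h1, h2, h3]
    refine LinearMap.ext fun y => (TensorProduct.lid R E).injective ?_
    simpa using LinearMap.congr_fun h y
  lTensor_counit_comp_comul := hη.hom_ext _ _ _ <| by
    refine LinearMap.ext fun y => ?_
    have h1 := LinearMap.congr_fun hη.comul_spec y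
    have h2 := LinearMap.congr_fun (aux_nat hη.counit η) (η y)
    have h3 := LinearMap.congr_fun hη.counit_spec y
    simp only [LinearMap.comp_apply, LinearMap.lTensor_comp, LinearEquiv.coe_coe] at *
    rw [h1, h2, h3]
    simp only [rid_symm_apply, LinearMap.rTensor_tmul]
    generalize η y = s
    induction s using TensorProduct.induction_on with
    | zero => simp
    | tmul => simp
    | add x y hx hy => simp only [add_tmul, map_add, hx, hy]

/-- For a `C`-`D`-bicomodule `X`: there is an isomorphism of coalgebras `e_C(X) ≅ D` carrying the
canonical right `e_C(X)`-coaction `η` of `X` to the given right `D`-coaction. -/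
def CoendIso {x : BiCoact R C D X} (hη : IsLCohom x.left x.left η) : Prop :=
  letI := hη.coalgebra
  ∃ φ : E ≃ₗc[R] D, φ.toLinearMap.lTensor X ∘ₗ η = x.right.map

end IsLCohom


/-! ### Duals of finitely generated comodules -/

/-- `V ⊗ N^* → Hom_R(N,V)`, `v ⊗ f ↦ (n ↦ f(n) v)`. -/
def contract (R V N : Type u) [CommRing R] [AddCommGroup V] [Module R V] [AddCommGroup N]
    [Module R N] : V ⊗[R] Module.Dual R N →ₗ[R] N →ₗ[R] V :=
  dualTensorHom R N V ∘ₗ (TensorProduct.comm R V (Module.Dual R N)).toLinearMap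

@[simp] theorem contract_tmul (v : V) (f : Module.Dual R N) (n : N) :
    contract R V N (v ⊗ₜ f) n = f n • v := by
  simp [contract]

theorem contract_injective [Module.Projective R V] : Function.Injective (contract R V N) := by
  obtain ⟨s, hs⟩ := (Module.projective_def' (R := R) (P := V)).1 inferInstance
  classical
  let e := TensorProduct.finsuppScalarLeft R (Module.Dual R N) V
  have hinj : Function.Injective (s.rTensor (Module.Dual R N)) := by
    refine Function.LeftInverse.injective
      (g := (Finsupp.linearCombination R (id : V → V)).rTensor (Module.Dual R N)) fun t => ?_
    rw [← LinearMap.comp_apply, ← LinearMap.rTensor_comp, hs]; simp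
  have key : ∀ (t : V ⊗[R] Module.Dual R N) (v : V) (n : N),
      e (s.rTensor (Module.Dual R N) t) v n = s (contract R V N t n) v := by
    intro t v n
    induction t using TensorProduct.induction_on with
    | zero => simp
    | tmul w f => simp [e, TensorProduct.finsuppScalarLeft_apply_tmul_apply, mul_comm]
    | add x y hx hy => simp [hx, hy]
  rw [injective_iff_map_eq_zero]
  intro t ht
  refine hinj (e.injective ?_)
  ext v n
  rw [key, ht]; simp

theorem contract_surjective [Module.Projective R V] [Module.Finite R N] :
    Function.Surjective (contract R V N) := by
  classical
  intro g
  obtain ⟨s, hs⟩ := (Module.projective_def' (R := R) (P := V)).1 inferInstance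
  obtain ⟨S, hS⟩ := Module.Finite.fg_top (R := R) (M := N)
  let T : Finset V := S.biUnion fun n => (s (g n)).support
  have hT : ∀ n : N, (s (g n)).support ⊆ T := by
    intro n
    have hn : n ∈ Submodule.span R (S : Set N) := hS ▸ Submodule.mem_top
    have hle : Submodule.span R (S : Set N) ≤
        (Finsupp.supported R R (T : Set V)).comap (s ∘ₗ g) := by
      rw [Submodule.span_le]
      intro m hm
      simp only [Submodule.comap_coe, Set.mem_preimage, LinearMap.comp_apply, SetLike.mem_coe,
        Finsupp.mem_supported, Finset.coe_subset]
      exact Finset.subset_biUnion_of_mem (fun n => (s (g n)).support) (Finset.mem_coe.1 hm)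
    simpa [Finsupp.mem_supported] using hle hn
  refine ⟨∑ v ∈ T, v ⊗ₜ (Finsupp.lapply v ∘ₗ s ∘ₗ g), LinearMap.ext fun n => ?_⟩
  have h := LinearMap.congr_fun hs (g n)
  simp only [LinearMap.comp_apply, LinearMap.id_apply, Finsupp.linearCombination_apply,
    id_eq] at h
  rw [Finsupp.sum_of_support_subset _ (hT n) _ (by simp)] at h
  simpa using h

/-- `V ⊗ N^* ≅ Hom_R(N,V)` for `V` projective and `N` finitely generated. -/
def contractEquiv (R V N : Type u) [CommRing R] [AddCommGroup V] [Module R V] [AddCommGroup N]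
    [Module R N] [Module.Projective R V] [Module.Finite R N] :
    V ⊗[R] Module.Dual R N ≃ₗ[R] N →ₗ[R] V :=
  LinearEquiv.ofBijective (contract R V N) ⟨contract_injective, contract_surjective⟩

namespace RCoact

/-- `f ↦ (f ⊗ id) ρ`, as a map `N^* → Hom_R(N,D)`. -/
def dualAux (n : RCoact R D N) : Module.Dual R N →ₗ[R] N →ₗ[R] D where
  toFun f := (TensorProduct.lid R D).toLinearMap ∘ₗ f.rTensor D ∘ₗ n.map
  map_add' f g := by
    rw [LinearMap.rTensor_add, LinearMap.add_comp, LinearMap.comp_add]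
  map_smul' r f := by
    rw [LinearMap.rTensor_smul, LinearMap.smul_comp, LinearMap.comp_smul]; rfl

variable [Module.Projective R D]

/-- The left coaction on `N^*`: the composite `N^* → Hom_R(N,D) ≅ D ⊗ N^*`. -/
def dualMap [Module.Finite R N] (n : RCoact R D N) :
    Module.Dual R N →ₗ[R] D ⊗[R] Module.Dual R N :=
  (contractEquiv R D N).symm.toLinearMap ∘ₗ n.dualAux

theorem contract_dualMap [Module.Finite R N] (n : RCoact R D N) (f : Module.Dual R N) :
    contract R D N (n.dualMap f) =
      (TensorProduct.lid R D).toLinearMap ∘ₗ f.rTensor D ∘ₗ n.map :=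
  (contractEquiv R D N).apply_symm_apply _

/-- The dual `N^*` of a right `D`-comodule `N` that is finitely generated over `R`, as a left
`D`-comodule. -/
def dual [Module.Finite R N] (n : RCoact R D N) : LCoact R D (Module.Dual R N) where
  map := n.dualMap
  coassoc := by
    refine LinearMap.ext fun f => (TensorProduct.assoc R D D (Module.Dual R N)).symm.injective ?_
    refine contract_injective (LinearMap.ext fun y => ?_)
    have hl : ∀ t : D ⊗[R] Module.Dual R N,
        contract R (D ⊗[R] D) N ((TensorProduct.assoc R D D (Module.Dual R N)).symm
          (n.dualMap.lTensor D t)) y = (contract R D N t).rTensor D (n.map y) := by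
      intro t
      induction t using TensorProduct.induction_on with
      | zero => simp
      | tmul d g =>
        have h1 : ∀ s : D ⊗[R] Module.Dual R N,
            contract R (D ⊗[R] D) N ((TensorProduct.assoc R D D (Module.Dual R N)).symm
              (d ⊗ₜ s)) y = d ⊗ₜ contract R D N s y := by
          intro s
          induction s using TensorProduct.induction_on with
          | zero => simp
          | tmul => simp
          | add a b ha hb => simp only [tmul_add, map_add, LinearMap.add_apply, ha, hb]
        rw [LinearMap.lTensor_tmul, h1, contract_dualMap]
        simp only [LinearMap.comp_apply, LinearEquiv.coe_coe]
        generalize n.map y = s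
        induction s using TensorProduct.induction_on with
        | zero => simp
        | tmul => simp [smul_tmul']
        | add a b ha hb => simp only [tmul_add, map_add, ha, hb]
      | add a b ha hb => simp only [map_add, LinearMap.add_apply, LinearMap.rTensor_add, ha, hb]
    have hr : ∀ t : D ⊗[R] Module.Dual R N,
        contract R (D ⊗[R] D) N ((Coalgebra.comul (R := R) (A := D)).rTensor _ t) y =
          Coalgebra.comul (R := R) (contract R D N t y) := by
      intro t
      induction t using TensorProduct.induction_on with
      | zero => simp
      | tmul => simp
      | add a b ha hb => simp only [map_add, LinearMap.add_apply, ha, hb]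
    have e1 : ((TensorProduct.lid R D).toLinearMap ∘ₗ f.rTensor D ∘ₗ n.map).rTensor D =
        (TensorProduct.lid R (D ⊗[R] D)).toLinearMap ∘ₗ f.rTensor (D ⊗[R] D) ∘ₗ
          (TensorProduct.assoc R N D D).toLinearMap ∘ₗ n.map.rTensor D := by
      refine TensorProduct.ext' fun z d => ?_
      simp only [LinearMap.comp_apply, LinearMap.rTensor_tmul, LinearEquiv.coe_coe]
      generalize n.map z = s
      induction s using TensorProduct.induction_on with
      | zero => simp
      | tmul => simp [smul_tmul']
      | add a b ha hb => simp only [add_tmul, map_add, ha, hb]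
    have e2 : (Coalgebra.comul (R := R) (A := D)) ∘ₗ (TensorProduct.lid R D).toLinearMap ∘ₗ
        f.rTensor D = (TensorProduct.lid R (D ⊗[R] D)).toLinearMap ∘ₗ f.rTensor (D ⊗[R] D) ∘ₗ
          (Coalgebra.comul (R := R) (A := D)).lTensor N :=
      TensorProduct.ext' fun _ _ => by simp
    have h1 := LinearMap.congr_fun e1 (n.map y)
    have h2 := LinearMap.congr_fun e2 (n.map y)
    have h3 := LinearMap.congr_fun n.coassoc y
    simp only [LinearMap.comp_apply, LinearEquiv.coe_coe, LinearEquiv.symm_apply_apply] at *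
    rw [hl, hr, contract_dualMap, h1, h3]
    simp only [LinearMap.comp_apply, LinearEquiv.coe_coe]
    rw [h2]
  counit := by
    refine LinearMap.ext fun f => LinearMap.ext fun y => ?_
    have h1 : ∀ t : D ⊗[R] Module.Dual R N,
        TensorProduct.lid R _ ((Coalgebra.counit (R := R) (A := D)).rTensor _ t) y =
          Coalgebra.counit (R := R) (contract R D N t y) := by
      intro t
      induction t using TensorProduct.induction_on with
      | zero => simp
      | tmul => simp [mul_comm]
      | add a b ha hb => simp only [map_add, LinearMap.add_apply, ha, hb]
    have e : (Coalgebra.counit (R := R) (A := D)) ∘ₗ (TensorProduct.lid R D).toLinearMap ∘ₗ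
        f.rTensor D = f ∘ₗ (TensorProduct.rid R N).toLinearMap ∘ₗ
          (Coalgebra.counit (R := R) (A := D)).lTensor N :=
      TensorProduct.ext' fun _ _ => by simp [mul_comm]
    have h2 := LinearMap.congr_fun e (n.map y)
    have h3 := LinearMap.congr_fun n.counit y
    simp only [LinearMap.comp_apply, LinearEquiv.coe_coe, LinearMap.id_apply] at *
    rw [h1, contract_dualMap]
    simp only [LinearMap.comp_apply, LinearEquiv.coe_coe]
    rw [h2, h3]

/-- The transpose of a colinear map is colinear. -/
theorem dualMap_mem_com [Module.Finite R M] [Module.Finite R N] {m : RCoact R D M}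
    {n : RCoact R D N} {f : M →ₗ[R] N} (hf : f ∈ com m n) :
    LinearMap.dualMap f ∈ LCoact.com n.dual m.dual := by
  rw [LCoact.mem_com]
  refine LinearMap.ext fun g => contract_injective (LinearMap.ext fun y => ?_)
  have h1 : ∀ t : D ⊗[R] Module.Dual R N,
      contract R D M ((LinearMap.dualMap f).lTensor D t) y = contract R D N t (f y) := by
    intro t
    induction t using TensorProduct.induction_on with
    | zero => simp
    | tmul => simp
    | add a b ha hb => simp only [map_add, LinearMap.add_apply, ha, hb]
  have h2 := LinearMap.congr_fun (mem_com.1 hf) y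
  simp only [dual, LinearMap.comp_apply] at *
  rw [h1, contract_dualMap, contract_dualMap]
  simp only [LinearMap.comp_apply, LinearEquiv.coe_coe]
  rw [h2]
  generalize m.map y = s
  induction s using TensorProduct.induction_on with
  | zero => simp
  | tmul => simp
  | add a b ha hb => simp only [map_add, ha, hb]

end RCoact

/-! ### The left adjoints -/

/-- The unit of an adjunction `h ⊣ - ⊗ X` is universal. -/
theorem RCoact.isCohom (x : RCoact R D X) {h : RComod R D ⥤ ModuleCat.{u} R}
    (adj : h ⊣ RComod.tensorFunctor x) (M : RComod R D) :
    IsCohom x M.coact (H := h.obj M) (RComod.lin (adj.unit.app M)) where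
  colinear := RComod.lin_mem (adj.unit.app M)
  exists_lift W _ _ f hf := by
    let φ : M ⟶ (RComod.tensorFunctor x).obj (ModuleCat.of R W) := RComod.homMk f hf
    refine ⟨((adj.homEquiv M (ModuleCat.of R W)).symm φ).hom, ?_⟩
    have h1 := (adj.homEquiv M (ModuleCat.of R W)).apply_symm_apply φ
    rw [Adjunction.homEquiv_unit] at h1
    exact congrArg RComod.lin h1
  hom_ext W _ _ f g hfg := by
    have h1 : adj.homEquiv M (ModuleCat.of R W) (ModuleCat.ofHom f) =
        adj.homEquiv M (ModuleCat.of R W) (ModuleCat.ofHom g) := by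
      rw [Adjunction.homEquiv_unit, Adjunction.homEquiv_unit]
      exact RComod.hom_ext hfg
    exact congrArg ModuleCat.Hom.hom ((adj.homEquiv M (ModuleCat.of R W)).injective h1)

/-- The unit of an adjunction `h ⊣ X ⊗ -` is universal. -/
theorem LCoact.isLCohom (x : LCoact R C X) {h : LComod R C ⥤ ModuleCat.{u} R}
    (adj : h ⊣ LComod.tensorFunctor x) (M : LComod R C) :
    IsLCohom x M.coact (H := h.obj M) (LComod.lin (adj.unit.app M)) where
  colinear := LComod.lin_mem (adj.unit.app M)
  exists_lift W _ _ f hf := by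
    let φ : M ⟶ (LComod.tensorFunctor x).obj (ModuleCat.of R W) := LComod.homMk f hf
    refine ⟨((adj.homEquiv M (ModuleCat.of R W)).symm φ).hom, ?_⟩
    have h1 := (adj.homEquiv M (ModuleCat.of R W)).apply_symm_apply φ
    rw [Adjunction.homEquiv_unit] at h1
    exact congrArg LComod.lin h1
  hom_ext W _ _ f g hfg := by
    have h1 : adj.homEquiv M (ModuleCat.of R W) (ModuleCat.ofHom f) =
        adj.homEquiv M (ModuleCat.of R W) (ModuleCat.ofHom g) := by
      rw [Adjunction.homEquiv_unit, Adjunction.homEquiv_unit]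
      exact LComod.hom_ext hfg
    exact congrArg ModuleCat.Hom.hom ((adj.homEquiv M (ModuleCat.of R W)).injective h1)

namespace BiCoact

variable (x : BiCoact R C D X)

/-- The cohom functor `h_D(X,-) : M^D ⥤ M^C` of a `C`-`D`-bicomodule `X`. -/
def cohomFunctor {h : RComod R D ⥤ ModuleCat.{u} R} (adj : h ⊣ RComod.tensorFunctor x.right) :
    RComod R D ⥤ RComod R C where
  obj M := ⟨h.obj M, (x.right.isCohom adj M).coact⟩
  map {M N} f := RComod.homMk (h.map f).hom <|
    (x.right.isCohom adj M).coact_natural (x.right.isCohom adj N) (f := RComod.lin f)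
      (congrArg RComod.lin (adj.unit.naturality f).symm)
  map_id M := RComod.hom_ext (congrArg ModuleCat.Hom.hom (h.map_id M))
  map_comp f g := RComod.hom_ext (congrArg ModuleCat.Hom.hom (h.map_comp f g))

/-- `h_D(X,D)` as a `D`-`C`-bicomodule. -/
def cohomSelf {h : RComod R D ⥤ ModuleCat.{u} R} (adj : h ⊣ RComod.tensorFunctor x.right) :
    BiCoact R D C (h.obj ⟨D, RCoact.self R D⟩) :=
  (x.right.isCohom adj ⟨D, RCoact.self R D⟩).bicoact (m := BiCoact.self R D)

/-- `X_D` is quasi-finite and an injective cogenerator of the category of right `D`-comodules, and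
`e_D(X) ≅ C` as coalgebras (compatibly with the coactions on `X`). -/
def RightCondition : Prop :=
  x.right.QuasiFinite ∧ Injective (⟨X, x.right⟩ : RComod R D) ∧
    IsCoseparator (⟨X, x.right⟩ : RComod R D) ∧
    ∃ (h : RComod R D ⥤ ModuleCat.{u} R) (adj : h ⊣ RComod.tensorFunctor x.right),
      (x.right.isCohom adj ⟨X, x.right⟩).CoendIso

/-- `_C X` is quasi-finite and an injective cogenerator of the category of left `C`-comodules, and
`e_C(X) ≅ D` as coalgebras (compatibly with the coactions on `X`). -/
def LeftCondition : Prop :=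
  x.left.QuasiFinite ∧ Injective (⟨X, x.left⟩ : LComod R C) ∧
    IsCoseparator (⟨X, x.left⟩ : LComod R C) ∧
    ∃ (h : LComod R C ⥤ ModuleCat.{u} R) (adj : h ⊣ LComod.tensorFunctor x.left),
      (x.left.isLCohom adj ⟨X, x.left⟩).CoendIso

end BiCoact

/-! ### Direct limits over the finitely presented subcomodules -/

/-- The subcomodules of `M` that are finitely presented as `R`-modules, ordered by inclusion. -/
abbrev FPSub (m : RCoact R D M) : Type u :=
  {K : Submodule R M // m.IsSubcomodule K ∧ Module.FinitePresentation R K}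

instance (m : RCoact R D M) (K : FPSub m) : Module.Finite R K.1 :=
  haveI := K.2.2
  inferInstance

/-- Precomposition with a colinear map `f : M → N`, as a map `Com(N,P) → Com(M,P)`. -/
def RCoact.precomp {m : RCoact R D M} {n : RCoact R D N} (f : M →ₗ[R] N)
    (hf : f ∈ RCoact.com m n) (p : RCoact R D P) : RCoact.com n p →ₗ[R] RCoact.com m p :=
  (LinearMap.lcomp R P f).restrict fun _ hg => RCoact.comp_mem_com hf hg

namespace FPSub

variable [Module.Flat R D] {m : RCoact R D M}

/-- The comodule structure on a member of the family. -/
abbrev coact (K : FPSub m) : RCoact R D K.1 := m.sub K.1 K.2.1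

theorem inclusion_mem_com {K L : FPSub m} (hKL : K ≤ L) :
    Submodule.inclusion hKL ∈ RCoact.com K.coact L.coact :=
  RCoact.mem_com_sub m L.1 L.2.1 _ (RCoact.subtype_mem_com m K.1 K.2.1)

/-- The inclusion of a member of the family into `M`, as a morphism of comodules. -/
def ι (K : FPSub m) : (⟨K.1, K.coact⟩ : RComod R D) ⟶ ⟨M, m⟩ :=
  RComod.homMk K.1.subtype (RCoact.subtype_mem_com m K.1 K.2.1)

/-- The transition maps `Com_D(K,X)^* → Com_D(L,X)^*` for `K ≤ L`. -/
def comDualMap (m : RCoact R D M) (x : RCoact R D X) (K L : FPSub m) (hKL : K ≤ L) :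
    Module.Dual R (RCoact.com K.coact x) →ₗ[R] Module.Dual R (RCoact.com L.coact x) :=
  (RCoact.precomp (Submodule.inclusion hKL) (inclusion_mem_com hKL) x).dualMap

/-- The transition maps `(X □_D K^*)^* → (X □_D L^*)^*` for `K ≤ L`. -/
def cotensorDualMap [Module.Projective R D] (m : RCoact R D M) (x : RCoact R D X)
    (K L : FPSub m) (hKL : K ≤ L) :
    Module.Dual R (cotensor x K.coact.dual) →ₗ[R] Module.Dual R (cotensor x L.coact.dual) :=
  (cotensorMapRight x (Submodule.inclusion hKL).dualMap
    (RCoact.dualMap_mem_com (inclusion_mem_com hKL))).dualMap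

open Classical in
/-- The direct limit of the modules `Com_D(K,X)^*` over the finitely presented subcomodules `K`
of `M`. -/
abbrev ComLimit (m : RCoact R D M) (x : RCoact R D X) : Type u :=
  Module.DirectLimit (fun K : FPSub m => Module.Dual R (RCoact.com K.coact x)) (comDualMap m x)

open Classical in
/-- The direct limit of the modules `(X □_D K^*)^*` over the finitely presented subcomodules `K`
of `M`. -/
abbrev CotensorLimit [Module.Projective R D] (m : RCoact R D M) (x : RCoact R D X) : Type u :=
  Module.DirectLimit (fun K : FPSub m => Module.Dual R (cotensor x K.coact.dual))
    (cotensorDualMap m x)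

open Classical in
/-- The canonical map `Com_D(K,X)^* → lim Com_D(K,X)^*`. -/
def toComLimit {m : RCoact R D M} (x : RCoact R D X) (K : FPSub m) :
    Module.Dual R (RCoact.com K.coact x) →ₗ[R] ComLimit m x :=
  Module.DirectLimit.of R (FPSub m) _ (comDualMap m x) K

open Classical in
/-- The canonical map `(X □_D K^*)^* → lim (X □_D K^*)^*`. -/
def toCotensorLimit [Module.Projective R D] {m : RCoact R D M} (x : RCoact R D X)
    (K : FPSub m) : Module.Dual R (cotensor x K.coact.dual) →ₗ[R] CotensorLimit m x :=
  Module.DirectLimit.of R (FPSub m) _ (cotensorDualMap m x) K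

end FPSub

/-- The adjunction map `h_D(X,M)^* = Hom_R(h_D(X,M),R) → Com_D(M,R ⊗ X) ≅ Com_D(M,X)`. -/
def RCoact.adjDual (x : RCoact R D X) {h : RComod R D ⥤ ModuleCat.{u} R}
    (adj : h ⊣ RComod.tensorFunctor x) (M : RComod R D) (ψ : Module.Dual R (h.obj M)) :
    RCoact.com M.coact x :=
  ⟨(TensorProduct.lid R X).toLinearMap ∘ₗ ψ.rTensor X ∘ₗ RComod.lin (adj.unit.app M),
    RCoact.comp_mem_com
      (RCoact.comp_mem_com (x.isCohom adj M).colinear (RCoact.rTensor_mem_com x ψ))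
      (RCoact.symm_mem_com (TensorProduct.lid R X).symm (IsCohom.lidSymm_mem_com x))⟩

end Basic

end

noncomputable section

/-! The case W = R of the universal property gives a natural bijection between functionals on h(M) =
h_D(X,M) and Com_D(M,X). Over a QF ring functionals separate points
(`IsQFRing.exists_dual_ne_zero`), so statements about h can be tested on Com_D(-,X). If X is
injective in M^D it follows that h is exact (`IsCohom.injective_of_injective`,
`IsCohom.exact_of_exact`). Moreover h(W ⊗ M) = W ⊗ h(M) (`IsCohom.tens`), and the condition on
e_D(X) says precisely that the left coaction X → C ⊗ X is universal, that is, h(X) = C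
(`IsCohom.coendIso_iff`).

3 → 1: h turns 0 → N □ X → N ⊗ X → N ⊗ C ⊗ X into an exact sequence 0 → h(N □ X) → N ⊗ C → N ⊗ C ⊗
C. The kernel of the last map is N, so h(N □ X) = N. The unit M → h(M) □ X is injective because X
cogenerates; it is surjective because a map from h(M) □ X to X is determined by its restriction to
M. Applying h to 0 → M → M ⊗ D → M ⊗ D ⊗ D likewise gives h(M) ≅ M □ h(D).

1 → 3: Com_C(M,C) is the dual of M, so C is an injective cogenerator of M^C, and X ≅ C □ X is its
image under the equivalence. Since W ⊗ X ≅ (W ⊗ C) □ X, the functor - ⊗ X is a composite of right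
adjoints, and maps X → W ⊗ X correspond to colinear maps C → W ⊗ C, hence to linear maps C → W.

1 → 2: put Y = h(D). Then Y □ X ≅ D and X □ Y ≅ C as bicomodules. Cotensor products are not
associative in general, but X and Y are injective comodules, hence retracts of X ⊗ D and Y ⊗ C. The
sequences defining X □ Y and Y □ X therefore split over R and stay exact after tensoring with any
module (`BiCoact.SplitCotensor`). Injectivity also makes X and Y projective over R, because every
module over a QF ring embeds into a free one. So X □ - and Y □ - are mutually inverse.

Passing to co-opposite coalgebras exchanges left and right: 2 ↔ 4 is 1 ↔ 3, and 2 → 1 is 1 → 2, for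
the flipped bicomodule.

For the limit formulas, each element of M lies in a finitely generated subcomodule K because D is
projective. Then h(K) is finitely generated, hence reflexive, hence equal to the dual of Com_D(K,X);
exactness embeds h(K) into h(M), and these images exhaust h(M). -/

theorem CategoryTheory.IsCoseparator.of_iso {𝒞 : Type*} [Category 𝒞] {M N : 𝒞} (e : M ≅ N)
    (h : IsCoseparator M) : IsCoseparator N :=
  (isCoseparator_def _).2 fun _ _ f g hfg => h.def f g fun k => by
    have := hfg (k ≫ e.hom)
    rwa [← Category.assoc, ← Category.assoc, cancel_mono] at this

/-! ### Modules over quasi-Frobenius rings -/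

section QF

variable {R : Type u} [CommRing R]

/-- A map into an injective module that vanishes on the kernel of `σ` factors through `σ`. -/
theorem Module.Injective.exists_comp_eq {Q P P' : Type u} [AddCommGroup Q] [Module R Q]
    [AddCommGroup P] [Module R P] [AddCommGroup P'] [Module R P'] (hQ : Module.Injective R Q)
    (σ : P →ₗ[R] P') (g : P →ₗ[R] Q) (h : LinearMap.ker σ ≤ LinearMap.ker g) :
    ∃ k : P' →ₗ[R] Q, k ∘ₗ σ = g := by
  obtain ⟨k, hk⟩ := hQ.out ((LinearMap.ker σ).liftQ σ le_rfl)
    (LinearMap.ker_eq_bot.1 (Submodule.ker_liftQ_eq_bot _ _ _ le_rfl)) ((LinearMap.ker σ).liftQ g h)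
  refine ⟨k, LinearMap.ext fun y => ?_⟩
  simpa using hk ((LinearMap.ker σ).mkQ y)

namespace IsQFRing

/-- The double annihilator property of a self-injective noetherian ring. It needs only maps from
principal ideals and from sums of two annihilator ideals to extend to R, where they become
multiplications. -/
theorem mem_of_annihilator (hR : IsQFRing R) (I : Ideal R) (b : R)
    (hb : ∀ r, (∀ a ∈ I, r * a = 0) → r * b = 0) : b ∈ I := by
  have := hR.1
  induction I, IsNoetherian.noetherian I using Submodule.fg_induction generalizing b with
  | singleton a =>
    obtain ⟨k, hk⟩ := hR.2.exists_comp_eq (LinearMap.toSpanSingleton R R a)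
      (LinearMap.toSpanSingleton R R b) fun r hr => by
        have hr : r * a = 0 := by simpa using hr
        have : r * b = 0 := hb r fun c hc => by
          obtain ⟨d, rfl⟩ := Submodule.mem_span_singleton.1 hc
          rw [smul_eq_mul, mul_left_comm, hr, mul_zero]
        simpa using this
    have h1 := LinearMap.congr_fun hk 1
    simp only [LinearMap.comp_apply, LinearMap.toSpanSingleton_apply, one_smul] at h1
    rw [← h1]
    refine Submodule.mem_span_singleton.2 ⟨k 1, ?_⟩
    rw [smul_eq_mul, mul_comm, ← smul_eq_mul, ← map_smul, smul_eq_mul, mul_one]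
  | sup I J _ _ hI hJ =>
    -- The rule r + s ↦ r b on Ann I + Ann J is well defined, because an element of both
    -- annihilators kills I + J and hence b. It extends to multiplication by `k 1`, and b = (b - `k
    -- 1`) + `k 1` is the required decomposition.
    let σ : (Submodule.annihilator I × Submodule.annihilator J) →ₗ[R] R :=
      (Submodule.annihilator I).subtype.coprod (Submodule.annihilator J).subtype
    let g : (Submodule.annihilator I × Submodule.annihilator J) →ₗ[R] R :=
      LinearMap.toSpanSingleton R R b ∘ₗ (Submodule.annihilator I).subtype ∘ₗ LinearMap.fst R _ _
    obtain ⟨k, hk⟩ := hR.2.exists_comp_eq σ g fun p hp => by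
      have hp : (p.1 : R) + p.2 = 0 := by simpa [σ] using hp
      have h2 : (p.1 : R) * b = 0 := hb _ fun c hc => by
        obtain ⟨i, hi, j, hj, rfl⟩ := Submodule.mem_sup.1 hc
        have h3 : (p.1 : R) * i = 0 := by
          simpa using Submodule.mem_annihilator.1 p.1.2 i hi
        have h4 : (p.2 : R) * j = 0 := by
          simpa using Submodule.mem_annihilator.1 p.2.2 j hj
        rw [mul_add, h3, eq_neg_of_add_eq_zero_left hp, neg_mul, h4]; simp
      simpa [g] using h2
    have hk1 : ∀ r : R, k r = k 1 * r := fun r => by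
      rw [mul_comm, ← smul_eq_mul, ← map_smul, smul_eq_mul, mul_one]
    have h1 : b - k 1 ∈ I := hI _ fun r hr => by
      have := LinearMap.congr_fun hk
        (⟨r, Submodule.mem_annihilator.2 fun a ha => by simpa using hr a ha⟩, 0)
      simp only [σ, g, LinearMap.comp_apply, LinearMap.coprod_apply, Submodule.subtype_apply,
        LinearMap.fst_apply, LinearMap.toSpanSingleton_apply, smul_eq_mul, ZeroMemClass.coe_zero,
        add_zero] at this
      rw [mul_sub, ← this, hk1]; ring
    have h2 : k 1 ∈ J := hJ _ fun r hr => by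
      have := LinearMap.congr_fun hk
        (0, ⟨r, Submodule.mem_annihilator.2 fun a ha => by simpa using hr a ha⟩)
      simp only [σ, g, LinearMap.comp_apply, LinearMap.coprod_apply, Submodule.subtype_apply,
        LinearMap.fst_apply, LinearMap.toSpanSingleton_apply, smul_eq_mul, ZeroMemClass.coe_zero,
        zero_add, zero_mul] at this
      rw [mul_comm, ← hk1, this]
    exact Submodule.mem_sup.2 ⟨_, h1, _, h2, by ring⟩

/-- Over a QF ring, linear functionals separate points. -/
theorem exists_dual_ne_zero (hR : IsQFRing R) {M : Type u} [AddCommGroup M] [Module R M] {y : M}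
    (hy : y ≠ 0) : ∃ f : M →ₗ[R] R, f y ≠ 0 := by
  by_contra! hf
  -- The double annihilator property is applied to Ann(y) and 1. If r kills Ann(y), then a y ↦ a r
  -- is well defined on R y and extends to a functional on M with value r at y, so r = 0.
  have h1 : (1 : R) ∈ LinearMap.ker (LinearMap.toSpanSingleton R M y) :=
    hR.mem_of_annihilator _ _ fun r hr => by
      obtain ⟨k, hk⟩ := hR.2.exists_comp_eq (LinearMap.toSpanSingleton R M y)
        (LinearMap.toSpanSingleton R R r) fun a ha => by
          simpa [mul_comm] using hr a ha
      have := LinearMap.congr_fun hk 1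
      simp only [LinearMap.comp_apply, LinearMap.toSpanSingleton_apply, one_smul] at this
      rw [mul_one, ← this, hf]
  exact hy (by simpa using h1)

theorem eq_zero_of_dual (hR : IsQFRing R) {M : Type u} [AddCommGroup M] [Module R M] {y : M}
    (h : ∀ f : M →ₗ[R] R, f y = 0) : y = 0 := by
  by_contra hy
  obtain ⟨f, hf⟩ := hR.exists_dual_ne_zero hy
  exact hf (h f)

/-- Taking annihilators reverses inclusions and is injective on ideals by the double annihilator
property, so the ascending chain condition yields the descending one. -/
theorem isArtinianRing (hR : IsQFRing R) : IsArtinianRing R := by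
  have := hR.1
  let a : Ideal R → Ideal R := fun I => Submodule.annihilator I
  have hinj : Function.Injective a := fun I J h => by
    have key : ∀ I J : Ideal R, a I = a J → I ≤ J := fun I J h b hb =>
      hR.mem_of_annihilator J b fun r hr => by
        have h1 : r ∈ a J := Submodule.mem_annihilator.2 fun c hc => by simpa using hr c hc
        rw [← h] at h1
        simpa using Submodule.mem_annihilator.1 h1 b hb
    exact le_antisymm (key I J h) (key J I h.symm)
  have hanti : StrictAnti a := fun I J hIJ =>
    lt_of_le_of_ne (Submodule.annihilator_mono hIJ.le) fun h => hIJ.ne (hinj h.symm)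
  exact hanti.wellFoundedLT

/-- By Baer's criterion only maps from ideals matter. Ideals are finitely generated, so such a map
has image in finitely many coordinates and can be extended coordinate by coordinate. -/
theorem injective_finsupp (hR : IsQFRing R) (ι : Type u) : Module.Injective R (ι →₀ R) := by
  have := hR.1
  have := hR.2
  refine Module.Baer.injective fun I g => ?_
  classical
  obtain ⟨S, hS⟩ := Module.Finite.fg_top (R := R) (M := I)
  let T : Finset ι := S.biUnion fun n => (g n).support
  have hT : ∀ n : I, g n ∈ Finsupp.supported R R (T : Set ι) := by
    intro n
    have hn : n ∈ Submodule.span R (S : Set I) := hS ▸ Submodule.mem_top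
    have hle : Submodule.span R (S : Set I) ≤ (Finsupp.supported R R (T : Set ι)).comap g := by
      rw [Submodule.span_le]
      intro m hm
      simp only [Submodule.comap_coe, Set.mem_preimage, SetLike.mem_coe,
        Finsupp.mem_supported, Finset.coe_subset]
      exact Finset.subset_biUnion_of_mem (fun n => (g n).support) (Finset.mem_coe.1 hm)
    exact hle hn
  choose k hk using fun i => hR.2.exists_comp_eq I.subtype (Finsupp.lapply i ∘ₗ g)
    (by rw [Submodule.ker_subtype]; exact bot_le)
  refine ⟨∑ i ∈ T, Finsupp.lsingle i ∘ₗ k i, fun r hr => ?_⟩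
  have h1 : ∀ i, k i r = g ⟨r, hr⟩ i := fun i => LinearMap.congr_fun (hk i) ⟨r, hr⟩
  have h2 := Finsupp.mem_supported _ _ |>.1 (hT ⟨r, hr⟩)
  simp only [LinearMap.sum_apply, LinearMap.comp_apply, h1, Finsupp.lsingle_apply]
  conv_rhs => rw [← Finsupp.sum_single (g ⟨r, hr⟩)]
  exact (Finsupp.sum_of_support_subset _ (Finset.coe_subset.1 h2) _ (by simp)).symm

/-- A nonzero cyclic submodule is artinian, hence contains a minimal submodule. This says that
socles are essential. -/
theorem exists_simple_le (hR : IsQFRing R) {M : Type u} [AddCommGroup M] [Module R M]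
    {N : Submodule R M} (hN : N ≠ ⊥) : ∃ S : Submodule R M, IsSimpleModule R S ∧ S ≤ N := by
  have := hR.isArtinianRing
  obtain ⟨y, hy, hy0⟩ := Submodule.exists_mem_ne_zero_of_ne_bot hN
  let K := Submodule.span R {y}
  have : IsArtinian R K := inferInstance
  have : IsAtomic (Submodule R K) := isAtomic_of_orderBot_wellFounded_lt wellFounded_lt
  have hK : (⊤ : Submodule R K) ≠ ⊥ := fun h => hy0 <| by
    have : (⟨y, Submodule.mem_span_singleton_self y⟩ : K) ∈ (⊥ : Submodule R K) := h ▸ trivial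
    simpa using this
  obtain ⟨S, hS, -⟩ := (IsAtomic.eq_bot_or_exists_atom_le (⊤ : Submodule R K)).resolve_left hK
  have : IsSimpleModule R S := isSimpleModule_iff_isAtom.2 hS
  refine ⟨S.map K.subtype, IsSimpleModule.congr
    (Submodule.equivMapOfInjective K.subtype K.injective_subtype S).symm, ?_⟩
  refine (Submodule.map_subtype_le K S).trans ?_
  rw [Submodule.span_le]
  simpa using hy

/-- Every module over a QF ring embeds into a free module. -/
theorem exists_embedding (hR : IsQFRing R) (M : Type u) [AddCommGroup M] [Module R M] :
    ∃ (ι : Type u) (f : M →ₗ[R] (ι →₀ R)), Function.Injective f := by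
  classical
  -- The socle of M. It is a direct sum of simple modules, each of which embeds into R by a nonzero
  -- functional, so it embeds into a free module. That free module is injective, hence the embedding
  -- extends to M.
  let S : Submodule R M := ⨆ m ∈ {m : Submodule R M | IsSimpleModule R m}, m
  have : IsSemisimpleModule R S :=
    isSemisimpleModule_biSup_of_isSemisimpleModule_submodule fun m hm => by
      have : IsSimpleModule R m := hm
      infer_instance
  obtain ⟨s, e, -, hs⟩ := IsSemisimpleModule.exists_linearEquiv_dfinsupp R S
  have hf : ∀ m : s, ∃ f : m.1 →ₗ[R] R, Function.Injective f := fun m => by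
    have := hs m
    have := IsSimpleModule.nontrivial R m.1
    obtain ⟨y, hy⟩ := exists_ne (0 : m.1)
    obtain ⟨f, hf⟩ := hR.exists_dual_ne_zero hy
    exact ⟨f, LinearMap.injective_of_ne_zero fun h => hf (by rw [h]; rfl)⟩
  choose f hf using hf
  let j : S →ₗ[R] (s →₀ R) := (finsuppLequivDFinsupp R).symm.toLinearMap ∘ₗ
    DFinsupp.mapRange.linearMap f ∘ₗ e.toLinearMap
  have hj : Function.Injective j := by
    have hm : Function.Injective (DFinsupp.mapRange.linearMap f) := ?_
    · exact (finsuppLequivDFinsupp R).symm.injective.comp (hm.comp e.injective)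
    intro a b hab
    ext m : 1
    have h := congrArg (fun z : Π₀ _ : s, R => z m) hab
    simp only [DFinsupp.mapRange.linearMap_apply, DFinsupp.mapRange_apply] at h
    exact hf m h
  obtain ⟨k, hk⟩ := (hR.injective_finsupp s).exists_comp_eq S.subtype j
    (by rw [Submodule.ker_subtype]; exact bot_le)
  refine ⟨s, k, LinearMap.ker_eq_bot.1 ?_⟩
  -- A nonzero kernel would contain a simple submodule, which lies in the socle, where the map is
  -- injective.
  by_contra hker
  obtain ⟨N, hN, hle⟩ := hR.exists_simple_le hker
  have hNS : N ≤ S := le_biSup (fun m : Submodule R M => m) hN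
  have := hN
  have := IsSimpleModule.nontrivial R N
  obtain ⟨y, hy⟩ := exists_ne (0 : N)
  have h1 : j ⟨y, hNS y.2⟩ = 0 := by
    rw [← hk]; exact LinearMap.mem_ker.1 (hle y.2)
  have h2 := hj (h1.trans (map_zero j).symm)
  exact hy (Subtype.ext (congrArg (fun z : S => (z : M)) h2))

/-- Finitely generated modules over a QF ring are reflexive. -/
theorem isReflexive (hR : IsQFRing R) (M : Type u) [AddCommGroup M] [Module R M]
    [Module.Finite R M] : Module.IsReflexive R M where
  bijective_dual_eval' := by
    constructor
    · rw [injective_iff_map_eq_zero]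
      exact fun y hy => hR.eq_zero_of_dual fun f => LinearMap.congr_fun hy f
    -- Dualizing a presentation of M by R^n embeds the dual of M into that of R^n. By
    -- self-injectivity an element of the bidual of M extends to the bidual of R^n, which is R^n
    -- itself.
    · obtain ⟨n, p, hp⟩ := Module.Finite.exists_fin' R M
      have hd : Function.Injective p.dualMap := LinearMap.dualMap_injective_of_surjective hp
      intro ξ
      have : Module.Injective R R := hR.2
      obtain ⟨ζ, hζ⟩ := Module.Injective.extension_property R R _ _ p.dualMap hd ξ
      obtain ⟨z, hz⟩ := (Module.bijective_dual_eval R (Fin n → R)).2 ζ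
      refine ⟨p z, ?_⟩
      rw [← hζ, ← hz]
      rfl

end IsQFRing

end QF


/-! ### Colinear maps and injective comodules -/

section Comodules

variable {R : Type u} [CommRing R]
variable {D : Type u} [AddCommGroup D] [Module R D] [Coalgebra R D]
variable {M N P : Type u} [AddCommGroup M] [Module R M] [AddCommGroup N] [Module R N]
  [AddCommGroup P] [Module R P]
variable {W V X : Type u} [AddCommGroup W] [Module R W] [AddCommGroup V] [Module R V]
  [AddCommGroup X] [Module R X]

namespace RCoact

theorem com_apply {m : RCoact R D M} {n : RCoact R D N} {f : M →ₗ[R] N} (hf : f ∈ com m n)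
    (y : M) : n.map (f y) = f.rTensor D (m.map y) :=
  LinearMap.congr_fun (mem_com.1 hf) y

theorem counit_apply (m : RCoact R D M) (y : M) :
    TensorProduct.rid R M ((Coalgebra.counit (R := R) (A := D)).lTensor M (m.map y)) = y :=
  LinearMap.congr_fun m.counit y

theorem coassoc_apply (m : RCoact R D M) (y : M) :
    TensorProduct.assoc R M D D (m.map.rTensor D (m.map y)) =
      (Coalgebra.comul (R := R) (A := D)).lTensor M (m.map y) :=
  LinearMap.congr_fun m.coassoc y

theorem map_injective (m : RCoact R D M) : Function.Injective m.map := fun y z h => by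
  rw [← m.counit_apply y, h, m.counit_apply]

theorem map_mem_com (m : RCoact R D M) : m.map ∈ com m (tens M (self R D)) := by
  rw [mem_com]
  refine LinearMap.ext fun y => ?_
  change (TensorProduct.assoc R M D D).symm ((Coalgebra.comul (R := R) (A := D)).lTensor M _) = _
  rw [← m.coassoc_apply, LinearEquiv.symm_apply_apply]; rfl

theorem lid_mem_com (x : RCoact R D X) :
    (TensorProduct.lid R X).toLinearMap ∈ com (tens R x) x :=
  symm_mem_com (TensorProduct.lid R X).symm (IsCohom.lidSymm_mem_com x)

theorem dualAux_mem_com (m : RCoact R D M) (f : M →ₗ[R] R) : m.dualAux f ∈ com m (self R D) :=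
  comp_mem_com (comp_mem_com m.map_mem_com (rTensor_mem_com (self R D) f)) (lid_mem_com _)

theorem counit_dualAux (m : RCoact R D M) (f : M →ₗ[R] R) (y : M) :
    Coalgebra.counit (R := R) (m.dualAux f y) = f y := by
  have e : (Coalgebra.counit (R := R) (A := D)) ∘ₗ (TensorProduct.lid R D).toLinearMap ∘ₗ
      f.rTensor D = f ∘ₗ (TensorProduct.rid R M).toLinearMap ∘ₗ
        (Coalgebra.counit (R := R) (A := D)).lTensor M :=
    TensorProduct.ext' fun _ _ => by simp [mul_comm]
  exact (LinearMap.congr_fun e (m.map y)).trans (congrArg f (m.counit_apply y))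

/-- Together with `counit_dualAux` this gives Com_D(M,D) ≅ Hom_R(M,R) by composition with the
counit: D is the cofree comodule on R. -/
theorem eq_dualAux {m : RCoact R D M} {g : M →ₗ[R] D} (hg : g ∈ com m (self R D)) :
    g = m.dualAux (Coalgebra.counit ∘ₗ g) := by
  refine LinearMap.ext fun y => ?_
  have h : (Coalgebra.counit (R := R) (A := D)).rTensor D (g.rTensor D (m.map y)) =
      1 ⊗ₜ g y := by
    rw [← com_apply hg]
    exact Coalgebra.rTensor_counit_comul (R := R) (g y)
  change _ = TensorProduct.lid R D ((Coalgebra.counit ∘ₗ g).rTensor D (m.map y))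
  rw [LinearMap.rTensor_comp, LinearMap.comp_apply, h]; simp

theorem mem_com_of_surjective {m : RCoact R D M} {n : RCoact R D N} {p : RCoact R D P}
    {f : M →ₗ[R] N} (hf : f ∈ com m n) (hs : Function.Surjective f) {g : N →ₗ[R] P}
    (hg : g ∘ₗ f ∈ com m p) : g ∈ com n p := by
  rw [mem_com, ← LinearMap.cancel_right hs, LinearMap.comp_assoc, mem_com.1 hg,
    LinearMap.comp_assoc, mem_com.1 hf, LinearMap.rTensor_comp, LinearMap.comp_assoc]

theorem mem_com_of_injective [Module.Flat R D] {m : RCoact R D M} {n : RCoact R D N}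
    {p : RCoact R D P} {i : N →ₗ[R] P} (hi : i ∈ com n p) (hinj : Function.Injective i)
    {g : M →ₗ[R] N} (hg : i ∘ₗ g ∈ com m p) : g ∈ com m n := by
  rw [mem_com, ← LinearMap.cancel_left (Module.Flat.rTensor_preserves_injective_linearMap
    (M := D) i hinj), ← LinearMap.comp_assoc, ← mem_com.1 hi, LinearMap.comp_assoc,
    mem_com.1 hg, LinearMap.rTensor_comp, LinearMap.comp_assoc]

theorem isSubcomodule_range {m : RCoact R D M} {n : RCoact R D N} {f : M →ₗ[R] N}
    (hf : f ∈ com m n) : n.IsSubcomodule (LinearMap.range f) := by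
  rintro _ ⟨y, rfl⟩
  rw [com_apply hf]
  refine ⟨f.rangeRestrict.rTensor D (m.map y), ?_⟩
  rw [← LinearMap.comp_apply, ← LinearMap.rTensor_comp, LinearMap.subtype_comp_codRestrict]

/-- The extension property of an injective comodule. -/
def HasExtensions (x : RCoact R D X) : Prop :=
  ∀ (M N : Type u) [AddCommGroup M] [Module R M] [AddCommGroup N] [Module R N]
    (m : RCoact R D M) (n : RCoact R D N) (f : M →ₗ[R] N), f ∈ com m n → Function.Injective f →
    ∀ g ∈ com m x, ∃ k ∈ com n x, k ∘ₗ f = g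

/-- Maps into `X` separate the elements of every comodule. -/
def Cogenerates (x : RCoact R D X) : Prop :=
  ∀ (M N : Type u) [AddCommGroup M] [Module R M] [AddCommGroup N] [Module R N]
    (m : RCoact R D M) (n : RCoact R D N) (f : M →ₗ[R] N), f ∈ com m n →
    (∀ g ∈ com n x, g ∘ₗ f = 0) → f = 0

end RCoact

/-! ### Categorical injectivity and cogeneration in terms of colinear maps -/

namespace RComod

open RCoact

theorem lin_comp {M N P : RComod R D} (f : M ⟶ N) (g : N ⟶ P) : lin (f ≫ g) = lin g ∘ₗ lin f :=
  rfl

theorem mono_of_injective {M N : RComod R D} {f : M ⟶ N} (hf : Function.Injective (lin f)) :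
    Mono f where
  right_cancellation g h e := hom_ext <| by
    rw [← LinearMap.cancel_left hf]
    exact congrArg lin e

/-- Flatness of D makes the kernel a subcomodule, so its inclusion and the zero map can be compared
in the category. -/
theorem injective_of_mono [Module.Flat R D] {M N : RComod R D} (f : M ⟶ N) [Mono f] :
    Function.Injective (lin f) := by
  rw [← LinearMap.ker_eq_bot, eq_bot_iff]
  intro y hy
  have hs := isSubcomodule_ker (lin_mem f)
  let K : RComod R D := ⟨LinearMap.ker (lin f), M.coact.sub _ hs⟩
  let i : K ⟶ M := homMk (LinearMap.ker (lin f)).subtype (subtype_mem_com _ _ hs)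
  let z : K ⟶ M := homMk 0 (Submodule.zero_mem _)
  have h : i = z := by
    rw [← cancel_mono f]
    exact hom_ext (LinearMap.ext fun t => (LinearMap.mem_ker.1 t.2).trans (map_zero (lin f)).symm)
  exact LinearMap.congr_fun (congrArg lin h) (⟨y, hy⟩ : LinearMap.ker (lin f))

theorem hasExtensions {x : RCoact R D X} (hx : Injective (⟨X, x⟩ : RComod R D)) :
    x.HasExtensions := by
  intro M N _ _ _ _ m n f hf hinj g hg
  let f' : (⟨M, m⟩ : RComod R D) ⟶ ⟨N, n⟩ := homMk f hf
  have : Mono f' := mono_of_injective hinj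
  let g' : (⟨M, m⟩ : RComod R D) ⟶ ⟨X, x⟩ := homMk g hg
  exact ⟨lin (Injective.factorThru g' f'), lin_mem (Injective.factorThru g' f'),
    congrArg lin (Injective.comp_factorThru g' f')⟩

theorem cogenerates {x : RCoact R D X} (hx : IsCoseparator (⟨X, x⟩ : RComod R D)) :
    x.Cogenerates := by
  intro M N _ _ _ _ m n f hf h
  let f' : (⟨M, m⟩ : RComod R D) ⟶ ⟨N, n⟩ := homMk f hf
  let z : (⟨M, m⟩ : RComod R D) ⟶ ⟨N, n⟩ := homMk 0 (Submodule.zero_mem _)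
  have : f' = z := hx.def _ _ fun g => hom_ext (by
    rw [lin_comp, lin_comp]
    exact (h (lin g) (lin_mem g)).trans (LinearMap.comp_zero _).symm)
  exact congrArg lin this

/-- A colinear isomorphism as an isomorphism of comodules. -/
def isoMk {M N : RComod R D} (e : M.carrier ≃ₗ[R] N.carrier)
    (he : e.toLinearMap ∈ com M.coact N.coact) : M ≅ N where
  hom := homMk e.toLinearMap he
  inv := homMk e.symm.toLinearMap (symm_mem_com e he)
  hom_inv_id := hom_ext (LinearMap.ext e.symm_apply_apply)
  inv_hom_id := hom_ext (LinearMap.ext e.apply_symm_apply)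

/-- A bijective morphism is an isomorphism. -/
def isoOfBijective {M N : RComod R D} (f : M ⟶ N) (hf : Function.Bijective (lin f)) : M ≅ N :=
  isoMk (LinearEquiv.ofBijective (lin f) hf) (lin_mem f)

/-- Colinear maps into D are linear functionals, so extending them along a monomorphism only
requires self-injectivity of R. -/
theorem injective_self [Module.Flat R D] (hR : Module.Injective R R) :
    Injective (⟨D, RCoact.self R D⟩ : RComod R D) where
  factors {A B} g f _ := by
    obtain ⟨k, hk⟩ := hR.exists_comp_eq (lin f) (Coalgebra.counit ∘ₗ lin g)
      (by rw [LinearMap.ker_eq_bot.2 (injective_of_mono f)]; exact bot_le)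
    refine ⟨homMk (B.coact.dualAux k) (dualAux_mem_com _ _), hom_ext ?_⟩
    change B.coact.dualAux k ∘ₗ lin f = lin g
    rw [eq_dualAux (lin_mem g), eq_dualAux (comp_mem_com (lin_mem f) (dualAux_mem_com _ k)), ← hk]
    congr 1
    exact LinearMap.ext fun y => counit_dualAux _ _ _

/-- Every functional on B is the counit composed with a colinear map B → D, and functionals separate
points. -/
theorem isCoseparator_self (hR : IsQFRing R) :
    IsCoseparator (⟨D, RCoact.self R D⟩ : RComod R D) := by
  refine isCoseparator_def _ |>.2 fun A B f g h => hom_ext (LinearMap.ext fun y => ?_)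
  rw [← sub_eq_zero]
  refine hR.eq_zero_of_dual fun φ => ?_
  have h1 := h (homMk (B.coact.dualAux φ) (dualAux_mem_com _ _))
  have h2 := LinearMap.congr_fun (congrArg lin h1) y
  have h3 : B.coact.dualAux φ (lin f y) = B.coact.dualAux φ (lin g y) := h2
  rw [map_sub, ← counit_dualAux B.coact, h3, counit_dualAux, sub_self]

end RComod

namespace RCoact

/-- A comodule with the extension property is a retract of a cofree one. -/
theorem HasExtensions.exists_retraction {x : RCoact R D X} (hx : x.HasExtensions) :
    ∃ s ∈ com (tens X (self R D)) x, s ∘ₗ x.map = LinearMap.id :=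
  hx _ _ x _ x.map x.map_mem_com x.map_injective _ (id_mem_com x)

/-- Embed X into a free module F. The composite X → X ⊗ D → F ⊗ D is an injective colinear map, so
the injective comodule X is a direct summand of the projective module F ⊗ D. -/
theorem HasExtensions.projective [Module.Projective R D] (hR : IsQFRing R) {x : RCoact R D X}
    (hx : x.HasExtensions) : Module.Projective R X := by
  obtain ⟨ι, i, hi⟩ := hR.exists_embedding X
  obtain ⟨k, -, hk⟩ := hx _ _ x (tens (ι →₀ R) (self R D)) (i.rTensor D ∘ₗ x.map)
    (comp_mem_com x.map_mem_com (rTensor_mem_com _ i))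
    ((Module.Flat.rTensor_preserves_injective_linearMap (M := D) i hi).comp x.map_injective)
    _ (id_mem_com x)
  exact Module.Projective.of_split (i.rTensor D ∘ₗ x.map) k hk

end RCoact

end Comodules


/-! ### Universal colinear maps -/

section Cohom

variable {R : Type u} [CommRing R]
variable {C : Type u} [AddCommGroup C] [Module R C] [Coalgebra R C]
variable {D : Type u} [AddCommGroup D] [Module R D] [Coalgebra R D]
variable {M N P : Type u} [AddCommGroup M] [Module R M] [AddCommGroup N] [Module R N]
  [AddCommGroup P] [Module R P]
variable {W V X : Type u} [AddCommGroup W] [Module R W] [AddCommGroup V] [Module R V]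
  [AddCommGroup X] [Module R X]
variable {H H' H'' : Type u} [AddCommGroup H] [Module R H] [AddCommGroup H'] [Module R H']
  [AddCommGroup H''] [Module R H'']

theorem RCoact.mk_mem_com (m : RCoact R D M) (w : W) :
    TensorProduct.mk R W M w ∈ RCoact.com m (RCoact.tens W m) := by
  rw [RCoact.mem_com]
  refine LinearMap.ext fun y => ?_
  simp only [RCoact.tens, LinearMap.comp_apply, TensorProduct.mk_apply, LinearMap.lTensor_tmul,
    LinearEquiv.coe_coe]
  generalize m.map y = t
  induction t using TensorProduct.induction_on with
  | zero => simp
  | tmul => simp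
  | add a b ha hb => simp only [tmul_add, map_add, ha, hb]

theorem rTensor_assoc_symm_tmul (f : W ⊗[R] H →ₗ[R] V) (w : W) (s : H ⊗[R] X) :
    f.rTensor X ((TensorProduct.assoc R W H X).symm (w ⊗ₜ s)) =
      (f ∘ₗ TensorProduct.mk R W H w).rTensor X s := by
  induction s using TensorProduct.induction_on with
  | zero => simp
  | tmul => simp
  | add a b ha hb => simp only [tmul_add, map_add, ha, hb]

namespace IsCohom

variable {x : RCoact R D X} {m : RCoact R D M} {n : RCoact R D N} {p : RCoact R D P}
  {η : M →ₗ[R] H ⊗[R] X} {η' : N →ₗ[R] H' ⊗[R] X} {η'' : P →ₗ[R] H'' ⊗[R] X}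

/-- The map between cohom modules induced by a colinear map. -/
def map (hη : IsCohom x m η) (hη' : IsCohom x n η') (f : M →ₗ[R] N) (hf : f ∈ RCoact.com m n) :
    H →ₗ[R] H' :=
  hη.lift (η' ∘ₗ f) (RCoact.comp_mem_com hf hη'.colinear)

theorem map_spec (hη : IsCohom x m η) (hη' : IsCohom x n η') (f : M →ₗ[R] N)
    (hf : f ∈ RCoact.com m n) : (hη.map hη' f hf).rTensor X ∘ₗ η = η' ∘ₗ f :=
  hη.lift_spec _ _

theorem of_equiv (hη : IsCohom x m η) (e : H ≃ₗ[R] H') :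
    IsCohom x m (e.toLinearMap.rTensor X ∘ₗ η) where
  colinear := RCoact.comp_mem_com hη.colinear (RCoact.rTensor_mem_com _ _)
  exists_lift W _ _ f hf := by
    obtain ⟨g, hg⟩ := hη.exists_lift W f hf
    refine ⟨g ∘ₗ e.symm.toLinearMap, ?_⟩
    rw [← LinearMap.comp_assoc, ← LinearMap.rTensor_comp, LinearMap.comp_assoc]
    simpa using hg
  hom_ext W _ _ f g h := by
    rw [← LinearMap.comp_assoc, ← LinearMap.comp_assoc, ← LinearMap.rTensor_comp,
      ← LinearMap.rTensor_comp] at h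
    exact (LinearMap.cancel_right e.surjective).1 (hη.hom_ext W _ _ h)

/-- `W ⊗ M → W ⊗ h(M) ⊗ X` is universal. -/
theorem tens (W : Type u) [AddCommGroup W] [Module R W] (hη : IsCohom x m η) :
    IsCohom x (RCoact.tens W m)
      ((TensorProduct.assoc R W H X).symm.toLinearMap ∘ₗ η.lTensor W) where
  colinear := RCoact.comp_mem_com (RCoact.lTensor_mem_com W hη.colinear)
    (assocSymm_mem_com H x)
  exists_lift V _ _ f hf := by
    -- For fixed w, the slice y ↦ f(w ⊗ y) is colinear and lifts to a map H → V; uniqueness of lifts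
    -- makes the result linear in w.
    have hc : ∀ w : W, f ∘ₗ TensorProduct.mk R W M w ∈ RCoact.com m (RCoact.tens V x) :=
      fun w => RCoact.comp_mem_com (RCoact.mk_mem_com m w) hf
    let g : W →ₗ[R] H →ₗ[R] V :=
      { toFun := fun w => hη.lift _ (hc w)
        map_add' := fun w w' => hη.hom_ext _ _ _ <| by
          rw [LinearMap.rTensor_add, LinearMap.add_comp, lift_spec, lift_spec, lift_spec, map_add,
            LinearMap.comp_add]
        map_smul' := fun r w => hη.hom_ext _ _ _ <| by
          rw [RingHom.id_apply, LinearMap.rTensor_smul, LinearMap.smul_comp, lift_spec, lift_spec,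
            map_smul, LinearMap.comp_smul] }
    refine ⟨TensorProduct.lift g, TensorProduct.ext' fun w y => ?_⟩
    simp only [LinearMap.comp_apply, LinearMap.lTensor_tmul, LinearEquiv.coe_coe,
      rTensor_assoc_symm_tmul]
    have h : TensorProduct.lift g ∘ₗ TensorProduct.mk R W H w = g w := by ext; simp
    rw [h]
    exact LinearMap.congr_fun (hη.lift_spec _ (hc w)) y
  hom_ext V _ _ f g h := by
    refine TensorProduct.ext' fun w t => ?_
    refine LinearMap.congr_fun (f := f ∘ₗ TensorProduct.mk R W H w)
      (g := g ∘ₗ TensorProduct.mk R W H w) (hη.hom_ext _ _ _ (LinearMap.ext fun y => ?_)) t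
    have h1 := LinearMap.congr_fun h (w ⊗ₜ y)
    simpa only [LinearMap.comp_apply, LinearMap.lTensor_tmul, LinearEquiv.coe_coe,
      rTensor_assoc_symm_tmul] using h1

/-- Existence and uniqueness (`dual_ext`) of this functional form the universal property at W = R.
Through them, properties of the cohom module are read off from maps into X. -/
theorem exists_dual (hη : IsCohom x m η) {g : M →ₗ[R] X} (hg : g ∈ RCoact.com m x) :
    ∃ ψ : H →ₗ[R] R, (TensorProduct.lid R X).toLinearMap ∘ₗ ψ.rTensor X ∘ₗ η = g := by
  obtain ⟨ψ, hψ⟩ := hη.exists_lift R _ (RCoact.comp_mem_com hg (lidSymm_mem_com x))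
  refine ⟨ψ, ?_⟩
  rw [hψ]; ext; simp

theorem dual_mem_com (hη : IsCohom x m η) (ψ : H →ₗ[R] R) :
    (TensorProduct.lid R X).toLinearMap ∘ₗ ψ.rTensor X ∘ₗ η ∈ RCoact.com m x :=
  RCoact.comp_mem_com (RCoact.comp_mem_com hη.colinear (RCoact.rTensor_mem_com x ψ))
    (RCoact.lid_mem_com x)

theorem dual_ext (hη : IsCohom x m η) {ψ ψ' : H →ₗ[R] R}
    (h : (TensorProduct.lid R X).toLinearMap ∘ₗ ψ.rTensor X ∘ₗ η =
      (TensorProduct.lid R X).toLinearMap ∘ₗ ψ'.rTensor X ∘ₗ η) : ψ = ψ' :=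
  hη.hom_ext _ _ _ ((LinearMap.cancel_left (TensorProduct.lid R X).injective).1 h)

theorem dual_comp {a : H →ₗ[R] H'} {f : M →ₗ[R] N} (ha : a.rTensor X ∘ₗ η = η' ∘ₗ f)
    (ψ : H' →ₗ[R] R) :
    (TensorProduct.lid R X).toLinearMap ∘ₗ (ψ ∘ₗ a).rTensor X ∘ₗ η =
      ((TensorProduct.lid R X).toLinearMap ∘ₗ ψ.rTensor X ∘ₗ η') ∘ₗ f := by
  rw [LinearMap.rTensor_comp, LinearMap.comp_assoc, ha]; rfl

/-- If `X` is injective, `h(-)` preserves injective maps. -/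
theorem injective_of_injective (hR : IsQFRing R) (hx : x.HasExtensions) (hη : IsCohom x m η)
    (hη' : IsCohom x n η') {a : H →ₗ[R] H'} {f : M →ₗ[R] N} (hf : f ∈ RCoact.com m n)
    (ha : a.rTensor X ∘ₗ η = η' ∘ₗ f) (hinj : Function.Injective f) : Function.Injective a := by
  rw [injective_iff_map_eq_zero]
  intro y hy
  -- The colinear map M → X belonging to a functional ψ extends along f, so ψ factors through a and
  -- vanishes on the kernel of a.
  refine hR.eq_zero_of_dual fun ψ => ?_
  obtain ⟨k, hk, hkf⟩ := hx _ _ m n f hf hinj _ (hη.dual_mem_com ψ)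
  obtain ⟨φ, hφ⟩ := hη'.exists_dual hk
  have : ψ = φ ∘ₗ a := hη.dual_ext (by rw [dual_comp ha, hφ, hkf])
  rw [this, LinearMap.comp_apply, hy, map_zero]

/-- If `X` is injective, `h(-)` preserves exactness. -/
theorem exact_of_exact [Module.Flat R D] (hR : IsQFRing R) (hx : x.HasExtensions)
    (hη : IsCohom x m η) (hη' : IsCohom x n η') (hη'' : IsCohom x p η'')
    {a : H →ₗ[R] H'} {b : H' →ₗ[R] H''} {f : M →ₗ[R] N} {g : N →ₗ[R] P}
    (hg : g ∈ RCoact.com n p)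
    (ha : a.rTensor X ∘ₗ η = η' ∘ₗ f) (hb : b.rTensor X ∘ₗ η' = η'' ∘ₗ g)
    (hex : Function.Exact f g) : Function.Exact a b := by
  intro y
  constructor
  · intro hy
    -- An element outside the range of a is detected by a functional ψ with ψ ∘ a = 0. It suffices
    -- to show that ψ factors through b, since then ψ(y) = 0.
    by_contra hya
    have hya : (LinearMap.range a).mkQ y ≠ 0 := fun h => hya (by simpa using h)
    obtain ⟨φ, hφ⟩ := hR.exists_dual_ne_zero hya
    let ψ := φ ∘ₗ (LinearMap.range a).mkQ
    have hψ : ψ ∘ₗ a = 0 := by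
      ext z; exact (congrArg φ ((Submodule.Quotient.mk_eq_zero _).2 ⟨z, rfl⟩)).trans (map_zero φ)
    let q := (TensorProduct.lid R X).toLinearMap ∘ₗ ψ.rTensor X ∘ₗ η'
    have hq : q ∈ RCoact.com n x := hη'.dual_mem_com ψ
    have hqf : q ∘ₗ f = 0 := by
      rw [← dual_comp ha, hψ]; simp
    have hker : LinearMap.ker g ≤ LinearMap.ker q := fun t ht => by
      obtain ⟨s, rfl⟩ := (hex t).1 ht
      exact LinearMap.congr_fun hqf s
    -- The colinear map q : N → X attached to ψ kills the image of f, which is the kernel of g, so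
    -- it descends to the range of g. This is a subcomodule of P, whence injectivity of X extends
    -- the map to P, and the extension gives the functional χ with ψ = χ ∘ b.
    let r := (LinearMap.ker g).liftQ q hker ∘ₗ g.quotKerEquivRange.symm.toLinearMap
    have hrg : r ∘ₗ g.rangeRestrict = q := by
      ext t
      have : g.quotKerEquivRange.symm (g.rangeRestrict t) = (LinearMap.ker g).mkQ t := by
        rw [LinearEquiv.symm_apply_eq]; rfl
      simp only [r, LinearMap.comp_apply, LinearEquiv.coe_coe, this]
      simp
    have hs := RCoact.isSubcomodule_range hg
    have hgr : g.rangeRestrict ∈ RCoact.com n (p.sub _ hs) := RCoact.mem_com_sub _ _ _ _ hg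
    have hr : r ∈ RCoact.com (p.sub _ hs) x :=
      RCoact.mem_com_of_surjective hgr g.surjective_rangeRestrict (by rw [hrg]; exact hq)
    obtain ⟨k, hk, hkr⟩ := hx _ _ _ p _ (RCoact.subtype_mem_com _ _ hs)
      (Submodule.injective_subtype _) r hr
    obtain ⟨χ, hχ⟩ := hη''.exists_dual hk
    have hk2 : k ∘ₗ g = q := by rw [← hrg, ← hkr]; rfl
    have : ψ = χ ∘ₗ b := hη'.dual_ext (by rw [dual_comp hb, hχ, hk2])
    refine hφ ?_
    change ψ y = 0
    rw [this, LinearMap.comp_apply, hy, map_zero]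
  · rintro ⟨z, rfl⟩
    have : b ∘ₗ a = 0 := hη.hom_ext _ _ _ <| by
      rw [LinearMap.rTensor_comp, LinearMap.comp_assoc, ha, ← LinearMap.comp_assoc, hb,
        LinearMap.comp_assoc, hex.linearMap_comp_eq_zero]
      simp
    exact LinearMap.congr_fun this z

/-- Two universal maps differ by an isomorphism. -/
theorem exists_equiv (hη : IsCohom x m η) {θ : M →ₗ[R] H' ⊗[R] X} (hθ : IsCohom x m θ) :
    ∃ e : H ≃ₗ[R] H', e.toLinearMap.rTensor X ∘ₗ η = θ := by
  have h1 := hη.map_spec hθ _ (RCoact.id_mem_com m)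
  have h2 := hθ.map_spec hη _ (RCoact.id_mem_com m)
  rw [LinearMap.comp_id] at h1 h2
  refine ⟨LinearEquiv.ofLinearMap (hη.map hθ _ (RCoact.id_mem_com m))
    (hθ.map hη _ (RCoact.id_mem_com m)) (hθ.hom_ext _ _ _ ?_) (hη.hom_ext _ _ _ ?_), h1⟩
  · rw [LinearMap.rTensor_comp, LinearMap.comp_assoc, h2, h1]; simp
  · rw [LinearMap.rTensor_comp, LinearMap.comp_assoc, h1, h2]; simp

/-- The coendomorphism coalgebra is `C`, compatibly with the coactions, if and only if the left
coaction of `X` is universal. -/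
theorem coendIso_iff {x : BiCoact R C D X} {η : X →ₗ[R] H ⊗[R] X}
    (hη : IsCohom x.right x.right η) :
    hη.CoendIso ↔ IsCohom x.right x.right x.left.map := by
  constructor
  · rintro ⟨φ, hφ⟩
    rw [← hφ]
    let := hη.coalgebra
    exact hη.of_equiv (φ : H ≃ₗ[R] C)
  · intro h
    obtain ⟨e, he⟩ := hη.exists_equiv h
    let := hη.coalgebra
    -- Compatibility with the coalgebra structures is automatic. Maps out of H are determined by
    -- their composite with η, and there the counit and coassociativity laws of the left coaction of
    -- X give the two identities.
    have hcounit : Coalgebra.counit (R := R) (A := C) ∘ₗ e.toLinearMap = hη.counit :=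
      hη.hom_ext _ _ _ <| by
        rw [hη.counit_spec, LinearMap.rTensor_comp, LinearMap.comp_assoc, he]
        refine LinearMap.ext fun y => (TensorProduct.lid R X).injective ?_
        rw [LinearEquiv.coe_coe, LinearEquiv.apply_symm_apply]
        exact LinearMap.congr_fun x.left.counit y
    have hcomul : TensorProduct.map e.toLinearMap e.toLinearMap ∘ₗ hη.comul =
        Coalgebra.comul (R := R) (A := C) ∘ₗ e.toLinearMap := hη.hom_ext _ _ _ <| by
      refine LinearMap.ext fun y => ?_
      have h1 := LinearMap.congr_fun hη.comul_spec y
      have h2 := LinearMap.congr_fun he y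
      have h3 := LinearMap.congr_fun x.left.coassoc y
      have h4 : ∀ t : H ⊗[R] X, (TensorProduct.map e.toLinearMap e.toLinearMap).rTensor X
          ((TensorProduct.assoc R H H X).symm (η.lTensor H t)) =
          (TensorProduct.assoc R C C X).symm
            (x.left.map.lTensor C (e.toLinearMap.rTensor X t)) := by
        intro t
        induction t using TensorProduct.induction_on with
        | zero => simp
        | tmul a z =>
          simp only [LinearMap.lTensor_tmul, LinearMap.rTensor_tmul, ← he, LinearMap.comp_apply]
          generalize η z = s
          induction s using TensorProduct.induction_on with
          | zero => simp
          | tmul => simp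
          | add a b ha hb => simp only [tmul_add, map_add, ha, hb]
        | add a b ha hb => simp only [map_add, ha, hb]
      simp only [LinearMap.comp_apply, LinearMap.rTensor_comp, LinearEquiv.coe_coe] at *
      rw [h1, h4, h2, h3, LinearEquiv.symm_apply_apply]
    exact ⟨{ e with counit_comp := hcounit, map_comp_comul := hcomul }, he⟩

end IsCohom

end Cohom


/-! ### Cotensor products and universal maps -/

section Cotensor

variable {R : Type u} [CommRing R]
variable {C : Type u} [AddCommGroup C] [Module R C] [Coalgebra R C]
variable {D : Type u} [AddCommGroup D] [Module R D] [Coalgebra R D]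
variable {M N K A : Type u} [AddCommGroup M] [Module R M] [AddCommGroup N] [Module R N]
  [AddCommGroup K] [Module R K] [AddCommGroup A] [Module R A]
variable {X Y H : Type u} [AddCommGroup X] [Module R X] [AddCommGroup Y] [Module R Y]
  [AddCommGroup H] [Module R H]

theorem cotensorMap_self_map (n : RCoact R C N) (y : N) :
    cotensorMap n (LCoact.self R C) (n.map y) = 0 := by
  simp only [cotensorMap, LinearMap.sub_apply, LinearMap.comp_apply, LinearEquiv.coe_coe]
  rw [n.coassoc_apply]
  exact sub_self _

theorem exact_cotensor (n : RCoact R C N) (k : LCoact R C K) :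
    Function.Exact (cotensor n k).subtype (cotensorMap n k) :=
  LinearMap.exact_subtype_ker_map _

/-- This is N = N □ C. The counit on the last factor provides a preimage: applying it to the
equation defining N □ C shows that the coaction of this preimage is t. -/
theorem exact_cotensorMap_self (n : RCoact R C N) :
    Function.Exact n.map (cotensorMap n (LCoact.self R C)) := by
  intro t
  constructor
  · intro ht
    refine ⟨TensorProduct.rid R N ((Coalgebra.counit (R := R) (A := C)).lTensor N t), ?_⟩
    have e1 : n.map ∘ₗ (TensorProduct.rid R N).toLinearMap ∘ₗ
        (Coalgebra.counit (R := R) (A := C)).lTensor N =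
        (TensorProduct.rid R C).toLinearMap.lTensor N ∘ₗ
          ((Coalgebra.counit (R := R) (A := C)).lTensor C).lTensor N ∘ₗ
          (TensorProduct.assoc R N C C).toLinearMap ∘ₗ n.map.rTensor C := by
      refine TensorProduct.ext' fun y c => ?_
      simp only [LinearMap.comp_apply, LinearMap.rTensor_tmul, LinearMap.lTensor_tmul,
        LinearEquiv.coe_coe, rid_tmul, map_smul]
      generalize n.map y = s
      induction s using TensorProduct.induction_on with
      | zero => simp
      | tmul => simp
      | add a b ha hb => simp only [add_tmul, map_add, smul_add, ha, hb]
    have h1 := LinearMap.congr_fun e1 t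
    have h2 : TensorProduct.assoc R N C C (n.map.rTensor C t) =
        (Coalgebra.comul (R := R) (A := C)).lTensor N t :=
      (mem_cotensor (m := n) (n := LCoact.self R C)).1 (LinearMap.mem_ker.2 ht)
    have h3 : (TensorProduct.rid R C).toLinearMap ∘ₗ
        (Coalgebra.counit (R := R) (A := C)).lTensor C ∘ₗ Coalgebra.comul = LinearMap.id := by
      refine LinearMap.ext fun c => ?_
      have h5 := Coalgebra.lTensor_counit_comul (R := R) c
      simp only [LinearMap.comp_apply, LinearEquiv.coe_coe, h5, rid_tmul, one_smul,
        LinearMap.id_apply]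
    have h4 := LinearMap.congr_fun (congrArg (LinearMap.lTensor N) h3) t
    simp only [LinearMap.comp_apply, LinearEquiv.coe_coe, LinearMap.lTensor_comp,
      LinearMap.lTensor_id, LinearMap.id_apply] at h1 h4
    rw [h1, h2, h4]
  · rintro ⟨y, rfl⟩
    exact cotensorMap_self_map n y

/-- If `τ : A → K ⊗ X` is `C`-colinear, then `N ⊗ τ` commutes with the defining maps of
the cotensor products `N □ A` and `N □ K`. -/
theorem cotensorMap_rTensor_comp (n : RCoact R C N) {a : LCoact R C A} {k : LCoact R C K}
    {τ : A →ₗ[R] K ⊗[R] X} (hτ : k.map.rTensor X ∘ₗ τ =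
      (TensorProduct.assoc R C K X).symm.toLinearMap ∘ₗ τ.lTensor C ∘ₗ a.map) :
    (cotensorMap n k).rTensor X ∘ₗ
        ((TensorProduct.assoc R N K X).symm.toLinearMap ∘ₗ τ.lTensor N) =
      ((TensorProduct.assoc R N (C ⊗[R] K) X).symm.toLinearMap ∘ₗ
        ((TensorProduct.assoc R C K X).symm.toLinearMap ∘ₗ τ.lTensor C).lTensor N) ∘ₗ
        cotensorMap n a := by
  refine TensorProduct.ext' fun w y => ?_
  simp only [cotensorMap, LinearMap.rTensor_sub, LinearMap.sub_apply, LinearMap.comp_apply,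
    map_sub, LinearMap.lTensor_tmul, LinearMap.rTensor_tmul, LinearEquiv.coe_coe]
  congr 1
  · have h1 : ∀ s : K ⊗[R] X, ((TensorProduct.assoc R N C K).toLinearMap ∘ₗ
        n.map.rTensor K).rTensor X ((TensorProduct.assoc R N K X).symm (w ⊗ₜ s)) =
        (TensorProduct.assoc R N C K).toLinearMap.rTensor X
          ((TensorProduct.assoc R (N ⊗[R] C) K X).symm (n.map w ⊗ₜ s)) := by
      intro s
      induction s using TensorProduct.induction_on with
      | zero => simp
      | tmul => simp
      | add a b ha hb => simp only [tmul_add, map_add, ha, hb]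
    rw [h1]
    generalize n.map w = t
    induction t using TensorProduct.induction_on with
    | zero => simp
    | tmul w c =>
      simp only [assoc_tmul, LinearMap.lTensor_tmul, LinearMap.comp_apply, LinearEquiv.coe_coe]
      generalize τ y = s
      induction s using TensorProduct.induction_on with
      | zero => simp
      | tmul => simp
      | add a b ha hb => simp only [tmul_add, map_add, ha, hb]
    | add a b ha hb => simp only [add_tmul, map_add, ha, hb]
  · have h1 : ∀ s : K ⊗[R] X, (k.map.lTensor N).rTensor X
        ((TensorProduct.assoc R N K X).symm (w ⊗ₜ s)) =
        (TensorProduct.assoc R N (C ⊗[R] K) X).symm (w ⊗ₜ k.map.rTensor X s) := by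
      intro s
      induction s using TensorProduct.induction_on with
      | zero => simp
      | tmul => simp
      | add a b ha hb => simp only [tmul_add, map_add, ha, hb]
    rw [h1]
    exact congrArg (fun z => (TensorProduct.assoc R N (C ⊗[R] K) X).symm (w ⊗ₜ z))
      (LinearMap.congr_fun hτ y)

/-- The properties of a bicomodule `X` that make `- □ X` an equivalence: `X` is injective and
cogenerating over `D`, and its left coaction `X → C ⊗ X` is universal. -/
structure BiCoact.IsInvertingBicomodule (x : BiCoact R C D X) : Prop where
  hasExtensions : x.right.HasExtensions
  cogenerates : x.right.Cogenerates
  isCohom : IsCohom x.right x.right x.left.map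

namespace BiCoact.IsInvertingBicomodule

variable {x : BiCoact R C D X}

section Flat

variable [Module.Flat R D]

/-- The counit of the adjunction between cohom functor and cotensor product. -/
theorem bijective_of_cotensor (hR : IsQFRing R) (hx : x.IsInvertingBicomodule) (n : RCoact R C N)
    {η : cotensor n x.left →ₗ[R] H ⊗[R] X} (hη : IsCohom x.right (rcotensor n x) η)
    {ε : H →ₗ[R] N} (hε : ε.rTensor X ∘ₗ η = (cotensor n x.left).subtype) :
    Function.Bijective ε := by
  have hcom : (cotensor n x.left).subtype ∈ RCoact.com (rcotensor n x) (RCoact.tens N x.right) :=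
    RCoact.subtype_mem_com _ _ _
  -- Since h(N ⊗ X) = N ⊗ C, this identifies ρ_N ∘ ε with the map that h induces from the inclusion
  -- N □ X → N ⊗ X.
  have ha : (n.map ∘ₗ ε).rTensor X ∘ₗ η = ((TensorProduct.assoc R N C X).symm.toLinearMap ∘ₗ
      x.left.map.lTensor N) ∘ₗ (cotensor n x.left).subtype := by
    rw [LinearMap.rTensor_comp, LinearMap.comp_assoc, hε]
    refine LinearMap.ext fun t => (TensorProduct.assoc R N C X).injective ?_
    simp only [LinearMap.comp_apply, LinearEquiv.coe_coe, LinearEquiv.apply_symm_apply]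
    exact mem_cotensor.1 t.2
  have hb := cotensorMap_rTensor_comp (X := X) n (a := x.left) (k := LCoact.self R C)
    (τ := x.left.map) <| by
      refine LinearMap.ext fun y => (TensorProduct.assoc R C C X).injective ?_
      simp only [LinearMap.comp_apply, LinearEquiv.coe_coe, LinearEquiv.apply_symm_apply]
      exact (LinearMap.congr_fun x.left.coassoc y).symm
  have hinj := hη.injective_of_injective hR hx.hasExtensions (hx.isCohom.tens N) hcom ha
    (Submodule.injective_subtype _)
  -- The exact sequence h(N □ X) → N ⊗ C → N ⊗ C ⊗ C. Its second map also has kernel ρ_N(N), so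
  -- injectivity of ρ_N gives surjectivity of ε.
  have hex := hη.exact_of_exact hR hx.hasExtensions (hx.isCohom.tens N)
    ((hx.isCohom.tens C).tens N) (cotensorMap_mem_rcom n x) ha hb (exact_cotensor n x.left)
  refine ⟨Function.Injective.of_comp (f := n.map) hinj, fun y => ?_⟩
  obtain ⟨z, hz⟩ := (hex (n.map y)).1 (cotensorMap_self_map n y)
  exact ⟨z, n.map_injective hz⟩

/-- The counit being bijective, a universal map out of N □ X may be transported along it, and the
result is the inclusion into N ⊗ X. Thus h(N □ X) is N on the nose. -/
theorem isCohom_cotensor (hR : IsQFRing R) (hx : x.IsInvertingBicomodule) (n : RCoact R C N)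
    {η : cotensor n x.left →ₗ[R] H ⊗[R] X} (hη : IsCohom x.right (rcotensor n x) η) :
    IsCohom x.right (rcotensor n x) (cotensor n x.left).subtype := by
  have hcom : (cotensor n x.left).subtype ∈ RCoact.com (rcotensor n x) (RCoact.tens N x.right) :=
    RCoact.subtype_mem_com _ _ _
  have h := hη.lift_spec _ hcom
  have := hη.of_equiv (LinearEquiv.ofBijective _ (hx.bijective_of_cotensor hR n hη h))
  rw [← h]
  exact this

end Flat

/-- The equation that defines the coaction on h(M) is the one that cuts out h(M) □ X inside h(M) ⊗
X. -/
theorem _root_.IsCohom.mem_cotensor {m : RCoact R D M} {η : M →ₗ[R] H ⊗[R] X}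
    (hη : IsCohom x.right m η) (y : M) : η y ∈ cotensor hη.coact x.left := by
  rw [_root_.mem_cotensor]
  have h := LinearMap.congr_fun hη.coactMap_spec y
  simp only [LinearMap.comp_apply, LinearEquiv.coe_coe] at h
  change TensorProduct.assoc R H C X (hη.coactMap.rTensor X (η y)) = _
  rw [h, LinearEquiv.apply_symm_apply]

/-- The unit of the adjunction between cohom functor and cotensor product. -/
def _root_.IsCohom.toCotensor {m : RCoact R D M} {η : M →ₗ[R] H ⊗[R] X}
    (hη : IsCohom x.right m η) : M →ₗ[R] cotensor hη.coact x.left :=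
  η.codRestrict _ hη.mem_cotensor

theorem _root_.IsCohom.toCotensor_mem_com [Module.Flat R D] {m : RCoact R D M}
    {η : M →ₗ[R] H ⊗[R] X} (hη : IsCohom x.right m η) :
    hη.toCotensor ∈ RCoact.com m (rcotensor hη.coact x) :=
  RCoact.mem_com_sub _ _ _ _ hη.colinear

variable [Module.Flat R D]

/-- Every map M → X factors through η, so all of them vanish on the kernel of η, and cogeneration
makes this kernel zero. For surjectivity, M and h(M) □ X have the same cohom module, hence the same
maps to X. -/
theorem bijective_toCotensor (hx : x.IsInvertingBicomodule)
    {m : RCoact R D M} {η : M →ₗ[R] H ⊗[R] X} (hη : IsCohom x.right m η)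
    (hc : IsCohom x.right (rcotensor hη.coact x) (cotensor hη.coact x.left).subtype) :
    Function.Bijective hη.toCotensor := by
  constructor
  · have hs := RCoact.isSubcomodule_ker hη.colinear
    have h0 : (LinearMap.ker η).subtype = 0 :=
      hx.cogenerates _ _ (m.sub _ hs) m _ (RCoact.subtype_mem_com _ _ hs) fun g hg => by
        obtain ⟨ψ, rfl⟩ := hη.exists_dual hg
        refine LinearMap.ext fun y => ?_
        have : η y = 0 := y.2
        simp [this]
    have hker : LinearMap.ker η = ⊥ := by
      rw [eq_bot_iff]
      exact fun y hy => LinearMap.congr_fun h0 ⟨y, hy⟩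
    intro y z h
    exact LinearMap.ker_eq_bot.1 hker (congrArg Subtype.val h)
  · rw [← LinearMap.range_eq_top, ← Submodule.ker_mkQ (LinearMap.range hη.toCotensor),
      LinearMap.ker_eq_top]
    set π := (LinearMap.range hη.toCotensor).mkQ
    let p := rcotensor hη.coact x
    -- Mapping to the cofree comodule on the cokernel avoids a comodule structure on the cokernel
    -- itself. The counit recovers π at the end.
    have hcom : π.rTensor D ∘ₗ p.map ∈ RCoact.com p (RCoact.tens _ (RCoact.self R D)) :=
      RCoact.comp_mem_com p.map_mem_com (RCoact.rTensor_mem_com _ π)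
    have hu : (π.rTensor D ∘ₗ p.map) ∘ₗ hη.toCotensor = 0 := by
      rw [LinearMap.comp_assoc, RCoact.mem_com.1 hη.toCotensor_mem_com, ← LinearMap.comp_assoc,
        ← LinearMap.rTensor_comp, LinearMap.range_mkQ_comp]
      simp
    have h0 : π.rTensor D ∘ₗ p.map = 0 := hx.cogenerates _ _ _ _ _ hcom fun g hg => by
      obtain ⟨ψ, hψ⟩ := hc.exists_dual (RCoact.comp_mem_com hcom hg)
      -- The functional ψ represents a map h(M) □ X → X that vanishes on the image of M. As a
      -- functional on h(M) it therefore represents the zero map M → X.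
      have : ψ = 0 := hη.dual_ext <| by
        change ((TensorProduct.lid R X).toLinearMap ∘ₗ ψ.rTensor X ∘ₗ
          (cotensor hη.coact x.left).subtype) ∘ₗ hη.toCotensor = _
        rw [hψ, LinearMap.comp_assoc, hu]
        simp
      rw [← hψ, this]
      simp
    refine LinearMap.ext fun y => ?_
    have h1 := LinearMap.congr_fun h0 y
    rw [← p.counit_apply y]
    have e : π ∘ₗ (TensorProduct.rid R _).toLinearMap ∘ₗ
        (Coalgebra.counit (R := R) (A := D)).lTensor _ =
        (TensorProduct.rid R _).toLinearMap ∘ₗ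
          (Coalgebra.counit (R := R) (A := D)).lTensor _ ∘ₗ π.rTensor D :=
      TensorProduct.ext' fun _ _ => by simp
    refine (LinearMap.congr_fun e (p.map y)).trans ?_
    simp only [LinearMap.comp_apply] at h1 ⊢
    rw [h1]; simp

end BiCoact.IsInvertingBicomodule

end Cotensor


/-! ### The cohom functor as a cotensor product -/

section CohomCotensor

variable {R : Type u} [CommRing R]
variable {C : Type u} [AddCommGroup C] [Module R C] [Coalgebra R C]
variable {D : Type u} [AddCommGroup D] [Module R D] [Coalgebra R D]
variable {M N : Type u} [AddCommGroup M] [Module R M] [AddCommGroup N] [Module R N]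
variable {X Y H H' : Type u} [AddCommGroup X] [Module R X] [AddCommGroup Y] [Module R Y]
  [AddCommGroup H] [Module R H] [AddCommGroup H'] [Module R H']

namespace IsCohom

variable {x : BiCoact R C D X} {m : RCoact R D M} {n : RCoact R D N}
  {η : M →ₗ[R] H ⊗[R] X} {η' : N →ₗ[R] H' ⊗[R] X} {ηD : D →ₗ[R] Y ⊗[R] X}

/-- The `D`-`C`-bicomodule `h_D(X,D)`. -/
abbrev selfBicoact (hD : IsCohom x.right (RCoact.self R D) ηD) : BiCoact R D C Y :=
  IsCohom.bicoact (m := BiCoact.self R D) hD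

theorem selfBicoact_left_spec (hD : IsCohom x.right (RCoact.self R D) ηD) :
    hD.selfBicoact.left.map.rTensor X ∘ₗ ηD =
      (TensorProduct.assoc R D Y X).symm.toLinearMap ∘ₗ ηD.lTensor D ∘ₗ Coalgebra.comul :=
  IsCohom.lcoactMap_spec (m := BiCoact.self R D) hD

theorem selfBicoact_right_spec (hD : IsCohom x.right (RCoact.self R D) ηD) :
    hD.selfBicoact.right.map.rTensor X ∘ₗ ηD =
      (TensorProduct.assoc R Y C X).symm.toLinearMap ∘ₗ x.left.map.lTensor Y ∘ₗ ηD :=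
  hD.coactMap_spec

/-- The canonical map `h_D(X,M) → M ⊗ h_D(X,D)`. -/
def toTensor (hη : IsCohom x.right m η) (hD : IsCohom x.right (RCoact.self R D) ηD) :
    H →ₗ[R] M ⊗[R] Y :=
  hη.map (hD.tens M) m.map m.map_mem_com

theorem toTensor_spec (hη : IsCohom x.right m η) (hD : IsCohom x.right (RCoact.self R D) ηD) :
    (hη.toTensor hD).rTensor X ∘ₗ η =
      ((TensorProduct.assoc R M Y X).symm.toLinearMap ∘ₗ ηD.lTensor M) ∘ₗ m.map :=
  hη.map_spec _ _ _

theorem toTensor_injective (hR : IsQFRing R) (hx : x.right.HasExtensions)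
    (hη : IsCohom x.right m η) (hD : IsCohom x.right (RCoact.self R D) ηD) :
    Function.Injective (hη.toTensor hD) :=
  hη.injective_of_injective hR hx (hD.tens M) m.map_mem_com (hη.toTensor_spec hD) m.map_injective

/-- The exact functor h, applied to 0 → M → M ⊗ D → M ⊗ D ⊗ D, commutes with tensoring by modules,
so it produces the sequence defining M □ h(D). -/
theorem toTensor_exact [Module.Flat R D] (hR : IsQFRing R) (hx : x.right.HasExtensions)
    (hη : IsCohom x.right m η) (hD : IsCohom x.right (RCoact.self R D) ηD) :
    Function.Exact (hη.toTensor hD) (cotensorMap m hD.selfBicoact.left) :=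
  hη.exact_of_exact hR hx (hD.tens M) ((hD.tens D).tens M)
    (cotensorMap_mem_rcom m (BiCoact.self R D)) (hη.toTensor_spec hD)
    (cotensorMap_rTensor_comp (X := X) m (a := LCoact.self R D) hD.selfBicoact_left_spec)
    (exact_cotensorMap_self m)

/-- Both composites are tested on η, where each becomes the left coaction of X applied to the last
tensor factor. -/
theorem toTensor_mem_com (hη : IsCohom x.right m η)
    (hD : IsCohom x.right (RCoact.self R D) ηD) :
    hη.toTensor hD ∈ RCoact.com hη.coact (RCoact.tens M hD.selfBicoact.right) := by
  rw [RCoact.mem_com]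
  refine hη.hom_ext _ _ _ (LinearMap.ext fun y => ?_)
  have h1 := LinearMap.congr_fun hη.coactMap_spec y
  have h2 := LinearMap.congr_fun (hη.toTensor_spec hD) y
  have h3 := LinearMap.congr_fun (aux_nat (hη.toTensor hD) x.left.map) (η y)
  have h4 : ((TensorProduct.assoc R M Y C).symm.toLinearMap ∘ₗ
        hD.selfBicoact.right.map.lTensor M).rTensor X ∘ₗ
        (TensorProduct.assoc R M Y X).symm.toLinearMap ∘ₗ ηD.lTensor M =
      (TensorProduct.assoc R (M ⊗[R] Y) C X).symm.toLinearMap ∘ₗ x.left.map.lTensor (M ⊗[R] Y) ∘ₗ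
        (TensorProduct.assoc R M Y X).symm.toLinearMap ∘ₗ ηD.lTensor M := by
    refine TensorProduct.ext' fun w d => ?_
    have h5 := LinearMap.congr_fun hD.selfBicoact_right_spec d
    simp only [LinearMap.comp_apply, LinearMap.lTensor_tmul, LinearEquiv.coe_coe] at h5 ⊢
    have h6 : ∀ s : Y ⊗[R] X, ((TensorProduct.assoc R M Y C).symm.toLinearMap ∘ₗ
        hD.selfBicoact.right.map.lTensor M).rTensor X
          ((TensorProduct.assoc R M Y X).symm (w ⊗ₜ s)) =
        (TensorProduct.assoc R M Y C).symm.toLinearMap.rTensor X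
          ((TensorProduct.assoc R M (Y ⊗[R] C) X).symm
            (w ⊗ₜ hD.selfBicoact.right.map.rTensor X s)) := by
      intro s
      induction s using TensorProduct.induction_on with
      | zero => simp
      | tmul => simp
      | add a b ha hb => simp only [tmul_add, map_add, ha, hb]
    rw [h6, h5]
    generalize ηD d = s
    induction s using TensorProduct.induction_on with
    | zero => simp
    | tmul a z =>
      simp only [LinearMap.lTensor_tmul, assoc_symm_tmul]
      generalize x.left.map z = s
      induction s using TensorProduct.induction_on with
      | zero => simp
      | tmul => simp
      | add a b ha hb => simp only [tmul_add, map_add, ha, hb]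
    | add a b ha hb => simp only [tmul_add, map_add, ha, hb]
  have h5 := LinearMap.congr_fun h4 (m.map y)
  simp only [RCoact.tens, coact, LinearMap.comp_apply, LinearMap.rTensor_comp,
    LinearEquiv.coe_coe] at *
  rw [h2, h5, h1, h3, h2]

theorem toTensor_natural (hη : IsCohom x.right m η) (hη' : IsCohom x.right n η')
    (hD : IsCohom x.right (RCoact.self R D) ηD) {f : M →ₗ[R] N} (hf : f ∈ RCoact.com m n)
    {g : H →ₗ[R] H'} (hg : g.rTensor X ∘ₗ η = η' ∘ₗ f) :
    hη'.toTensor hD ∘ₗ g = f.rTensor Y ∘ₗ hη.toTensor hD := by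
  refine hη.hom_ext _ _ _ ?_
  rw [LinearMap.rTensor_comp, LinearMap.rTensor_comp, LinearMap.comp_assoc, LinearMap.comp_assoc,
    hg, toTensor_spec, ← LinearMap.comp_assoc, toTensor_spec, LinearMap.comp_assoc,
    RCoact.mem_com.1 hf, ← LinearMap.comp_assoc, ← LinearMap.comp_assoc]
  congr 1
  refine TensorProduct.ext' fun w d => ?_
  simp only [LinearMap.comp_apply, LinearMap.lTensor_tmul, LinearMap.rTensor_tmul,
    LinearEquiv.coe_coe]
  generalize ηD d = s
  induction s using TensorProduct.induction_on with
  | zero => simp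
  | tmul => simp
  | add a b ha hb => simp only [tmul_add, map_add, ha, hb]

/-- Naturality of maps obtained by lifting; applied to the inclusions N □ X → N ⊗ X it gives
naturality of the counit. -/
theorem comp_eq_comp (hη : IsCohom x.right m η) {W V : Type u} [AddCommGroup W] [Module R W]
    [AddCommGroup V] [Module R V] {ε : H →ₗ[R] W} {ε' : H' →ₗ[R] V} {i : M →ₗ[R] W ⊗[R] X}
    {i' : N →ₗ[R] V ⊗[R] X} (hε : ε.rTensor X ∘ₗ η = i) (hε' : ε'.rTensor X ∘ₗ η' = i')
    {f : W →ₗ[R] V} {g : H →ₗ[R] H'} {j : M →ₗ[R] N} (hg : g.rTensor X ∘ₗ η = η' ∘ₗ j)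
    (hj : i' ∘ₗ j = f.rTensor X ∘ₗ i) : ε' ∘ₗ g = f ∘ₗ ε := by
  refine hη.hom_ext _ _ _ ?_
  rw [LinearMap.rTensor_comp, LinearMap.rTensor_comp, LinearMap.comp_assoc, hg,
    LinearMap.comp_assoc, hε, ← hj, ← LinearMap.comp_assoc, hε']

theorem counit_mem_com {n : RCoact R C N} [Module.Flat R D]
    {η : cotensor n x.left →ₗ[R] H ⊗[R] X} (hη : IsCohom x.right (rcotensor n x) η)
    {ε : H →ₗ[R] N} (hε : ε.rTensor X ∘ₗ η = (cotensor n x.left).subtype) :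
    ε ∈ RCoact.com hη.coact n := by
  rw [RCoact.mem_com]
  refine hη.hom_ext _ _ _ (LinearMap.ext fun t => ?_)
  have h1 := LinearMap.congr_fun hη.coactMap_spec t
  have h2 := LinearMap.congr_fun hε t
  have h3 := LinearMap.congr_fun (aux_nat ε x.left.map) (η t)
  have h4 := _root_.mem_cotensor.1 t.2
  simp only [coact, LinearMap.comp_apply, LinearMap.rTensor_comp, Submodule.subtype_apply,
    LinearEquiv.coe_coe] at *
  rw [h1, h3, h2, ← h4, LinearEquiv.symm_apply_apply]

end IsCohom

/-! ### The cohom functor as inverse of the cotensor functor -/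

namespace BiCoact.IsInvertingBicomodule

variable {x : BiCoact R C D X} [Module.Flat R D]

/-- The unit isomorphism. -/
def unitIso (hR : IsQFRing R) (hx : x.IsInvertingBicomodule) {h : RComod R D ⥤ ModuleCat.{u} R}
    (adj : h ⊣ RComod.tensorFunctor x.right) :
    𝟭 (RComod R D) ≅ x.cohomFunctor adj ⋙ RComod.cotensorFunctor x :=
  NatIso.ofComponents (fun M => RComod.isoOfBijective
    (N := (RComod.cotensorFunctor x).obj ((x.cohomFunctor adj).obj M))
    (RComod.homMk (x.right.isCohom adj M).toCotensor
      (x.right.isCohom adj M).toCotensor_mem_com)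
    (hx.bijective_toCotensor (x.right.isCohom adj M)
      (hx.isCohom_cotensor hR _ (x.right.isCohom adj ⟨_, rcotensor _ x⟩))))
    fun f => RComod.hom_ext <| LinearMap.ext fun y => Subtype.ext <|
      LinearMap.congr_fun (congrArg RComod.lin (adj.unit.naturality f)) y

/-- The counit as a linear map. -/
def counitMap {h : RComod R D ⥤ ModuleCat.{u} R}
    (adj : h ⊣ RComod.tensorFunctor x.right) (N : RComod R C) :
    h.obj ((RComod.cotensorFunctor x).obj N) →ₗ[R] N.carrier :=
  (x.right.isCohom adj ((RComod.cotensorFunctor x).obj N)).lift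
    (cotensor N.coact x.left).subtype (RCoact.subtype_mem_com _ _ _)

theorem counitMap_spec {h : RComod R D ⥤ ModuleCat.{u} R}
    (adj : h ⊣ RComod.tensorFunctor x.right) (N : RComod R C) :
    (counitMap adj N).rTensor X ∘ₗ RComod.lin (adj.unit.app ((RComod.cotensorFunctor x).obj N)) =
      (cotensor N.coact x.left).subtype :=
  (x.right.isCohom adj ((RComod.cotensorFunctor x).obj N)).lift_spec _ _

/-- The counit isomorphism. -/
def counitIso (hR : IsQFRing R) (hx : x.IsInvertingBicomodule) {h : RComod R D ⥤ ModuleCat.{u} R}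
    (adj : h ⊣ RComod.tensorFunctor x.right) :
    RComod.cotensorFunctor x ⋙ x.cohomFunctor adj ≅ 𝟭 (RComod R C) :=
  NatIso.ofComponents (fun N => RComod.isoOfBijective
    (M := (x.cohomFunctor adj).obj ((RComod.cotensorFunctor x).obj N))
    (RComod.homMk (counitMap adj N)
      ((x.right.isCohom adj ((RComod.cotensorFunctor x).obj N)).counit_mem_com
        (counitMap_spec adj N)))
    (hx.bijective_of_cotensor hR N.coact
      (x.right.isCohom adj ((RComod.cotensorFunctor x).obj N)) (counitMap_spec adj N)))
    fun {M N} f => RComod.hom_ext <| by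
      exact (x.right.isCohom adj ((RComod.cotensorFunctor x).obj M)).comp_eq_comp
        (counitMap_spec adj M) (counitMap_spec adj N) (f := RComod.lin f)
        (congrArg RComod.lin (adj.unit.naturality ((RComod.cotensorFunctor x).map f)).symm) rfl

/-- The cotensor functor is an equivalence with inverse the cohom functor. -/
def equivalence (hR : IsQFRing R) (hx : x.IsInvertingBicomodule)
    {h : RComod R D ⥤ ModuleCat.{u} R} (adj : h ⊣ RComod.tensorFunctor x.right) :
    RComod R C ≌ RComod R D :=
  CategoryTheory.Equivalence.mk (RComod.cotensorFunctor x) (x.cohomFunctor adj)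
    (hx.counitIso hR adj).symm
    (hx.unitIso hR adj).symm

end BiCoact.IsInvertingBicomodule

/-- `h_D(X,-) ≅ - □_D h_D(X,D)`. -/
def BiCoact.cohomIso [Module.Flat R C] [Module.Flat R D] (hR : IsQFRing R) (x : BiCoact R C D X)
    (hx : x.right.HasExtensions) {h : RComod R D ⥤ ModuleCat.{u} R}
    (adj : h ⊣ RComod.tensorFunctor x.right) :
    x.cohomFunctor adj ≅ RComod.cotensorFunctor (x.cohomSelf adj) :=
  let hD := x.right.isCohom adj ⟨D, RCoact.self R D⟩
  NatIso.ofComponents (fun M => RComod.isoOfBijective (M := (x.cohomFunctor adj).obj M)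
    (N := (RComod.cotensorFunctor (x.cohomSelf adj)).obj M)
    (RComod.homMk (((x.right.isCohom adj M).toTensor hD).codRestrict
        (cotensor M.coact (x.cohomSelf adj).left)
        (fun y => ((x.right.isCohom adj M).toTensor_exact hR hx hD _).2 ⟨y, rfl⟩))
      (RCoact.mem_com_sub _ _ _ _ ((x.right.isCohom adj M).toTensor_mem_com hD)))
    ⟨fun a b hab => (x.right.isCohom adj M).toTensor_injective hR hx hD
        (congrArg Subtype.val hab),
      fun t => by
        obtain ⟨z, hz⟩ := ((x.right.isCohom adj M).toTensor_exact hR hx hD _).1 t.2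
        exact ⟨z, Subtype.ext hz⟩⟩)
    fun {M N} f => RComod.hom_ext <| LinearMap.ext fun y => Subtype.ext <|
      LinearMap.congr_fun ((x.right.isCohom adj M).toTensor_natural (x.right.isCohom adj N) hD
        (RComod.lin_mem f) (congrArg RComod.lin (adj.unit.naturality f).symm)) y

end CohomCotensor


/-! ### Bicomodules whose cotensor functor is an equivalence -/

section Invertible

variable {R : Type u} [CommRing R]
variable {C : Type u} [AddCommGroup C] [Module R C] [Coalgebra R C]
variable {D : Type u} [AddCommGroup D] [Module R D] [Coalgebra R D]
variable {M : Type u} [AddCommGroup M] [Module R M]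
variable {W X : Type u} [AddCommGroup W] [Module R W] [AddCommGroup X] [Module R X]

/-- The map `W ⊗ C → W` induced by the counit. -/
def tensorCounit (R W C : Type u) [CommRing R] [AddCommGroup W] [Module R W] [AddCommGroup C]
    [Module R C] [Coalgebra R C] : W ⊗[R] C →ₗ[R] W :=
  (TensorProduct.rid R W).toLinearMap ∘ₗ (Coalgebra.counit (R := R) (A := C)).lTensor W

theorem tensorCounit_tmul (w : W) (c : C) :
    tensorCounit R W C (w ⊗ₜ c) = Coalgebra.counit (R := R) c • w := by
  simp [tensorCounit]

theorem tensorCounit_natural {V : Type u} [AddCommGroup V] [Module R V] (f : W →ₗ[R] V) :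
    tensorCounit R V C ∘ₗ f.rTensor C = f ∘ₗ tensorCounit R W C :=
  TensorProduct.ext' fun _ _ => by simp [tensorCounit_tmul]

theorem tensorCounit_rTensor_comul :
    (tensorCounit R W C).rTensor C ∘ₗ (RCoact.tens W (RCoact.self R C)).map = LinearMap.id := by
  refine TensorProduct.ext' fun w c => ?_
  have h : ∀ s : C ⊗[R] C, (tensorCounit R W C).rTensor C
      ((TensorProduct.assoc R W C C).symm (w ⊗ₜ s)) =
      w ⊗ₜ TensorProduct.lid R C ((Coalgebra.counit (R := R)).rTensor C s) := by
    intro s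
    induction s using TensorProduct.induction_on with
    | zero => simp
    | tmul => simp [tensorCounit_tmul, smul_tmul]
    | add a b ha hb => simp only [tmul_add, map_add, ha, hb]
  simp only [RCoact.tens, RCoact.self, LinearMap.comp_apply, LinearMap.lTensor_tmul,
    LinearEquiv.coe_coe, h, Coalgebra.rTensor_counit_comul]
  simp

namespace RCoact

/-- With `tensorCounit_comp_rTensor` this is the bijection between linear maps M → W and colinear
maps M → W ⊗ C, the cofreeness of W ⊗ C. -/
theorem rTensor_tensorCounit_comp {m : RCoact R C M} {g : M →ₗ[R] W ⊗[R] C}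
    (hg : g ∈ com m (tens W (self R C))) :
    (tensorCounit R W C ∘ₗ g).rTensor C ∘ₗ m.map = g := by
  rw [LinearMap.rTensor_comp, LinearMap.comp_assoc, ← mem_com.1 hg, ← LinearMap.comp_assoc,
    tensorCounit_rTensor_comul, LinearMap.id_comp]

theorem tensorCounit_comp_rTensor (m : RCoact R C M) (f : M →ₗ[R] W) :
    tensorCounit R W C ∘ₗ f.rTensor C ∘ₗ m.map = f := by
  rw [← LinearMap.comp_assoc, tensorCounit_natural, LinearMap.comp_assoc]
  exact LinearMap.ext fun y => congrArg f (m.counit_apply y)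

end RCoact

namespace RComod

/-- The forgetful functor. -/
def forgetful (R C : Type u) [CommRing R] [AddCommGroup C] [Module R C] [Coalgebra R C] :
    RComod R C ⥤ ModuleCat.{u} R where
  obj M := ModuleCat.of R M.carrier
  map f := ModuleCat.ofHom (lin f)

/-- `- ⊗ C` is right adjoint to the forgetful functor. -/
def forgetAdj (R C : Type u) [CommRing R] [AddCommGroup C] [Module R C] [Coalgebra R C] :
    forgetful R C ⊣ tensorFunctor (RCoact.self R C) :=
  Adjunction.mkOfHomEquiv
    { homEquiv := fun M W =>
        { toFun := fun f => homMk (f.hom.rTensor C ∘ₗ M.coact.map)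
            (RCoact.comp_mem_com M.coact.map_mem_com (RCoact.rTensor_mem_com _ f.hom))
          invFun := fun g => ModuleCat.ofHom (tensorCounit R W C ∘ₗ lin g)
          left_inv := fun f => ModuleCat.hom_ext (M.coact.tensorCounit_comp_rTensor f.hom)
          right_inv := fun g => hom_ext (RCoact.rTensor_tensorCounit_comp (lin_mem g)) }
      homEquiv_naturality_left_symm := fun _ _ => rfl
      homEquiv_naturality_right := fun {M W V} f g => hom_ext <| by
        change (g.hom ∘ₗ f.hom).rTensor C ∘ₗ M.coact.map = _
        rw [LinearMap.rTensor_comp]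
        rfl }

end RComod

namespace LCoact

theorem rTensor_tensorCounit_lTensor (x : LCoact R C X) :
    (tensorCounit R W C).rTensor X ∘ₗ
      ((TensorProduct.assoc R W C X).symm.toLinearMap ∘ₗ x.map.lTensor W) = LinearMap.id := by
  have e : (tensorCounit R W C).rTensor X ∘ₗ (TensorProduct.assoc R W C X).symm.toLinearMap =
      ((TensorProduct.lid R X).toLinearMap ∘ₗ
        (Coalgebra.counit (R := R) (A := C)).rTensor X).lTensor W := by
    refine TensorProduct.ext' fun h t => ?_
    induction t using TensorProduct.induction_on with
    | zero => simp
    | tmul a y => simp [smul_tmul', tensorCounit_tmul]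
    | add x y hx hy => simp only [tmul_add, map_add, hx, hy]
  rw [← LinearMap.comp_assoc, e, ← LinearMap.lTensor_comp, LinearMap.comp_assoc, x.counit,
    LinearMap.lTensor_id]

/-- Coassociativity of the left coaction places W ⊗ ρ_X in (W ⊗ C) □ X; this and
`eq_of_mem_cotensor` identify that cotensor product with W ⊗ X. -/
theorem lTensor_mem_cotensor (x : LCoact R C X) (t : W ⊗[R] X) :
    (TensorProduct.assoc R W C X).symm (x.map.lTensor W t) ∈
      cotensor (RCoact.tens W (RCoact.self R C)) x := by
  rw [mem_cotensor]
  induction t using TensorProduct.induction_on with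
  | zero => simp
  | tmul w y =>
    have h1 : ∀ s : C ⊗[R] X, (TensorProduct.assoc R (W ⊗[R] C) C X)
        ((RCoact.tens W (RCoact.self R C)).map.rTensor X
          ((TensorProduct.assoc R W C X).symm (w ⊗ₜ s))) =
        (TensorProduct.assoc R W C (C ⊗[R] X)).symm (w ⊗ₜ
          (TensorProduct.assoc R C C X ((Coalgebra.comul (R := R) (A := C)).rTensor X s))) := by
      intro s
      induction s using TensorProduct.induction_on with
      | zero => simp
      | tmul c z =>
        simp only [RCoact.tens, RCoact.self, assoc_symm_tmul, LinearMap.rTensor_tmul,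
          LinearMap.comp_apply, LinearEquiv.coe_coe, LinearMap.lTensor_tmul]
        generalize (Coalgebra.comul (R := R) c) = s
        induction s using TensorProduct.induction_on with
        | zero => simp
        | tmul => simp
        | add a b ha hb => simp only [add_tmul, tmul_add, map_add, ha, hb]
      | add a b ha hb => simp only [tmul_add, map_add, ha, hb]
    have h2 : ∀ s : C ⊗[R] X, x.map.lTensor (W ⊗[R] C)
        ((TensorProduct.assoc R W C X).symm (w ⊗ₜ s)) =
        (TensorProduct.assoc R W C (C ⊗[R] X)).symm (w ⊗ₜ x.map.lTensor C s) := by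
      intro s
      induction s using TensorProduct.induction_on with
      | zero => simp
      | tmul => simp
      | add a b ha hb => simp only [tmul_add, map_add, ha, hb]
    have h3 := LinearMap.congr_fun x.coassoc y
    simp only [LinearMap.comp_apply, LinearEquiv.coe_coe] at h3
    rw [LinearMap.lTensor_tmul, h1, h2, h3]
  | add a b ha hb => simp only [map_add, ha, hb]

/-- Applying the counit to the middle factor C of the equation defining the cotensor product
reconstructs t. -/
theorem eq_of_mem_cotensor (x : LCoact R C X) {t : (W ⊗[R] C) ⊗[R] X}
    (ht : t ∈ cotensor (RCoact.tens W (RCoact.self R C)) x) :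
    (TensorProduct.assoc R W C X).symm (x.map.lTensor W ((tensorCounit R W C).rTensor X t)) =
      t := by
  have h1 : (tensorCounit R W C).rTensor (C ⊗[R] X) ∘ₗ x.map.lTensor (W ⊗[R] C) =
      x.map.lTensor W ∘ₗ (tensorCounit R W C).rTensor X :=
    TensorProduct.ext' fun _ _ => rfl
  have h2 : (tensorCounit R W C).rTensor (C ⊗[R] X) ∘ₗ
      (TensorProduct.assoc R (W ⊗[R] C) C X).toLinearMap =
      (TensorProduct.assoc R W C X).toLinearMap ∘ₗ
        ((tensorCounit R W C).rTensor C).rTensor X :=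
    TensorProduct.ext_threefold fun _ _ _ => rfl
  have h3 := congrArg (LinearMap.rTensor X) (tensorCounit_rTensor_comul (R := R) (W := W) (C := C))
  rw [LinearMap.rTensor_comp, LinearMap.rTensor_id] at h3
  have h4 := mem_cotensor.1 ht
  have h5 := LinearMap.congr_fun h1 t
  have h6 := LinearMap.congr_fun h2 ((RCoact.tens W (RCoact.self R C)).map.rTensor X t)
  have h7 := LinearMap.congr_fun h3 t
  simp only [LinearMap.comp_apply, LinearEquiv.coe_coe, LinearMap.id_apply] at h5 h6 h7
  rw [← h5, ← h4, h6, h7, LinearEquiv.symm_apply_apply]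

end LCoact

/-! ### What invertibility implies for the right comodule X -/

namespace BiCoact

variable (x : BiCoact R C D X)

theorem lTensor_left_mem_com (W : Type u) [AddCommGroup W] [Module R W] :
    (TensorProduct.assoc R W C X).symm.toLinearMap ∘ₗ x.left.map.lTensor W ∈
      RCoact.com (RCoact.tens W x.right) (RCoact.tens (W ⊗[R] C) x.right) :=
  RCoact.comp_mem_com (RCoact.lTensor_mem_com W x.colinear)
    (IsCohom.assocSymm_mem_com C x.right)

theorem RightCondition.isInvertingBicomodule {x : BiCoact R C D X} (hx : x.RightCondition) :
    x.IsInvertingBicomodule := by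
  obtain ⟨-, h1, h2, h, adj, h3⟩ := hx
  exact ⟨RComod.hasExtensions h1, RComod.cogenerates h2, (IsCohom.coendIso_iff _).1 h3⟩

variable [Module.Flat R D]

/-- `W ⊗ X ≅ (W ⊗ C) □_C X`, naturally in `W`. -/
def tensorCotensorIso : RComod.tensorFunctor x.right ≅
    RComod.tensorFunctor (RCoact.self R C) ⋙ RComod.cotensorFunctor x :=
  NatIso.ofComponents (fun W => RComod.isoOfBijective
    (N := (RComod.cotensorFunctor x).obj ((RComod.tensorFunctor (RCoact.self R C)).obj W))
    (RComod.homMk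
      (((TensorProduct.assoc R W C X).symm.toLinearMap ∘ₗ x.left.map.lTensor W).codRestrict _
        x.left.lTensor_mem_cotensor)
      (RCoact.mem_com_sub _ _ _ _ (x.lTensor_left_mem_com W)))
    ⟨fun a b hab => by
        have h := congrArg ((tensorCounit R W C).rTensor X) (congrArg Subtype.val hab)
        have e := LinearMap.congr_fun (x.left.rTensor_tensorCounit_lTensor (W := W))
        exact (e a).symm.trans (h.trans (e b)),
      fun t => ⟨(tensorCounit R W C).rTensor X t.1,
        Subtype.ext (x.left.eq_of_mem_cotensor t.2)⟩⟩)
    fun f => RComod.hom_ext <| LinearMap.ext fun t => Subtype.ext <|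
      (LinearMap.congr_fun (IsCohom.aux_nat f.hom x.left.map) t).symm

/-- `X ≅ C □_C X`. -/
def selfCotensorIso : (⟨X, x.right⟩ : RComod R D) ≅
    (RComod.cotensorFunctor x).obj ⟨C, RCoact.self R C⟩ :=
  RComod.isoMk (M := ⟨X, x.right⟩) (N := ⟨R ⊗[R] X, RCoact.tens R x.right⟩)
      (TensorProduct.lid R X).symm (IsCohom.lidSymm_mem_com x.right) ≪≫
    x.tensorCotensorIso.app (ModuleCat.of R R) ≪≫
    (RComod.cotensorFunctor x).mapIso (RComod.isoMk
      (M := ⟨R ⊗[R] C, RCoact.tens R (RCoact.self R C)⟩) (N := ⟨C, RCoact.self R C⟩)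
      (TensorProduct.lid R C) (RCoact.lid_mem_com _))

theorem selfCotensorIso_apply (y : X) :
    (RComod.lin x.selfCotensorIso.hom y : cotensor (RCoact.self R C) x.left).1 =
      x.left.map y := by
  change (TensorProduct.lid R C).toLinearMap.rTensor X ((TensorProduct.assoc R R C X).symm
    (x.left.map.lTensor R ((TensorProduct.lid R X).symm y))) = _
  rw [lid_symm_apply, LinearMap.lTensor_tmul]
  generalize x.left.map y = s
  induction s using TensorProduct.induction_on with
  | zero => simp
  | tmul => simp
  | add a b ha hb => simp only [tmul_add, map_add, ha, hb]

variable {x}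

/-- Under X ≅ C □ X and W ⊗ X ≅ (W ⊗ C) □ X, full faithfulness turns colinear maps X → W ⊗ X into
colinear maps C → W ⊗ C, and these are linear maps C → W by cofreeness. -/
theorem Invertible.isCohom (hx : x.Invertible) :
    IsCohom x.right x.right x.left.map where
  colinear := x.colinear
  exists_lift W _ _ f hf := by
    have : (RComod.cotensorFunctor x).IsEquivalence := hx
    let f' : (⟨X, x.right⟩ : RComod R D) ⟶ (RComod.tensorFunctor x.right).obj (ModuleCat.of R W) :=
      RComod.homMk f hf
    obtain ⟨g, hg⟩ := (RComod.cotensorFunctor x).map_surjective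
      (x.selfCotensorIso.inv ≫ f' ≫ x.tensorCotensorIso.hom.app (ModuleCat.of R W))
    rw [Iso.eq_inv_comp] at hg
    let k : C →ₗ[R] W ⊗[R] C := RComod.lin g
    refine ⟨tensorCounit R W C ∘ₗ k, LinearMap.ext fun y => ?_⟩
    have h1 : k.rTensor X (x.left.map y) =
        (TensorProduct.assoc R W C X).symm (x.left.map.lTensor W (f y)) := by
      have h2 := congrArg Subtype.val (LinearMap.congr_fun (congrArg RComod.lin hg) y :
        (_ : cotensor (RCoact.tens W (RCoact.self R C)) x.left) = _)
      have h3 := x.selfCotensorIso_apply y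
      rw [← h3]
      exact h2
    have h4 := LinearMap.congr_fun (x.left.rTensor_tensorCounit_lTensor (W := W)) (f y)
    simp only [LinearMap.comp_apply, LinearEquiv.coe_coe, LinearMap.id_apply] at h4
    rw [LinearMap.rTensor_comp, LinearMap.comp_apply, LinearMap.comp_apply, h1, h4]
  hom_ext W _ _ f g h := by
    have : (RComod.cotensorFunctor x).IsEquivalence := hx
    -- The colinear map C → W ⊗ C belonging to k. Faithfulness allows the two such maps to be
    -- compared after cotensoring with X, where `key` expresses them through k ⊗ X and the coaction
    -- of X.
    let cofree (k : C →ₗ[R] W) : (⟨C, RCoact.self R C⟩ : RComod R C) ⟶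
        (RComod.tensorFunctor (RCoact.self R C)).obj (ModuleCat.of R W) :=
      RComod.homMk (k.rTensor C ∘ₗ Coalgebra.comul)
        (RCoact.comp_mem_com (RCoact.self R C).map_mem_com (RCoact.rTensor_mem_com _ k))
    suffices cofree f = cofree g by
      rw [← (RCoact.self R C).tensorCounit_comp_rTensor f,
        ← (RCoact.self R C).tensorCounit_comp_rTensor g]
      exact congrArg (fun k => tensorCounit R W C ∘ₗ RComod.lin k) this
    refine (RComod.cotensorFunctor x).map_injective ?_
    rw [← cancel_epi x.selfCotensorIso.hom]
    refine RComod.hom_ext (LinearMap.ext fun y => Subtype.ext ?_)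
    have key : ∀ k : C →ₗ[R] W, (k.rTensor C ∘ₗ Coalgebra.comul).rTensor X (x.left.map y) =
        (TensorProduct.assoc R W C X).symm
          (x.left.map.lTensor W (k.rTensor X (x.left.map y))) := by
      intro k
      have h1 := LinearMap.congr_fun (IsCohom.aux_nat k x.left.map) (x.left.map y)
      have h2 := LinearMap.congr_fun x.left.coassoc y
      simp only [LinearMap.comp_apply, LinearEquiv.coe_coe, LinearMap.rTensor_comp] at *
      rw [← h1, h2, LinearEquiv.symm_apply_apply]
    have h5 := LinearMap.congr_fun h y
    simp only [LinearMap.comp_apply] at h5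
    have h6 := (key f).trans ((congrArg (fun z => (TensorProduct.assoc R W C X).symm
      (x.left.map.lTensor W z)) h5).trans (key g).symm)
    rw [← x.selfCotensorIso_apply y] at h6
    exact h6

/-- An equivalence transports the injective cogenerator C to C □ X ≅ X, and - ⊗ X is the right
adjoint - ⊗ C followed by the equivalence. -/
theorem Invertible.rightCondition [Module.Flat R C] (hR : IsQFRing R) (hx : x.Invertible) :
    x.RightCondition := by
  have : (RComod.cotensorFunctor x).IsEquivalence := hx
  have : (RComod.tensorFunctor (RCoact.self R C)).IsRightAdjoint :=
    (RComod.forgetAdj R C).isRightAdjoint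
  have hq : x.right.QuasiFinite := Functor.isRightAdjoint_of_iso x.tensorCotensorIso.symm
  refine ⟨hq, Injective.of_iso x.selfCotensorIso.symm
    (((RComod.cotensorFunctor x).asEquivalence.map_injective_iff _).2
      (RComod.injective_self hR.2)),
    ((RComod.isCoseparator_self hR).of_equivalence (RComod.cotensorFunctor x).asEquivalence).of_iso
      x.selfCotensorIso.symm, ?_⟩
  have : (RComod.tensorFunctor x.right).IsRightAdjoint := hq
  let adj := Adjunction.ofIsRightAdjoint (RComod.tensorFunctor x.right)
  exact ⟨_, adj, (IsCohom.coendIso_iff _).2 hx.isCohom⟩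

theorem invertible_iff_rightCondition [Module.Flat R C] (hR : IsQFRing R) :
    x.Invertible ↔ x.RightCondition := by
  refine ⟨fun h => h.rightCondition hR, fun h => ?_⟩
  obtain ⟨-, -, -, k, adj, -⟩ := id h
  exact (h.isInvertingBicomodule.equivalence hR adj).isEquivalence_functor

end BiCoact

end Invertible


/-! ### The cotensor functor on left comodules -/

section LeftFunctor

variable {R : Type u} [CommRing R]
variable {C : Type u} [AddCommGroup C] [Module R C] [Coalgebra R C]
variable {D : Type u} [AddCommGroup D] [Module R D] [Coalgebra R D]
variable {M N K L L' : Type u} [AddCommGroup M] [Module R M] [AddCommGroup N] [Module R N]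
  [AddCommGroup K] [Module R K] [AddCommGroup L] [Module R L] [AddCommGroup L'] [Module R L']
variable {X Y H : Type u} [AddCommGroup X] [Module R X] [AddCommGroup Y] [Module R Y]
  [AddCommGroup H] [Module R H]

namespace LComod

/-- A colinear isomorphism as an isomorphism of comodules. -/
def isoMk {M N : LComod R C} (e : M.carrier ≃ₗ[R] N.carrier)
    (he : e.toLinearMap ∈ LCoact.com M.coact N.coact) : M ≅ N where
  hom := homMk e.toLinearMap he
  inv := homMk e.symm.toLinearMap (LCoact.symm_mem_com e he)
  hom_inv_id := hom_ext (LinearMap.ext e.symm_apply_apply)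
  inv_hom_id := hom_ext (LinearMap.ext e.apply_symm_apply)

/-- A bijective morphism is an isomorphism. -/
def isoOfBijective {M N : LComod R C} (f : M ⟶ N) (hf : Function.Bijective (lin f)) : M ≅ N :=
  isoMk (LinearEquiv.ofBijective (lin f) hf) (lin_mem f)

end LComod

/-- Relates (N □ K) ⊗ L to N □ (K ⊗ L). With `cotensorMap_tens_right` it replaces associativity of
the cotensor product by statements inside plain tensor products. -/
theorem cotensorMap_tens_left (n : RCoact R C N) (k : LCoact R C K) (t : (N ⊗[R] K) ⊗[R] L) :
    cotensorMap n (k.tens L) (TensorProduct.assoc R N K L t) =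
      (TensorProduct.assoc R C K L).toLinearMap.lTensor N
        (TensorProduct.assoc R N (C ⊗[R] K) L ((cotensorMap n k).rTensor L t)) := by
  have e : cotensorMap n (k.tens L) ∘ₗ (TensorProduct.assoc R N K L).toLinearMap =
      (TensorProduct.assoc R C K L).toLinearMap.lTensor N ∘ₗ
        (TensorProduct.assoc R N (C ⊗[R] K) L).toLinearMap ∘ₗ (cotensorMap n k).rTensor L := by
    refine TensorProduct.ext_threefold fun a b c => ?_
    simp only [cotensorMap, LCoact.tens, LinearMap.rTensor_sub, LinearMap.sub_apply,
      LinearMap.comp_apply, map_sub, LinearMap.lTensor_tmul, LinearMap.rTensor_tmul,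
      LinearEquiv.coe_coe, assoc_tmul]
    congr 1
    generalize n.map a = s
    induction s using TensorProduct.induction_on with
    | zero => simp
    | tmul => simp
    | add a b ha hb => simp only [add_tmul, map_add, ha, hb]
  exact LinearMap.congr_fun e t

theorem cotensorMap_tens_right (n : RCoact R D N) (l : LCoact R D L) (t : (M ⊗[R] N) ⊗[R] L) :
    TensorProduct.assoc R M N (D ⊗[R] L) (cotensorMap (RCoact.tens M n) l t) =
      (cotensorMap n l).lTensor M (TensorProduct.assoc R M N L t) := by
  have e : (TensorProduct.assoc R M N (D ⊗[R] L)).toLinearMap ∘ₗ cotensorMap (RCoact.tens M n) l =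
      (cotensorMap n l).lTensor M ∘ₗ (TensorProduct.assoc R M N L).toLinearMap := by
    refine TensorProduct.ext_threefold fun a b c => ?_
    simp only [cotensorMap, RCoact.tens, LinearMap.lTensor_sub, LinearMap.sub_apply,
      LinearMap.comp_apply, map_sub, LinearMap.lTensor_tmul, LinearMap.rTensor_tmul,
      LinearEquiv.coe_coe, assoc_tmul]
    congr 1
    generalize n.map b = s
    induction s using TensorProduct.induction_on with
    | zero => simp
    | tmul => simp
    | add a b ha hb => simp only [tmul_add, add_tmul, map_add, ha, hb]
  exact LinearMap.congr_fun e t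

theorem LCoact.counit_apply (l : LCoact R D L) (y : L) :
    TensorProduct.lid R L ((Coalgebra.counit (R := R) (A := D)).rTensor L (l.map y)) = y :=
  LinearMap.congr_fun l.counit y

theorem LCoact.map_injective (l : LCoact R D L) : Function.Injective l.map := fun y z h => by
  rw [← l.counit_apply y, h, l.counit_apply]

theorem LCoact.map_mem_cotensor (l : LCoact R D L) (y : L) :
    l.map y ∈ cotensor (RCoact.self R D) l :=
  mem_cotensor.2 (LinearMap.congr_fun l.coassoc y).symm

/-- The surjectivity half of L ≅ D □ L: applying the counit to the first factor of the defining
equation recovers z. -/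
theorem LCoact.eq_map_of_mem_cotensor (l : LCoact R D L) {z : D ⊗[R] L}
    (hz : z ∈ cotensor (RCoact.self R D) l) :
    l.map (TensorProduct.lid R L ((Coalgebra.counit (R := R) (A := D)).rTensor L z)) = z := by
  have e1 : l.map ∘ₗ (TensorProduct.lid R L).toLinearMap ∘ₗ
      (Coalgebra.counit (R := R) (A := D)).rTensor L =
      (TensorProduct.lid R (D ⊗[R] L)).toLinearMap ∘ₗ
        (Coalgebra.counit (R := R) (A := D)).rTensor (D ⊗[R] L) ∘ₗ l.map.lTensor D :=
    TensorProduct.ext' fun _ _ => by simp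
  have e2 : (TensorProduct.lid R (D ⊗[R] L)).toLinearMap ∘ₗ
      (Coalgebra.counit (R := R) (A := D)).rTensor (D ⊗[R] L) ∘ₗ
      (TensorProduct.assoc R D D L).toLinearMap ∘ₗ
      (Coalgebra.comul (R := R) (A := D)).rTensor L = LinearMap.id := by
    refine TensorProduct.ext' fun d y => ?_
    have h : ∀ s : D ⊗[R] D, TensorProduct.lid R (D ⊗[R] L)
        ((Coalgebra.counit (R := R) (A := D)).rTensor (D ⊗[R] L)
          (TensorProduct.assoc R D D L (s ⊗ₜ y))) =
        TensorProduct.lid R D ((Coalgebra.counit (R := R) (A := D)).rTensor D s) ⊗ₜ y := by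
      intro s
      induction s using TensorProduct.induction_on with
      | zero => simp
      | tmul => simp [smul_tmul']
      | add a b ha hb => simp only [add_tmul, map_add, ha, hb]
    simp only [LinearMap.comp_apply, LinearEquiv.coe_coe, LinearMap.rTensor_tmul, h,
      Coalgebra.rTensor_counit_comul]
    simp
  have h1 := LinearMap.congr_fun e1 z
  have h2 := LinearMap.congr_fun e2 z
  have h3 := mem_cotensor.1 hz
  change TensorProduct.assoc R D D L ((Coalgebra.comul (R := R) (A := D)).rTensor L z) = _ at h3
  simp only [LinearMap.comp_apply, LinearEquiv.coe_coe, LinearMap.id_apply] at h1 h2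
  rw [h1, ← h3, h2]

/-- An identification of `D` with `Y □_C X` as bicomodules, where the right comodule `Y` is a
retract of `Y ⊗ C`. -/
structure BiCoact.SplitCotensor (b : BiCoact R D C Y) (a : BiCoact R C D X)
    (u : D →ₗ[R] Y ⊗[R] X) : Prop where
  injective : Function.Injective u
  exact : Function.Exact u (cotensorMap b.right a.left)
  left : u ∈ LCoact.com (LCoact.self R D) (b.left.tens X)
  right : u ∈ RCoact.com (RCoact.self R D) (RCoact.tens Y a.right)
  retraction : ∃ s ∈ RCoact.com (RCoact.tens Y (RCoact.self R C)) b.right,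
    s ∘ₗ b.right.map = LinearMap.id

namespace BiCoact.SplitCotensor

variable {b : BiCoact R D C Y} {a : BiCoact R C D X} {u : D →ₗ[R] Y ⊗[R] X}

/-- The retraction Y ⊗ C → Y splits the sequence D → Y ⊗ X → Y ⊗ C ⊗ X over R: the composite u ∘ r
is a projection onto Y □ X, with complement factoring through the second map. -/
theorem exists_leftInverse (h : SplitCotensor b a u) : ∃ r : Y ⊗[R] X →ₗ[R] D,
    r ∘ₗ u = LinearMap.id ∧ ∃ q : Y ⊗[R] (C ⊗[R] X) →ₗ[R] Y ⊗[R] X,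
      u ∘ₗ r = LinearMap.id - q ∘ₗ cotensorMap b.right a.left := by
  obtain ⟨s, hs, hsr⟩ := h.retraction
  let q : Y ⊗[R] (C ⊗[R] X) →ₗ[R] Y ⊗[R] X :=
    s.rTensor X ∘ₗ (TensorProduct.assoc R Y C X).symm.toLinearMap
  -- Replacing the left coaction of X by the right coaction of Y would give the identity, since s
  -- retracts that coaction. The difference of the two coactions is `cotensorMap`.
  let w : Y ⊗[R] X →ₗ[R] Y ⊗[R] X := q ∘ₗ a.left.map.lTensor Y
  have hw : w = LinearMap.id - q ∘ₗ cotensorMap b.right a.left := by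
    have h1 : q ∘ₗ (TensorProduct.assoc R Y C X).toLinearMap ∘ₗ b.right.map.rTensor X =
        LinearMap.id := by
      rw [← LinearMap.rTensor_id, ← hsr, LinearMap.rTensor_comp]
      refine LinearMap.ext fun t => ?_
      simp [q]
    rw [cotensorMap, LinearMap.comp_sub, h1, sub_sub_cancel]
  -- The coaction of X carries Y ⊗ X into (Y ⊗ C) □ X, and the colinear map s induces a map from
  -- there into Y □ X, the range of u.
  have hwmem : ∀ t, w t ∈ LinearMap.range u := fun t =>
    (h.exact _).1 (cotensorMapLeft s hs a.left ⟨_, a.left.lTensor_mem_cotensor t⟩).2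
  let e := LinearEquiv.ofInjective u h.injective
  let r : Y ⊗[R] X →ₗ[R] D := e.symm.toLinearMap ∘ₗ w.codRestrict _ hwmem
  have hur : u ∘ₗ r = w := LinearMap.ext fun t =>
    congrArg Subtype.val (e.apply_symm_apply ⟨w t, hwmem t⟩)
  refine ⟨r, ?_, q, hur.trans hw⟩
  rw [← LinearMap.cancel_left h.injective, ← LinearMap.comp_assoc, hur, hw, LinearMap.sub_comp,
    LinearMap.comp_assoc, h.exact.linearMap_comp_eq_zero]
  simp

/-- A left inverse of the inclusion of `D ≅ Y □_C X` into `Y ⊗ X`. -/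
def leftInverse (h : SplitCotensor b a u) : Y ⊗[R] X →ₗ[R] D := h.exists_leftInverse.choose

theorem leftInverse_comp (h : SplitCotensor b a u) : h.leftInverse ∘ₗ u = LinearMap.id :=
  h.exists_leftInverse.choose_spec.1

theorem leftInverse_rTensor (h : SplitCotensor b a u) (z : D ⊗[R] L) :
    h.leftInverse.rTensor L (u.rTensor L z) = z := by
  rw [← LinearMap.comp_apply, ← LinearMap.rTensor_comp, h.leftInverse_comp]; simp

theorem rTensor_injective (h : SplitCotensor b a u) (L : Type u) [AddCommGroup L] [Module R L] :
    Function.Injective (u.rTensor L) :=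
  Function.LeftInverse.injective h.leftInverse_rTensor

/-- Because the sequence splits, its kernel is still the image of D after tensoring with an
arbitrary L. -/
theorem rTensor_leftInverse (h : SplitCotensor b a u) {t : (Y ⊗[R] X) ⊗[R] L}
    (ht : (cotensorMap b.right a.left).rTensor L t = 0) :
    u.rTensor L (h.leftInverse.rTensor L t) = t := by
  obtain ⟨q, hq⟩ := h.exists_leftInverse.choose_spec.2
  rw [← LinearMap.comp_apply, ← LinearMap.rTensor_comp]
  change (u ∘ₗ h.exists_leftInverse.choose).rTensor L t = t
  rw [hq, LinearMap.rTensor_sub, LinearMap.rTensor_comp, LinearMap.sub_apply,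
    LinearMap.comp_apply, ht]
  simp

/-- The map `Y ⊗ (X ⊗ L) → L` induced by `Y ⊗ X → D → R`. -/
def contraction (h : SplitCotensor b a u) (L : Type u) [AddCommGroup L] [Module R L] :
    Y ⊗[R] (X ⊗[R] L) →ₗ[R] L :=
  (TensorProduct.lid R L).toLinearMap ∘ₗ (Coalgebra.counit ∘ₗ h.leftInverse).rTensor L ∘ₗ
    (TensorProduct.assoc R Y X L).symm.toLinearMap

theorem contraction_natural (h : SplitCotensor b a u) (f : L →ₗ[R] L') (t : Y ⊗[R] (X ⊗[R] L)) :
    h.contraction L' ((f.lTensor X).lTensor Y t) = f (h.contraction L t) := by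
  have e : h.contraction L' ∘ₗ (f.lTensor X).lTensor Y ∘ₗ
      (TensorProduct.assoc R Y X L).toLinearMap =
      f ∘ₗ h.contraction L ∘ₗ (TensorProduct.assoc R Y X L).toLinearMap :=
    TensorProduct.ext_threefold fun _ _ _ => by simp [contraction]
  have h1 := LinearMap.congr_fun e ((TensorProduct.assoc R Y X L).symm t)
  simpa only [LinearMap.comp_apply, LinearEquiv.coe_coe, LinearEquiv.apply_symm_apply] using h1

/-- Left colinearity of u turns the coaction of Y into the comultiplication of D, and contracting
afterwards applies the counit to its second factor. -/
theorem contraction_lTensor_tens (h : SplitCotensor b a u) (z : D ⊗[R] L) :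
    (h.contraction L).lTensor D ((b.left.tens (X ⊗[R] L)).map
      (TensorProduct.assoc R Y X L (u.rTensor L z))) = z := by
  induction z using TensorProduct.induction_on with
  | zero => simp
  | tmul d y =>
    have h1 : ∀ t : Y ⊗[R] X, (h.contraction L).lTensor D ((b.left.tens (X ⊗[R] L)).map
        (TensorProduct.assoc R Y X L (t ⊗ₜ y))) =
        TensorProduct.rid R D ((Coalgebra.counit ∘ₗ h.leftInverse).lTensor D
          ((b.left.tens X).map t)) ⊗ₜ y := by
      intro t
      induction t using TensorProduct.induction_on with
      | zero => simp
      | tmul c z =>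
        simp only [LCoact.tens, LinearMap.comp_apply, LinearEquiv.coe_coe, assoc_tmul,
          LinearMap.rTensor_tmul]
        generalize b.left.map c = s
        induction s using TensorProduct.induction_on with
        | zero => simp
        | tmul => simp [contraction, smul_tmul]
        | add a b ha hb => simp only [add_tmul, map_add, ha, hb]
      | add a b ha hb => simp only [add_tmul, map_add, ha, hb]
    have h2 := LinearMap.congr_fun (LCoact.mem_com.1 h.left) d
    simp only [LinearMap.comp_apply] at h2
    rw [LinearMap.rTensor_tmul, h1, h2, ← LinearMap.comp_apply, ← LinearMap.lTensor_comp,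
      LinearMap.comp_assoc, h.leftInverse_comp, LinearMap.comp_id]
    congr 1
    change TensorProduct.rid R D ((Coalgebra.counit (R := R) (A := D)).lTensor D
      (Coalgebra.comul (R := R) d)) = d
    rw [Coalgebra.lTensor_counit_comul]
    simp
  | add a b ha hb => simp only [map_add, ha, hb]

section Flat

variable [Module.Flat R C]

/-- The map `Y □_C (X □_D L) → L`. -/
def cotensorContraction (h : SplitCotensor b a u) (l : LCoact R D L) :
    cotensor b.right (lcotensor a l) →ₗ[R] L :=
  h.contraction L ∘ₗ (cotensor a.right l).subtype.lTensor Y ∘ₗ (cotensor b.right _).subtype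

/-- The chain L ≅ D □ L ≅ (Y □ X) □ L ≅ Y □ (X □ L), read inside Y ⊗ X ⊗ L. It expresses t through
its contraction, which gives injectivity, colinearity and the computation of preimages. -/
theorem rTensor_map_cotensorContraction (h : SplitCotensor b a u) (l : LCoact R D L)
    (t : cotensor b.right (lcotensor a l)) :
    TensorProduct.assoc R Y X L (u.rTensor L (l.map (h.cotensorContraction l t))) =
      (cotensor a.right l).subtype.lTensor Y t.1 := by
  set t₁ := (cotensor a.right l).subtype.lTensor Y t.1 with ht₁
  let t₀ := (TensorProduct.assoc R Y X L).symm t₁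
  have ht₀ : TensorProduct.assoc R Y X L t₀ = t₁ := LinearEquiv.apply_symm_apply _ _
  -- The outer cotensor condition places the element in (Y □ X) ⊗ L, so it comes from D ⊗ L.
  have hC : (cotensorMap b.right a.left).rTensor L t₀ = 0 := by
    have h1 : cotensorMap b.right (a.left.tens L) t₁ = 0 :=
      (cotensorMapRight b.right (cotensor a.right l).subtype
        (LCoact.subtype_mem_com (a.left.tens L) _ _) t).2
    rw [← ht₀, cotensorMap_tens_left] at h1
    have hinj : Function.Injective ((TensorProduct.assoc R C X L).toLinearMap.lTensor Y) :=
      (LinearEquiv.lTensor Y (TensorProduct.assoc R C X L)).injective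
    exact (LinearEquiv.map_eq_zero_iff _).1 (hinj (h1.trans (map_zero _).symm))
  -- The inner cotensor condition, tensored with Y, places the same element in (Y ⊗ X) □ L.
  have hD : t₀ ∈ cotensor (RCoact.tens Y a.right) l := by
    refine LinearMap.mem_ker.2 ((LinearEquiv.map_eq_zero_iff
      (TensorProduct.assoc R Y X (D ⊗[R] L))).1 ?_)
    rw [cotensorMap_tens_right, ht₀, ht₁, ← LinearMap.comp_apply, ← LinearMap.lTensor_comp,
      (exact_cotensor a.right l).linearMap_comp_eq_zero]
    simp
  have h0 := h.rTensor_leftInverse hC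
  set z := h.leftInverse.rTensor L t₀ with hz
  -- Right colinearity of u pulls the second condition back along the injective map u ⊗ D ⊗ L, so z
  -- lies in D □ L and is the coaction of an element of L.
  have hzmem : z ∈ cotensor (RCoact.self R D) l := by
    have h1 := mem_cotensor.1 hD
    refine mem_cotensor.2 (h.rTensor_injective (D ⊗[R] L) ?_)
    have e1 : u.rTensor (D ⊗[R] L) ∘ₗ (TensorProduct.assoc R D D L).toLinearMap =
        (TensorProduct.assoc R (Y ⊗[R] X) D L).toLinearMap ∘ₗ (u.rTensor D).rTensor L :=
      TensorProduct.ext_threefold fun _ _ _ => rfl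
    have e2 : u.rTensor (D ⊗[R] L) ∘ₗ l.map.lTensor D = l.map.lTensor (Y ⊗[R] X) ∘ₗ u.rTensor L :=
      TensorProduct.ext' fun _ _ => rfl
    have e3 : (u.rTensor D).rTensor L ∘ₗ (RCoact.self R D).map.rTensor L =
        (RCoact.tens Y a.right).map.rTensor L ∘ₗ u.rTensor L := by
      rw [← LinearMap.rTensor_comp, ← LinearMap.rTensor_comp, RCoact.mem_com.1 h.right]
    have e1 := LinearMap.congr_fun e1 ((RCoact.self R D).map.rTensor L z)
    have e2 := LinearMap.congr_fun e2 z
    have e3 := LinearMap.congr_fun e3 z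
    simp only [LinearMap.comp_apply, LinearEquiv.coe_coe] at e1 e2 e3
    rw [e1, e2, e3, h0, h1]
  have h2 : h.cotensorContraction l t =
      TensorProduct.lid R L ((Coalgebra.counit (R := R) (A := D)).rTensor L z) := by
    rw [hz, ← LinearMap.comp_apply (LinearMap.rTensor _ _), ← LinearMap.rTensor_comp]; rfl
  rw [h2, l.eq_map_of_mem_cotensor hzmem, h0, ht₀]

theorem cotensorContraction_bijective [Module.Flat R Y] (h : SplitCotensor b a u)
    (l : LCoact R D L) : Function.Bijective (h.cotensorContraction l) := by
  have hY : Function.Injective ((cotensor a.right l).subtype.lTensor Y) :=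
    Module.Flat.lTensor_preserves_injective_linearMap _ (Submodule.injective_subtype _)
  constructor
  · intro t t' htt
    refine Subtype.ext (hY ?_)
    rw [← h.rTensor_map_cotensorContraction, htt, h.rTensor_map_cotensorContraction]
  · intro y
    -- The preimage of y must be (u ⊗ L) ρ_L(y). It lies in Y ⊗ (X □ L) by flatness of Y, and it
    -- satisfies the outer condition because u takes values in Y □ X.
    have h1 : u.rTensor L (l.map y) ∈ cotensor (RCoact.tens Y a.right) l :=
      (cotensorMapLeft u h.right l ⟨_, l.map_mem_cotensor y⟩).2
    have h2 : (cotensorMap a.right l).lTensor Y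
        (TensorProduct.assoc R Y X L (u.rTensor L (l.map y))) = 0 := by
      rw [← cotensorMap_tens_right, LinearMap.mem_ker.1 h1, map_zero]
    obtain ⟨t, ht⟩ := (Module.Flat.lTensor_exact Y
      (exact_cotensor a.right l) _).1 h2
    have h3 : cotensorMap b.right (a.left.tens L)
        ((cotensor a.right l).subtype.lTensor Y t) = 0 := by
      rw [ht, cotensorMap_tens_left, ← LinearMap.comp_apply (LinearMap.rTensor _ _),
        ← LinearMap.rTensor_comp, h.exact.linearMap_comp_eq_zero]
      simp
    -- The coaction of X □ L is known only through its inclusion into X ⊗ L, and flatness of C and Y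
    -- allows the equation to be checked after this inclusion.
    have h4 : t ∈ cotensor b.right (lcotensor a l) := by
      have hinj : Function.Injective (((cotensor a.right l).subtype.lTensor C).lTensor Y) :=
        Module.Flat.lTensor_preserves_injective_linearMap _
          (LCoact.subtype_lTensor_inj R C _)
      have e1 : ((cotensor a.right l).subtype.lTensor C).lTensor Y ∘ₗ
          (lcotensor a l).map.lTensor Y = (a.left.tens L).map.lTensor Y ∘ₗ
            (cotensor a.right l).subtype.lTensor Y := by
        rw [← LinearMap.lTensor_comp, ← LinearMap.lTensor_comp]
        congr 1
        exact (LCoact.mem_com.1 (LCoact.subtype_mem_com (a.left.tens L) _ _)).symm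
      have e2 : ((cotensor a.right l).subtype.lTensor C).lTensor Y ∘ₗ
          (TensorProduct.assoc R Y C _).toLinearMap =
          (TensorProduct.assoc R Y C _).toLinearMap ∘ₗ
            (cotensor a.right l).subtype.lTensor (Y ⊗[R] C) :=
        TensorProduct.ext_threefold fun _ _ _ => rfl
      have e3 : (cotensor a.right l).subtype.lTensor (Y ⊗[R] C) ∘ₗ b.right.map.rTensor _ =
          b.right.map.rTensor _ ∘ₗ (cotensor a.right l).subtype.lTensor Y :=
        TensorProduct.ext' fun _ _ => rfl
      have e1 := LinearMap.congr_fun e1 t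
      have e2 := LinearMap.congr_fun e2 (b.right.map.rTensor _ t)
      have e3 := LinearMap.congr_fun e3 t
      simp only [LinearMap.comp_apply, LinearEquiv.coe_coe] at e1 e2 e3
      refine mem_cotensor.2 (hinj ?_)
      rw [e1, e2, e3]
      exact mem_cotensor.1 h3
    refine ⟨⟨t, h4⟩, l.map_injective (h.rTensor_injective L
      ((TensorProduct.assoc R Y X L).injective ?_))⟩
    rw [h.rTensor_map_cotensorContraction, ← ht]

variable [Module.Flat R D]

/-- Recovers ρ_L(contraction of t) by contracting the coaction of t, through
`contraction_lTensor_tens`. -/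
theorem cotensorContraction_mem_com (h : SplitCotensor b a u) (l : LCoact R D L) :
    h.cotensorContraction l ∈ LCoact.com (lcotensor b (lcotensor a l)) l := by
  rw [LCoact.mem_com]
  refine LinearMap.ext fun t => ?_
  have h1 := LinearMap.congr_fun (LCoact.subtype_mem_com (b.left.tens (cotensor a.right l))
    (cotensor b.right (lcotensor a l)) (LCoact.isSubcomodule_ker
      (cotensorMap_mem_lcom b (lcotensor a l)))) t
  have h2 := LinearMap.congr_fun (LCoact.mem_com.1
    (LCoact.lTensor_mem_com b.left (cotensor a.right l).subtype)) t.1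
  have h3 := h.rTensor_map_cotensorContraction l t
  have h4 := h.contraction_lTensor_tens (l.map (h.cotensorContraction l t))
  rw [h3] at h4
  simp only [LinearMap.comp_apply] at h1 h2 ⊢
  rw [← h4, h2]
  rw [cotensorContraction, LinearMap.lTensor_comp, LinearMap.lTensor_comp]
  exact congrArg (fun s => (h.contraction L).lTensor D
    (((cotensor a.right l).subtype.lTensor Y).lTensor D s)) h1

/-- `Y □_C (X □_D -)` is isomorphic to the identity. -/
def cotensorIso [Module.Flat R Y] (h : SplitCotensor b a u) :
    LComod.cotensorFunctor a ⋙ LComod.cotensorFunctor b ≅ 𝟭 (LComod R D) :=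
  NatIso.ofComponents (fun L => LComod.isoOfBijective
    (M := (LComod.cotensorFunctor b).obj ((LComod.cotensorFunctor a).obj L))
    (LComod.homMk (h.cotensorContraction L.coact) (h.cotensorContraction_mem_com L.coact))
    (h.cotensorContraction_bijective L.coact))
    fun {L L'} f => LComod.hom_ext <| LinearMap.ext fun t => by
      refine Eq.trans ?_ (h.contraction_natural (LComod.lin f)
        ((cotensor a.right L.coact).subtype.lTensor Y t.1))
      refine congrArg (h.contraction L'.carrier) ?_
      have e : (cotensor a.right L'.coact).subtype.lTensor Y ∘ₗ
          (cotensorMapRight a.right (LComod.lin f) (LComod.lin_mem f)).lTensor Y =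
          ((LComod.lin f).lTensor X).lTensor Y ∘ₗ (cotensor a.right L.coact).subtype.lTensor Y := by
        rw [← LinearMap.lTensor_comp, ← LinearMap.lTensor_comp]; rfl
      exact LinearMap.congr_fun e t.1

end Flat

end BiCoact.SplitCotensor

/-! ### The bicomodules X and h_D(X,D) as mutual inverses -/

namespace BiCoact.IsInvertingBicomodule

variable {x : BiCoact R C D X}

/-- Under h(X) = C, coassociativity of the left coaction says that the comultiplication satisfies
the equation characterizing the coaction on h(X). -/
theorem coact_isCohom (hx : x.IsInvertingBicomodule) : hx.isCohom.coact = RCoact.self R C := by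
  have h : hx.isCohom.coactMap = Coalgebra.comul := hx.isCohom.hom_ext _ _ _ <| by
    rw [hx.isCohom.coactMap_spec, x.left.coassoc, ← LinearMap.comp_assoc]
    simp
  simp only [IsCohom.coact, RCoact.self, h]

/-- The map C → X ⊗ h(D) is h applied to ρ_X : X → X ⊗ D, which is left C-colinear by the bicomodule
axiom; coassociativity of the left coaction transfers this to C. -/
theorem toTensor_mem_lcom (hx : x.IsInvertingBicomodule) {ηD : D →ₗ[R] Y ⊗[R] X}
    (hD : IsCohom x.right (RCoact.self R D) ηD) :
    hx.isCohom.toTensor hD ∈ LCoact.com (LCoact.self R C) (x.left.tens Y) := by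
  rw [LCoact.mem_com]
  refine hx.isCohom.hom_ext _ _ _ (LinearMap.ext fun y => ?_)
  set v := hx.isCohom.toTensor hD
  have h1 : v.rTensor X ∘ₗ x.left.map = _ := hx.isCohom.toTensor_spec hD
  have h2 : (x.left.tens Y).map.rTensor X ∘ₗ
      (TensorProduct.assoc R X Y X).symm.toLinearMap ∘ₗ ηD.lTensor X =
      (TensorProduct.assoc R C (X ⊗[R] Y) X).symm.toLinearMap ∘ₗ
        ((TensorProduct.assoc R X Y X).symm.toLinearMap ∘ₗ ηD.lTensor X).lTensor C ∘ₗ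
        (x.left.tens D).map := by
    refine TensorProduct.ext' fun z d => ?_
    simp only [LCoact.tens, LinearMap.comp_apply, LinearMap.lTensor_tmul, LinearMap.rTensor_tmul,
      LinearEquiv.coe_coe]
    have h3 : ∀ s : Y ⊗[R] X, ((TensorProduct.assoc R C X Y).toLinearMap ∘ₗ
        x.left.map.rTensor Y).rTensor X ((TensorProduct.assoc R X Y X).symm (z ⊗ₜ s)) =
        (TensorProduct.assoc R C X Y).toLinearMap.rTensor X
          ((TensorProduct.assoc R (C ⊗[R] X) Y X).symm (x.left.map z ⊗ₜ s)) := by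
      intro s
      induction s using TensorProduct.induction_on with
      | zero => simp
      | tmul => simp
      | add a b ha hb => simp only [tmul_add, map_add, ha, hb]
    rw [h3]
    generalize x.left.map z = t
    induction t using TensorProduct.induction_on with
    | zero => simp
    | tmul c z =>
      simp only [assoc_tmul, LinearMap.lTensor_tmul, LinearMap.comp_apply, LinearEquiv.coe_coe]
      generalize ηD d = s
      induction s using TensorProduct.induction_on with
      | zero => simp
      | tmul => simp
      | add a b ha hb => simp only [tmul_add, map_add, ha, hb]
    | add a b ha hb => simp only [add_tmul, map_add, ha, hb]
  have h4 := LinearMap.congr_fun (LCoact.mem_com.1 x.colinear') y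
  have h5 : (v.lTensor C).rTensor X ∘ₗ (TensorProduct.assoc R C C X).symm.toLinearMap =
      (TensorProduct.assoc R C (X ⊗[R] Y) X).symm.toLinearMap ∘ₗ (v.rTensor X).lTensor C := by
    refine TensorProduct.ext' fun c t => ?_
    induction t using TensorProduct.induction_on with
    | zero => simp
    | tmul => simp
    | add a b ha hb => simp only [tmul_add, map_add, ha, hb]
  have h6 := LinearMap.congr_fun x.left.coassoc y
  have h7 := LinearMap.congr_fun h1 y
  have h8 := LinearMap.congr_fun h2 (x.right.map y)
  have h9 := LinearMap.congr_fun h5 (x.left.map.lTensor C (x.left.map y))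
  have h10 := LinearMap.congr_fun (congrArg (LinearMap.lTensor C) h1) (x.left.map y)
  simp only [LCoact.self, LinearMap.comp_apply, LinearMap.rTensor_comp, LinearMap.lTensor_comp,
    LinearEquiv.coe_coe] at *
  rw [← LinearEquiv.symm_apply_eq] at h6
  rw [h7, h8, h4, ← h6, h9, h10]

variable [Module.Flat R D]

/-- The equivalence M^D → M^C sends the injective comodule D to h(D). -/
theorem hasExtensions_coact (hR : IsQFRing R) (hx : x.IsInvertingBicomodule)
    {h : RComod R D ⥤ ModuleCat.{u} R} (adj : h ⊣ RComod.tensorFunctor x.right) :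
    (x.cohomSelf adj).right.HasExtensions :=
  RComod.hasExtensions (((hx.equivalence hR adj).symm.map_injective_iff
    ⟨D, RCoact.self R D⟩).2 (RComod.injective_self hR.2))

/-- The unit at D is the identification D ≅ h(D) □ X; injectivity of h(D) supplies the retraction.
-/
theorem splitCotensor_unit (hR : IsQFRing R) (hx : x.IsInvertingBicomodule)
    {h : RComod R D ⥤ ModuleCat.{u} R} (adj : h ⊣ RComod.tensorFunctor x.right) :
    SplitCotensor (x.cohomSelf adj) x
      (RComod.lin (adj.unit.app (⟨D, RCoact.self R D⟩ : RComod R D))) := by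
  let hD := x.right.isCohom adj ⟨D, RCoact.self R D⟩
  have hb := hx.bijective_toCotensor hD
    (hx.isCohom_cotensor hR _ (x.right.isCohom adj ⟨_, rcotensor _ x⟩))
  refine ⟨fun a b hab => hb.1 (Subtype.ext hab), fun t => ⟨fun ht => ?_, ?_⟩, ?_, hD.colinear,
    (hx.hasExtensions_coact hR adj).exists_retraction⟩
  · obtain ⟨d, hd⟩ := hb.2 ⟨t, ht⟩
    exact ⟨d, congrArg Subtype.val hd⟩
  · rintro ⟨d, rfl⟩
    exact hD.mem_cotensor d
  · have h1 := hD.selfBicoact_left_spec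
    refine LCoact.mem_com.2 ?_
    change (TensorProduct.assoc R D _ X).toLinearMap ∘ₗ
      hD.selfBicoact.left.map.rTensor X ∘ₗ RComod.lin (adj.unit.app _) = _
    refine (congrArg (fun f => (TensorProduct.assoc R D _ X).toLinearMap ∘ₗ f) h1).trans ?_
    refine LinearMap.ext fun d => ?_
    simp only [LinearMap.comp_apply, LinearEquiv.coe_coe, LinearEquiv.apply_symm_apply]
    rfl

/-- The isomorphism h(M) ≅ M □ h(D) at M = X, where h(X) = C, gives C ≅ X □ h(D); here the
retraction comes from injectivity of X. -/
theorem splitCotensor_toTensor (hR : IsQFRing R) (hx : x.IsInvertingBicomodule)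
    {h : RComod R D ⥤ ModuleCat.{u} R} (adj : h ⊣ RComod.tensorFunctor x.right) :
    SplitCotensor x (x.cohomSelf adj)
      (hx.isCohom.toTensor (x.right.isCohom adj (⟨D, RCoact.self R D⟩ : RComod R D))) where
  injective := hx.isCohom.toTensor_injective hR hx.hasExtensions _
  exact := hx.isCohom.toTensor_exact hR hx.hasExtensions _
  left := hx.toTensor_mem_lcom _
  right := by
    have := hx.isCohom.toTensor_mem_com (x.right.isCohom adj ⟨D, RCoact.self R D⟩)
    rwa [hx.coact_isCohom] at this
  retraction := hx.hasExtensions.exists_retraction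

end BiCoact.IsInvertingBicomodule

/-- Both X and h(D) are injective comodules, hence projective over R. This is the flatness needed
for X □ - and h(D) □ - to be mutually inverse. -/
theorem BiCoact.Invertible.isEquivalence_left [Module.Projective R C] [Module.Projective R D]
    (hR : IsQFRing R) {x : BiCoact R C D X} (hx : x.Invertible) :
    (LComod.cotensorFunctor x).IsEquivalence := by
  obtain ⟨-, -, -, h, adj, -⟩ := hx.rightCondition hR
  have hx := (hx.rightCondition hR).isInvertingBicomodule
  have : Module.Projective R X := hx.hasExtensions.projective hR
  have : Module.Projective R (h.obj ⟨D, RCoact.self R D⟩) :=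
    (hx.hasExtensions_coact hR adj).projective hR
  exact (CategoryTheory.Equivalence.mk (LComod.cotensorFunctor x)
    (LComod.cotensorFunctor (x.cohomSelf adj)) (hx.splitCotensor_unit hR adj).cotensorIso.symm
    (hx.splitCotensor_toTensor hR adj).cotensorIso).isEquivalence_functor

end LeftFunctor


/-! ### Left comodules as right comodules over the co-opposite coalgebra -/

/-- A coalgebra anti-isomorphism. -/
structure CoalgAntiEquiv (R A B : Type u) [CommRing R] [AddCommGroup A] [Module R A]
    [Coalgebra R A] [AddCommGroup B] [Module R B] [Coalgebra R B] where
  toEquiv : A ≃ₗ[R] B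
  comul_apply : ∀ a, Coalgebra.comul (R := R) (toEquiv a) =
    TensorProduct.map toEquiv.toLinearMap toEquiv.toLinearMap
      (TensorProduct.comm R A A (Coalgebra.comul (R := R) a))
  counit_apply : ∀ a, Coalgebra.counit (R := R) (toEquiv a) = Coalgebra.counit (R := R) a

section Flip

variable {R : Type u} [CommRing R]
variable {A B C C' D D' : Type u} [AddCommGroup A] [Module R A] [Coalgebra R A]
  [AddCommGroup B] [Module R B] [Coalgebra R B]
  [AddCommGroup C] [Module R C] [Coalgebra R C] [AddCommGroup C'] [Module R C'] [Coalgebra R C']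
  [AddCommGroup D] [Module R D] [Coalgebra R D] [AddCommGroup D'] [Module R D'] [Coalgebra R D']
variable {M N X W V H H' : Type u} [AddCommGroup M] [Module R M] [AddCommGroup N] [Module R N]
  [AddCommGroup X] [Module R X] [AddCommGroup W] [Module R W] [AddCommGroup V] [Module R V]
  [AddCommGroup H] [Module R H] [AddCommGroup H'] [Module R H']

namespace CoalgAntiEquiv

/-- The inverse of an anti-isomorphism. -/
def symm (e : CoalgAntiEquiv R A B) : CoalgAntiEquiv R B A where
  toEquiv := e.toEquiv.symm
  comul_apply b := by
    obtain ⟨a, rfl⟩ := e.toEquiv.surjective b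
    rw [e.comul_apply, LinearEquiv.symm_apply_apply]
    generalize (Coalgebra.comul (R := R) a) = s
    induction s using TensorProduct.induction_on with
    | zero => simp
    | tmul => simp
    | add a b ha hb => simp only [map_add, ← ha, ← hb]
  counit_apply b := by
    obtain ⟨a, rfl⟩ := e.toEquiv.surjective b
    rw [e.counit_apply, LinearEquiv.symm_apply_apply]

/-- The map `a ⊗ m ↦ m ⊗ e a`. -/
def swap (e : CoalgAntiEquiv R A B) (M : Type u) [AddCommGroup M] [Module R M] :
    A ⊗[R] M ≃ₗ[R] M ⊗[R] B :=
  TensorProduct.comm R A M ≪≫ₗ LinearEquiv.lTensor M e.toEquiv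

@[simp] theorem swap_tmul (e : CoalgAntiEquiv R A B) (a : A) (y : M) :
    e.swap M (a ⊗ₜ y) = y ⊗ₜ e.toEquiv a := rfl

@[simp] theorem swap_symm_tmul (e : CoalgAntiEquiv R A B) (b : B) (y : M) :
    (e.swap M).symm (y ⊗ₜ b) = e.toEquiv.symm b ⊗ₜ y := rfl

@[simp] theorem symm_toEquiv_symm (e : CoalgAntiEquiv R A B) : e.symm.toEquiv.symm = e.toEquiv :=
  rfl

@[simp] theorem symm_toEquiv (e : CoalgAntiEquiv R A B) : e.symm.toEquiv = e.toEquiv.symm :=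
  rfl

end CoalgAntiEquiv

/-- A left comodule as a right comodule along an anti-isomorphism. -/
def LCoact.flip (m : LCoact R A M) (e : CoalgAntiEquiv R A B) : RCoact R B M where
  map := (e.swap M).toLinearMap ∘ₗ m.map
  coassoc := by
    -- The map a ⊗ b ⊗ m ↦ m ⊗ e(b) ⊗ e(a). It carries both sides of left coassociativity to the two
    -- sides of right coassociativity.
    let τ : A ⊗[R] (A ⊗[R] M) →ₗ[R] M ⊗[R] (B ⊗[R] B) :=
      (TensorProduct.assoc R M B B).toLinearMap ∘ₗ (e.swap M).toLinearMap.rTensor B ∘ₗ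
        (e.swap (A ⊗[R] M)).toLinearMap
    have e1 : (TensorProduct.assoc R M B B).toLinearMap ∘ₗ
        ((e.swap M).toLinearMap ∘ₗ m.map).rTensor B ∘ₗ (e.swap M).toLinearMap =
        τ ∘ₗ m.map.lTensor A := TensorProduct.ext' fun _ _ => by simp [τ]
    have e2 : (Coalgebra.comul (R := R) (A := B)).lTensor M ∘ₗ (e.swap M).toLinearMap =
        τ ∘ₗ (TensorProduct.assoc R A A M).toLinearMap ∘ₗ
          (Coalgebra.comul (R := R) (A := A)).rTensor M := by
      refine TensorProduct.ext' fun a y => ?_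
      simp only [LinearMap.comp_apply, LinearEquiv.coe_coe, CoalgAntiEquiv.swap_tmul,
        LinearMap.lTensor_tmul, LinearMap.rTensor_tmul, e.comul_apply]
      generalize (Coalgebra.comul (R := R) a) = s
      induction s using TensorProduct.induction_on with
      | zero => simp
      | tmul => simp [τ]
      | add a b ha hb => simp only [map_add, tmul_add, add_tmul, ha, hb]
    refine LinearMap.ext fun y => ?_
    have h1 := LinearMap.congr_fun e1 (m.map y)
    have h2 := LinearMap.congr_fun e2 (m.map y)
    have h3 := LinearMap.congr_fun m.coassoc y
    simp only [LinearMap.comp_apply, LinearEquiv.coe_coe] at *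
    rw [h1, h2, h3]
  counit := by
    rw [← m.counit, ← LinearMap.comp_assoc, ← LinearMap.comp_assoc, ← LinearMap.comp_assoc]
    congr 1
    exact TensorProduct.ext' fun _ _ => by simp [e.counit_apply]

/-- A right comodule as a left comodule along an anti-isomorphism. -/
def RCoact.flip (m : RCoact R A M) (e : CoalgAntiEquiv R A B) : LCoact R B M where
  map := (e.symm.swap M).symm.toLinearMap ∘ₗ m.map
  coassoc := by
    let τ : (M ⊗[R] A) ⊗[R] A →ₗ[R] B ⊗[R] (B ⊗[R] M) :=
      (e.symm.swap M).symm.toLinearMap.lTensor B ∘ₗ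
        (e.symm.swap (M ⊗[R] A)).symm.toLinearMap
    have e1 : ((e.symm.swap M).symm.toLinearMap ∘ₗ m.map).lTensor B ∘ₗ
        (e.symm.swap M).symm.toLinearMap =
        τ ∘ₗ m.map.rTensor A := TensorProduct.ext' fun _ _ => by simp [τ]
    have e2 : (TensorProduct.assoc R B B M).toLinearMap ∘ₗ
        (Coalgebra.comul (R := R) (A := B)).rTensor M ∘ₗ (e.symm.swap M).symm.toLinearMap =
        τ ∘ₗ (TensorProduct.assoc R M A A).symm.toLinearMap ∘ₗ
          (Coalgebra.comul (R := R) (A := A)).lTensor M := by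
      refine TensorProduct.ext' fun y a => ?_
      simp only [LinearMap.comp_apply, LinearEquiv.coe_coe, CoalgAntiEquiv.swap_symm_tmul,
        LinearMap.lTensor_tmul, LinearMap.rTensor_tmul, CoalgAntiEquiv.symm_toEquiv_symm,
        e.comul_apply]
      generalize (Coalgebra.comul (R := R) a) = s
      induction s using TensorProduct.induction_on with
      | zero => simp
      | tmul => simp [τ]
      | add a b ha hb => simp only [map_add, tmul_add, add_tmul, ha, hb]
    refine LinearMap.ext fun y => ?_
    have h1 := LinearMap.congr_fun e1 (m.map y)
    have h2 := LinearMap.congr_fun e2 (m.map y)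
    have h3 := m.coassoc_apply y
    rw [← LinearEquiv.eq_symm_apply] at h3
    simp only [LinearMap.comp_apply, LinearEquiv.coe_coe] at *
    rw [h1, h2, h3]
  counit := by
    rw [← m.counit, ← LinearMap.comp_assoc, ← LinearMap.comp_assoc, ← LinearMap.comp_assoc]
    congr 1
    exact TensorProduct.ext' fun _ _ => by simp [e.counit_apply]

theorem RCoact.ext_map {m n : RCoact R A M} (h : m.map = n.map) : m = n := by
  cases m; cases n; congr

theorem LCoact.ext_map {m n : LCoact R A M} (h : m.map = n.map) : m = n := by
  cases m; cases n; congr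

theorem LCoact.flip_flip (m : LCoact R A M) (e : CoalgAntiEquiv R A B) :
    (m.flip e).flip e.symm = m :=
  LCoact.ext_map (LinearMap.ext fun y => (e.swap M).symm_apply_apply (m.map y))

theorem RCoact.flip_flip (m : RCoact R A M) (e : CoalgAntiEquiv R A B) :
    (m.flip e).flip e.symm = m :=
  RCoact.ext_map (LinearMap.ext fun y => (e.symm.swap M).apply_symm_apply (m.map y))

theorem LCoact.mem_com_flip {m : LCoact R A M} {n : LCoact R A N} (e : CoalgAntiEquiv R A B)
    {f : M →ₗ[R] N} : f ∈ RCoact.com (m.flip e) (n.flip e) ↔ f ∈ LCoact.com m n := by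
  have h : f.rTensor B ∘ₗ (e.swap M).toLinearMap = (e.swap N).toLinearMap ∘ₗ f.lTensor A :=
    TensorProduct.ext' fun _ _ => rfl
  rw [RCoact.mem_com, LCoact.mem_com, LCoact.flip, LCoact.flip, ← LinearMap.comp_assoc, h,
    LinearMap.comp_assoc, LinearMap.comp_assoc]
  exact LinearMap.cancel_left (e.swap N).injective

theorem RCoact.mem_com_flip {m : RCoact R A M} {n : RCoact R A N} (e : CoalgAntiEquiv R A B)
    {f : M →ₗ[R] N} : f ∈ LCoact.com (m.flip e) (n.flip e) ↔ f ∈ RCoact.com m n := by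
  rw [← LCoact.mem_com_flip e.symm, flip_flip, flip_flip]

theorem LCoact.flip_tens_mem_com (k : LCoact R A M) (e : CoalgAntiEquiv R A B) (g : W →ₗ[R] V) :
    g.rTensor M ∘ₗ (TensorProduct.comm R M W).toLinearMap ∈
      RCoact.com ((k.tens W).flip e) (RCoact.tens V (k.flip e)) := by
  rw [RCoact.mem_com]
  refine TensorProduct.ext' fun y w => ?_
  simp only [LCoact.tens, RCoact.tens, LCoact.flip, LinearMap.comp_apply, LinearEquiv.coe_coe,
    comm_tmul, LinearMap.rTensor_tmul, LinearMap.lTensor_tmul]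
  generalize k.map y = s
  induction s using TensorProduct.induction_on with
  | zero => simp
  | tmul => simp
  | add a b ha hb => simp only [map_add, tmul_add, add_tmul, ha, hb]

/-- Left `A`-comodules as right `B`-comodules, for `B` anti-isomorphic to `A`. -/
def LComod.flipFunctor (e : CoalgAntiEquiv R A B) : LComod R A ⥤ RComod R B where
  obj M := ⟨M.carrier, M.coact.flip e⟩
  map f := RComod.homMk (LComod.lin f) ((LCoact.mem_com_flip e).2 (LComod.lin_mem f))

/-- Right `A`-comodules as left `B`-comodules, for `B` anti-isomorphic to `A`. -/
def RComod.flipFunctor (e : CoalgAntiEquiv R A B) : RComod R A ⥤ LComod R B where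
  obj M := ⟨M.carrier, M.coact.flip e⟩
  map f := LComod.homMk (RComod.lin f) ((RCoact.mem_com_flip e).2 (RComod.lin_mem f))

/-- Flipping a left comodule twice. -/
def LComod.flipFlipIso (e : CoalgAntiEquiv R A B) (M : LComod R A) :
    M ≅ (RComod.flipFunctor e.symm).obj ((LComod.flipFunctor e).obj M) :=
  LComod.isoMk (N := ⟨M.carrier, (M.coact.flip e).flip e.symm⟩) (LinearEquiv.refl R M.carrier) (by
    rw [LCoact.flip_flip]; exact LCoact.id_mem_com _)

/-- Flipping a right comodule twice. -/
def RComod.flipFlipIso (e : CoalgAntiEquiv R A B) (M : RComod R B) :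
    (LComod.flipFunctor e).obj ((RComod.flipFunctor e.symm).obj M) ≅ M :=
  RComod.isoMk (M := ⟨M.carrier, (M.coact.flip e.symm).flip e⟩) (LinearEquiv.refl R M.carrier) (by
    have h : (M.coact.flip e.symm).flip e = M.coact := M.coact.flip_flip e.symm
    rw [h]; exact RCoact.id_mem_com _)

/-- Left `A`-comodules are right `B`-comodules, for `B` anti-isomorphic to `A`. -/
def CoalgAntiEquiv.comodEquiv (e : CoalgAntiEquiv R A B) : LComod R A ≌ RComod R B :=
  CategoryTheory.Equivalence.mk (LComod.flipFunctor e) (RComod.flipFunctor e.symm)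
    (NatIso.ofComponents (LComod.flipFlipIso e) fun _ =>
      LComod.hom_ext (LinearMap.ext fun _ => rfl))
    (NatIso.ofComponents (RComod.flipFlipIso e) fun _ =>
      RComod.hom_ext (LinearMap.ext fun _ => rfl))

/-- Reordering the tensor factors interchanges the two maps whose equalizer is the cotensor product.
-/
theorem mem_cotensor_flip {m : RCoact R A M} {n : LCoact R A N} (e : CoalgAntiEquiv R A B)
    {t : M ⊗[R] N} :
    TensorProduct.comm R M N t ∈ cotensor (n.flip e) (m.flip e) ↔ t ∈ cotensor m n := by
  let p : M ⊗[R] (A ⊗[R] N) ≃ₗ[R] N ⊗[R] (B ⊗[R] M) :=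
    TensorProduct.comm R M (A ⊗[R] N) ≪≫ₗ LinearEquiv.rTensor M (e.swap N) ≪≫ₗ
      TensorProduct.assoc R N B M
  have h1 : (TensorProduct.assoc R N B M).toLinearMap ∘ₗ (n.flip e).map.rTensor M ∘ₗ
      (TensorProduct.comm R M N).toLinearMap = p.toLinearMap ∘ₗ n.map.lTensor M :=
    TensorProduct.ext' fun _ _ => rfl
  have h2 : (m.flip e).map.lTensor N ∘ₗ (TensorProduct.comm R M N).toLinearMap =
      p.toLinearMap ∘ₗ (TensorProduct.assoc R M A N).toLinearMap ∘ₗ m.map.rTensor N := by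
    refine TensorProduct.ext' fun y z => ?_
    simp only [RCoact.flip, LinearMap.comp_apply, LinearEquiv.coe_coe,
      comm_tmul, LinearMap.rTensor_tmul, LinearMap.lTensor_tmul]
    generalize m.map y = s
    induction s using TensorProduct.induction_on with
    | zero => simp
    | tmul => simp [p]
    | add a b ha hb => simp only [map_add, tmul_add, add_tmul, ha, hb]
  have h1 := LinearMap.congr_fun h1 t
  have h2 := LinearMap.congr_fun h2 t
  simp only [LinearMap.comp_apply, LinearEquiv.coe_coe] at h1 h2
  rw [mem_cotensor, mem_cotensor, h1, h2, p.injective.eq_iff, eq_comm]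

/-- The extra isomorphism g lets the cohom module change along with the coalgebra: the right
coaction of X takes values in X ⊗ D, its flip in D' ⊗ X. -/
theorem isCohom_flip {x : LCoact R A X} {m : LCoact R A M} (e : CoalgAntiEquiv R A B)
    (g : H ≃ₗ[R] H') {η : M →ₗ[R] X ⊗[R] H} :
    IsCohom (x.flip e) (m.flip e)
        (g.toLinearMap.rTensor X ∘ₗ (TensorProduct.comm R X H).toLinearMap ∘ₗ η) ↔
      IsLCohom x m η := by
  have hcom : ∀ {W V : Type u} [AddCommGroup W] [Module R W] [AddCommGroup V] [Module R V]
      (g : W ≃ₗ[R] V) (f : M →ₗ[R] X ⊗[R] W),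
      g.toLinearMap.rTensor X ∘ₗ (TensorProduct.comm R X W).toLinearMap ∘ₗ f ∈
        RCoact.com (m.flip e) (RCoact.tens V (x.flip e)) ↔ f ∈ LCoact.com m (x.tens W) := by
    intro W V _ _ _ _ g f
    rw [← LCoact.mem_com_flip e]
    constructor
    · intro h
      let E : X ⊗[R] W ≃ₗ[R] V ⊗[R] X := TensorProduct.comm R X W ≪≫ₗ LinearEquiv.rTensor X g
      have h1 := RCoact.comp_mem_com h
        (RCoact.symm_mem_com E (LCoact.flip_tens_mem_com x e g.toLinearMap))
      have h2 : E.symm.toLinearMap ∘ₗ g.toLinearMap.rTensor X ∘ₗ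
          (TensorProduct.comm R X W).toLinearMap ∘ₗ f = f :=
        LinearMap.ext fun y => E.symm_apply_apply (f y)
      rwa [h2] at h1
    · intro h
      have h1 := RCoact.comp_mem_com h (LCoact.flip_tens_mem_com x e g.toLinearMap)
      rwa [LinearMap.comp_assoc] at h1
  have hmap : ∀ {W : Type u} [AddCommGroup W] [Module R W] (k : H →ₗ[R] W),
      (k ∘ₗ g.symm.toLinearMap).rTensor X ∘ₗ g.toLinearMap.rTensor X ∘ₗ
        (TensorProduct.comm R X H).toLinearMap ∘ₗ η =
      (TensorProduct.comm R X W).toLinearMap ∘ₗ k.lTensor X ∘ₗ η := by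
    intro W _ _ k
    rw [← LinearMap.comp_assoc, ← LinearMap.rTensor_comp, LinearMap.comp_assoc,
      LinearEquiv.symm_comp, LinearMap.comp_id, ← LinearMap.comp_assoc,
      ← LinearMap.comp_assoc]
    congr 1
    exact TensorProduct.ext' fun _ _ => rfl
  have hg : ∀ {W : Type u} [AddCommGroup W] [Module R W] (k : H' →ₗ[R] W),
      k = (k ∘ₗ g.toLinearMap) ∘ₗ g.symm.toLinearMap := fun k => by
    rw [LinearMap.comp_assoc, LinearEquiv.comp_symm, LinearMap.comp_id]
  have hid : ∀ {W : Type u} [AddCommGroup W] [Module R W] (f : M →ₗ[R] X ⊗[R] W),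
      (LinearEquiv.refl R W).toLinearMap.rTensor X ∘ₗ (TensorProduct.comm R X W).toLinearMap ∘ₗ f =
        (TensorProduct.comm R X W).toLinearMap ∘ₗ f := fun f => by
    rw [LinearEquiv.refl_toLinearMap, LinearMap.rTensor_id, LinearMap.id_comp]
  constructor
  · intro h
    refine ⟨(hcom g η).1 h.colinear, fun W _ _ f hf => ?_, fun W _ _ f f' hff => ?_⟩
    · have hf := (hcom (LinearEquiv.refl R W) f).2 hf
      rw [hid] at hf
      obtain ⟨k, hk⟩ := h.exists_lift W _ hf
      rw [hg k, hmap] at hk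
      exact ⟨k ∘ₗ g.toLinearMap, (LinearMap.cancel_left (TensorProduct.comm R X W).injective).1 hk⟩
    · have h1 := h.hom_ext W (f ∘ₗ g.symm.toLinearMap) (f' ∘ₗ g.symm.toLinearMap)
        (by rw [hmap, hmap, hff])
      exact (LinearMap.cancel_right g.symm.surjective).1 h1
  · intro h
    refine ⟨(hcom g η).2 h.colinear, fun W _ _ f hf => ?_, fun W _ _ f f' hff => ?_⟩
    · have h1 : f = (TensorProduct.comm R X W).toLinearMap ∘ₗ
          (TensorProduct.comm R X W).symm.toLinearMap ∘ₗ f := by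
        rw [← LinearMap.comp_assoc, LinearEquiv.comp_symm, LinearMap.id_comp]
      have hf' : (TensorProduct.comm R X W).symm.toLinearMap ∘ₗ f ∈ LCoact.com m (x.tens W) := by
        rw [← hcom (LinearEquiv.refl R W), hid, ← h1]
        exact hf
      obtain ⟨k, hk⟩ := h.exists_lift W _ hf'
      exact ⟨k ∘ₗ g.symm.toLinearMap, by rw [hmap, hk, ← h1]⟩
    · rw [hg f, hg f', hmap, hmap] at hff
      rw [hg f, hg f', h.hom_ext W _ _
        ((LinearMap.cancel_left (TensorProduct.comm R X W).injective).1 hff)]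

/-! ### Flipping bicomodules and the conditions on them -/

namespace BiCoact

/-- A `C`-`D`-bicomodule as a bicomodule over anti-isomorphic coalgebras. -/
def flip (x : BiCoact R C D X) (e : CoalgAntiEquiv R C C') (f : CoalgAntiEquiv R D D') :
    BiCoact R D' C' X where
  left := x.right.flip f
  right := x.left.flip e
  colinear := by
    have h1 := RCoact.comp_mem_com ((LCoact.mem_com_flip e).2 x.colinear')
      (LCoact.flip_tens_mem_com x.left e f.toEquiv.toLinearMap)
    have h2 : (f.symm.swap X).symm.toLinearMap =
        f.toEquiv.toLinearMap.rTensor X ∘ₗ (TensorProduct.comm R X D).toLinearMap :=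
      TensorProduct.ext' fun _ _ => rfl
    rwa [← h2] at h1

theorem flip_flip (x : BiCoact R C D X) (e : CoalgAntiEquiv R C C') (f : CoalgAntiEquiv R D D') :
    (x.flip e f).flip f.symm e.symm = x := by
  have h1 : ((x.flip e f).flip f.symm e.symm).left = x.left := x.left.flip_flip e
  have h2 : ((x.flip e f).flip f.symm e.symm).right = x.right := x.right.flip_flip f
  generalize (x.flip e f).flip f.symm e.symm = z at *
  cases z; cases x
  simp only at h1 h2
  subst h1 h2
  rfl

variable (x : BiCoact R C D X) (e : CoalgAntiEquiv R C C') (f : CoalgAntiEquiv R D D')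

/-- The flip `X □_D N → N □_{D'} X`. -/
def cotensorFlip [Module.Flat R C] [Module.Flat R C'] (N : LComod R D) :
    (LComod.flipFunctor e).obj ((LComod.cotensorFunctor x).obj N) ⟶
      (RComod.cotensorFunctor (x.flip e f)).obj ((LComod.flipFunctor f).obj N) :=
  RComod.homMk (M := ⟨cotensor x.right N.coact, (lcotensor x N.coact).flip e⟩)
    (N := (RComod.cotensorFunctor (x.flip e f)).obj ⟨N.carrier, N.coact.flip f⟩)
    ((TensorProduct.comm R X N.carrier).toLinearMap.restrict
      fun _ ht => (mem_cotensor_flip f).2 ht) <| by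
    refine RCoact.mem_com_sub (RCoact.tens N.carrier (x.flip e f).right) _ _ _ ?_
    have h1 : (cotensor x.right N.coact).subtype ∈ RCoact.com ((lcotensor x N.coact).flip e)
        ((x.left.tens N.carrier).flip e) :=
      (LCoact.mem_com_flip e).2 (LCoact.subtype_mem_com _ _ _)
    have h2 := LCoact.flip_tens_mem_com (W := N.carrier) x.left e LinearMap.id
    rw [LinearMap.rTensor_id, LinearMap.id_comp] at h2
    have h3 := RCoact.comp_mem_com h1 h2
    exact h3

theorem cotensorFlip_bijective [Module.Flat R C] [Module.Flat R C'] (N : LComod R D) :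
    Function.Bijective (RComod.lin (cotensorFlip x e f N)) :=
  ⟨fun a b hab => Subtype.ext ((TensorProduct.comm R X N.carrier).injective
      (congrArg Subtype.val hab : (_ : N.carrier ⊗[R] X) = _)),
    fun t : cotensor (N.coact.flip f) (x.right.flip f) =>
      ⟨⟨(TensorProduct.comm R X N.carrier).symm t.1, (mem_cotensor_flip f).1 (by
        rw [LinearEquiv.apply_symm_apply]; exact t.2)⟩,
      Subtype.ext ((TensorProduct.comm R X N.carrier).apply_symm_apply t.1)⟩⟩

/-- The cotensor functors of `X` and of the flipped bicomodule correspond to each other. -/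
def cotensorFlipIso [Module.Flat R C] [Module.Flat R C'] :
    LComod.cotensorFunctor x ⋙ e.comodEquiv.functor ≅
      f.comodEquiv.functor ⋙ RComod.cotensorFunctor (x.flip e f) :=
  NatIso.ofComponents
    (fun N => RComod.isoOfBijective (cotensorFlip x e f N) (cotensorFlip_bijective x e f N))
    fun {N N'} k => RComod.hom_ext <| LinearMap.ext fun t => Subtype.ext <| by
      have h : (TensorProduct.comm R X N'.carrier).toLinearMap ∘ₗ (LComod.lin k).lTensor X =
          (LComod.lin k).rTensor X ∘ₗ (TensorProduct.comm R X N.carrier).toLinearMap :=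
        TensorProduct.ext' fun _ _ => rfl
      exact LinearMap.congr_fun h t.1

/-- The two cotensor functors differ only by the equivalences between left comodules and right
comodules over anti-isomorphic coalgebras, which can be cancelled. -/
theorem isEquivalence_left_iff [Module.Flat R C] [Module.Flat R C'] :
    (LComod.cotensorFunctor x).IsEquivalence ↔ (x.flip e f).Invertible := by
  constructor
  · intro h
    have h1 : (LComod.cotensorFunctor x ⋙ e.comodEquiv.functor).IsEquivalence := inferInstance
    have h2 := Functor.isEquivalence_of_iso (cotensorFlipIso x e f)
    exact Functor.isEquivalence_of_comp_left f.comodEquiv.functor _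
  · intro h
    have h0 : (RComod.cotensorFunctor (x.flip e f)).IsEquivalence := h
    have h1 : (f.comodEquiv.functor ⋙
      RComod.cotensorFunctor (x.flip e f)).IsEquivalence := inferInstance
    have h2 := Functor.isEquivalence_of_iso (cotensorFlipIso x e f).symm
    exact Functor.isEquivalence_of_comp_right _ e.comodEquiv.functor

end BiCoact

/-- The tensor functors of `X` and of the flipped comodule correspond to each other. -/
def LCoact.tensorFlipIso (x : LCoact R A X) (e : CoalgAntiEquiv R A B) :
    LComod.tensorFunctor x ⋙ e.comodEquiv.functor ≅ RComod.tensorFunctor (x.flip e) :=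
  NatIso.ofComponents (fun W => RComod.isoMk
    (M := ⟨X ⊗[R] W, (x.tens W).flip e⟩) (N := ⟨W ⊗[R] X, RCoact.tens W (x.flip e)⟩)
    (TensorProduct.comm R X W) (by
      have h2 := LCoact.flip_tens_mem_com (W := W) x e LinearMap.id
      rwa [LinearMap.rTensor_id, LinearMap.id_comp] at h2))
    fun {W V} k => RComod.hom_ext <| by
      have h : (TensorProduct.comm R X V).toLinearMap ∘ₗ k.hom.lTensor X =
          k.hom.rTensor X ∘ₗ (TensorProduct.comm R X W).toLinearMap :=
        TensorProduct.ext' fun _ _ => rfl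
      exact h

theorem LCoact.quasiFinite_iff (x : LCoact R A X) (e : CoalgAntiEquiv R A B) :
    x.QuasiFinite ↔ (x.flip e).QuasiFinite := by
  constructor
  · intro h
    have : (LComod.tensorFunctor x).IsRightAdjoint := h
    exact Functor.isRightAdjoint_of_iso (x.tensorFlipIso e)
  · intro h
    have : (RComod.tensorFunctor (x.flip e)).IsRightAdjoint := h
    have h1 : LComod.tensorFunctor x ≅ RComod.tensorFunctor (x.flip e) ⋙ e.comodEquiv.inverse :=
      (Functor.rightUnitor _).symm ≪≫ Functor.isoWhiskerLeft _ e.comodEquiv.unitIso ≪≫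
        (Functor.associator _ _ _).symm ≪≫ Functor.isoWhiskerRight (x.tensorFlipIso e) _
    exact Functor.isRightAdjoint_of_iso h1.symm

/-- The coendomorphism coalgebra is `D`, compatibly with the coactions, if and only if the right
coaction of `X` is universal. -/
theorem IsLCohom.coendIso_iff {x : BiCoact R C D X} {η : X →ₗ[R] X ⊗[R] H}
    (hη : IsLCohom x.left x.left η) :
    hη.CoendIso ↔ IsLCohom x.left x.left x.right.map := by
  constructor
  · rintro ⟨φ, hφ⟩
    rw [← hφ]
    let := hη.coalgebra
    let e : H ≃ₗ[R] D := φ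
    change IsLCohom x.left x.left (e.toLinearMap.lTensor X ∘ₗ η)
    refine ⟨LCoact.comp_mem_com hη.colinear (LCoact.lTensor_mem_com _ _), fun W _ _ f hf => ?_,
      fun W _ _ f g h => ?_⟩
    · obtain ⟨g, hg⟩ := hη.exists_lift W f hf
      refine ⟨g ∘ₗ e.symm.toLinearMap, ?_⟩
      rw [← LinearMap.comp_assoc, ← LinearMap.lTensor_comp, LinearMap.comp_assoc]
      simpa using hg
    · rw [← LinearMap.comp_assoc, ← LinearMap.comp_assoc, ← LinearMap.lTensor_comp,
        ← LinearMap.lTensor_comp] at h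
      exact (LinearMap.cancel_right e.surjective).1 (hη.hom_ext W _ _ h)
  · intro h
    have h1 := hη.lift_spec _ h.colinear
    have h2 := h.lift_spec _ hη.colinear
    let e : H ≃ₗ[R] D := LinearEquiv.ofLinearMap (hη.lift _ h.colinear) (h.lift _ hη.colinear)
      (h.hom_ext _ _ _ (by
        rw [LinearMap.lTensor_comp, LinearMap.comp_assoc, h2, h1]; simp))
      (hη.hom_ext _ _ _ (by
        rw [LinearMap.lTensor_comp, LinearMap.comp_assoc, h1, h2]; simp))
    have he : e.toLinearMap.lTensor X ∘ₗ η = x.right.map := h1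
    let := hη.coalgebra
    have hcounit : Coalgebra.counit (R := R) (A := D) ∘ₗ e.toLinearMap = hη.counit :=
      hη.hom_ext _ _ _ <| by
        rw [hη.counit_spec, LinearMap.lTensor_comp, LinearMap.comp_assoc, he]
        refine LinearMap.ext fun y => (TensorProduct.rid R X).injective ?_
        rw [LinearEquiv.coe_coe, LinearEquiv.apply_symm_apply]
        exact LinearMap.congr_fun x.right.counit y
    have hcomul : TensorProduct.map e.toLinearMap e.toLinearMap ∘ₗ hη.comul =
        Coalgebra.comul (R := R) (A := D) ∘ₗ e.toLinearMap := hη.hom_ext _ _ _ <| by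
      refine LinearMap.ext fun y => ?_
      have h1 := LinearMap.congr_fun hη.comul_spec y
      have h2 := LinearMap.congr_fun he y
      have h3 := x.right.coassoc_apply y
      have h4 : ∀ t : X ⊗[R] H, (TensorProduct.map e.toLinearMap e.toLinearMap).lTensor X
          (TensorProduct.assoc R X H H (η.rTensor H t)) =
          TensorProduct.assoc R X D D
            (x.right.map.rTensor D (e.toLinearMap.lTensor X t)) := by
        intro t
        induction t using TensorProduct.induction_on with
        | zero => simp
        | tmul z a =>
          simp only [LinearMap.lTensor_tmul, LinearMap.rTensor_tmul, ← he, LinearMap.comp_apply]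
          generalize η z = s
          induction s using TensorProduct.induction_on with
          | zero => simp
          | tmul => simp
          | add a b ha hb => simp only [add_tmul, map_add, ha, hb]
        | add a b ha hb => simp only [map_add, ha, hb]
      simp only [LinearMap.comp_apply, LinearMap.lTensor_comp, LinearEquiv.coe_coe] at *
      rw [h1, h4, h2, h3]
    exact ⟨{ e with counit_comp := hcounit, map_comp_comul := hcomul }, he⟩

/-- Quasi-finiteness, injectivity and cogeneration are transported by the equivalence of comodule
categories. The coendomorphism condition is first rewritten as universality of a coaction, which
flips without comparing coalgebra structures. -/
theorem BiCoact.leftCondition_iff (x : BiCoact R C D X) (e : CoalgAntiEquiv R C C')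
    (f : CoalgAntiEquiv R D D') : x.LeftCondition ↔ (x.flip e f).RightCondition := by
  have h1 : x.left.QuasiFinite ↔ (x.flip e f).right.QuasiFinite := x.left.quasiFinite_iff e
  have h2 : Injective (⟨X, x.left⟩ : LComod R C) ↔
      Injective (⟨X, (x.flip e f).right⟩ : RComod R C') :=
    (e.comodEquiv.map_injective_iff ⟨X, x.left⟩).symm
  have h3 : IsCoseparator (⟨X, x.left⟩ : LComod R C) ↔
      IsCoseparator (⟨X, (x.flip e f).right⟩ : RComod R C') :=
    ⟨fun h => h.of_equivalence e.comodEquiv, fun h =>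
      (h.of_equivalence e.comodEquiv.symm).of_iso
        (e.comodEquiv.unitIso.app (⟨X, x.left⟩ : LComod R C)).symm⟩
  have h4 : IsLCohom x.left x.left x.right.map ↔
      IsCohom (x.flip e f).right (x.flip e f).right (x.flip e f).left.map := by
    have h : (f.symm.swap X).symm.toLinearMap =
        f.toEquiv.toLinearMap.rTensor X ∘ₗ (TensorProduct.comm R X D).toLinearMap :=
      TensorProduct.ext' fun _ _ => rfl
    rw [← isCohom_flip e f.toEquiv, ← LinearMap.comp_assoc, ← h]
    rfl
  constructor
  · rintro ⟨hq, hi, hc, h, adj, hφ⟩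
    have : (RComod.tensorFunctor (x.flip e f).right).IsRightAdjoint := h1.1 hq
    exact ⟨h1.1 hq, h2.1 hi, h3.1 hc, _,
      Adjunction.ofIsRightAdjoint (RComod.tensorFunctor (x.flip e f).right),
      (IsCohom.coendIso_iff _).2 (h4.1 ((IsLCohom.coendIso_iff _).1 hφ))⟩
  · rintro ⟨hq, hi, hc, h, adj, hφ⟩
    have : (LComod.tensorFunctor x.left).IsRightAdjoint := h1.2 hq
    exact ⟨h1.2 hq, h2.2 hi, h3.2 hc, _,
      Adjunction.ofIsRightAdjoint (LComod.tensorFunctor x.left),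
      (IsLCohom.coendIso_iff _).2 (h4.2 ((IsCohom.coendIso_iff _).1 hφ))⟩

end Flip

/-- The co-opposite of a coalgebra. -/
def CoOpp (C : Type u) : Type u := C

/-! ### Left-right symmetry through the co-opposite coalgebra -/

section CoOpp

variable {R : Type u} [CommRing R]
variable {C : Type u} [AddCommGroup C] [Module R C] [Coalgebra R C]
variable {D : Type u} [AddCommGroup D] [Module R D] [Coalgebra R D]
variable {X : Type u} [AddCommGroup X] [Module R X]

instance : AddCommGroup (CoOpp C) := inferInstanceAs (AddCommGroup C)

instance : Module R (CoOpp C) := inferInstanceAs (Module R C)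

instance [Module.Projective R C] : Module.Projective R (CoOpp C) :=
  inferInstanceAs (Module.Projective R C)

/-- The identity map to the co-opposite. -/
def CoOpp.equiv (R C : Type u) [CommRing R] [AddCommGroup C] [Module R C] : C ≃ₗ[R] CoOpp C :=
  LinearEquiv.refl R C

/-- The comultiplication of the co-opposite coalgebra. -/
def CoOpp.comul (R C : Type u) [CommRing R] [AddCommGroup C] [Module R C] [Coalgebra R C] :
    CoOpp C →ₗ[R] CoOpp C ⊗[R] CoOpp C :=
  TensorProduct.map (CoOpp.equiv R C).toLinearMap (CoOpp.equiv R C).toLinearMap ∘ₗ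
    (TensorProduct.comm R C C).toLinearMap ∘ₗ Coalgebra.comul ∘ₗ (CoOpp.equiv R C).symm.toLinearMap

/-- The counit of the co-opposite coalgebra. -/
def CoOpp.counit (R C : Type u) [CommRing R] [AddCommGroup C] [Module R C] [Coalgebra R C] :
    CoOpp C →ₗ[R] R :=
  Coalgebra.counit ∘ₗ (CoOpp.equiv R C).symm.toLinearMap

instance : Coalgebra R (CoOpp C) where
  comul := CoOpp.comul R C
  counit := CoOpp.counit R C
  coassoc := by
    let ε := (CoOpp.equiv R C).toLinearMap
    -- Reversal of the three factors. It exchanges the two iterated comultiplications, so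
    -- coassociativity of C is used with its sides swapped.
    let τ : C ⊗[R] (C ⊗[R] C) →ₗ[R] CoOpp C ⊗[R] (CoOpp C ⊗[R] CoOpp C) :=
      TensorProduct.map ε (TensorProduct.map ε ε) ∘ₗ (TensorProduct.assoc R C C C).toLinearMap ∘ₗ
        (TensorProduct.comm R C C).toLinearMap.rTensor C ∘ₗ
        (TensorProduct.comm R C (C ⊗[R] C)).toLinearMap
    refine LinearMap.ext fun c => ?_
    obtain ⟨c, rfl⟩ := (CoOpp.equiv R C).surjective c
    have hc : CoOpp.comul R C (CoOpp.equiv R C c) =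
        TensorProduct.map ε ε (TensorProduct.comm R C C (Coalgebra.comul (R := R) c)) := rfl
    have h1 : ∀ s : C ⊗[R] C, TensorProduct.assoc R _ _ _ ((CoOpp.comul R C).rTensor _
        (TensorProduct.map ε ε (TensorProduct.comm R C C s))) =
        τ ((Coalgebra.comul (R := R) (A := C)).lTensor C s) := by
      intro s
      induction s using TensorProduct.induction_on with
      | zero => simp
      | tmul a b =>
        have hb : CoOpp.comul R C (ε b) =
          TensorProduct.map ε ε (TensorProduct.comm R C C (Coalgebra.comul (R := R) b)) := rfl
        simp only [comm_tmul, map_tmul, LinearMap.rTensor_tmul, LinearMap.lTensor_tmul, hb]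
        generalize (Coalgebra.comul (R := R) b) = s
        induction s using TensorProduct.induction_on with
        | zero => simp
        | tmul => simp [τ]
        | add a b ha hb => simp only [map_add, tmul_add, add_tmul, ha, hb]
      | add a b ha hb => simp only [map_add, ha, hb]
    have h2 : ∀ s : C ⊗[R] C, (CoOpp.comul R C).lTensor _
        (TensorProduct.map ε ε (TensorProduct.comm R C C s)) =
        τ (TensorProduct.assoc R C C C ((Coalgebra.comul (R := R) (A := C)).rTensor C s)) := by
      intro s
      induction s using TensorProduct.induction_on with
      | zero => simp
      | tmul a b =>
        have ha : CoOpp.comul R C (ε a) =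
          TensorProduct.map ε ε (TensorProduct.comm R C C (Coalgebra.comul (R := R) a)) := rfl
        simp only [comm_tmul, map_tmul, LinearMap.rTensor_tmul, LinearMap.lTensor_tmul, ha]
        generalize (Coalgebra.comul (R := R) a) = s
        induction s using TensorProduct.induction_on with
        | zero => simp
        | tmul => simp [τ]
        | add a b ha hb => simp only [map_add, tmul_add, add_tmul, ha, hb]
      | add a b ha hb => simp only [map_add, ha, hb]
    simp only [LinearMap.comp_apply, LinearEquiv.coe_coe, hc, h1, h2]
    rw [Coalgebra.coassoc_apply]
  rTensor_counit_comp_comul := by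
    refine LinearMap.ext fun c => ?_
    obtain ⟨c, rfl⟩ := (CoOpp.equiv R C).surjective c
    have h : ∀ s : C ⊗[R] C, (CoOpp.counit R C).rTensor (CoOpp C)
        (TensorProduct.map (CoOpp.equiv R C).toLinearMap (CoOpp.equiv R C).toLinearMap
          (TensorProduct.comm R C C s)) = (CoOpp.equiv R C).toLinearMap.lTensor R
          (TensorProduct.comm R C R ((Coalgebra.counit (R := R) (A := C)).lTensor C s)) := by
      intro s
      induction s using TensorProduct.induction_on with
      | zero => simp
      | tmul => simp [CoOpp.counit]
      | add a b ha hb => simp only [map_add, ha, hb]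
    refine (h (Coalgebra.comul (R := R) c)).trans ?_
    rw [Coalgebra.lTensor_counit_comul]
    simp
  lTensor_counit_comp_comul := by
    refine LinearMap.ext fun c => ?_
    obtain ⟨c, rfl⟩ := (CoOpp.equiv R C).surjective c
    have h : ∀ s : C ⊗[R] C, (CoOpp.counit R C).lTensor (CoOpp C)
        (TensorProduct.map (CoOpp.equiv R C).toLinearMap (CoOpp.equiv R C).toLinearMap
          (TensorProduct.comm R C C s)) = (CoOpp.equiv R C).toLinearMap.rTensor R
          (TensorProduct.comm R R C ((Coalgebra.counit (R := R) (A := C)).rTensor C s)) := by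
      intro s
      induction s using TensorProduct.induction_on with
      | zero => simp
      | tmul => simp [CoOpp.counit]
      | add a b ha hb => simp only [map_add, ha, hb]
    refine (h (Coalgebra.comul (R := R) c)).trans ?_
    rw [Coalgebra.rTensor_counit_comul]
    simp

/-- The identity as an anti-isomorphism to the co-opposite coalgebra. -/
def CoOpp.antiEquiv (R C : Type u) [CommRing R] [AddCommGroup C] [Module R C] [Coalgebra R C] :
    CoalgAntiEquiv R C (CoOpp C) where
  toEquiv := CoOpp.equiv R C
  comul_apply _ := rfl
  counit_apply _ := rfl

variable [Module.Projective R C] [Module.Projective R D]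

theorem BiCoact.isEquivalence_left_iff_leftCondition (hR : IsQFRing R) (x : BiCoact R C D X) :
    (LComod.cotensorFunctor x).IsEquivalence ↔ x.LeftCondition := by
  rw [x.isEquivalence_left_iff (CoOpp.antiEquiv R C) (CoOpp.antiEquiv R D),
    x.leftCondition_iff (CoOpp.antiEquiv R C) (CoOpp.antiEquiv R D),
    BiCoact.invertible_iff_rightCondition hR]

/-- The hypothesis makes the flipped bicomodule invertible. Its left cotensor functor is then an
equivalence, and flipping back yields invertibility of x. -/
theorem BiCoact.invertible_of_isEquivalence_left (hR : IsQFRing R) {x : BiCoact R C D X}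
    (hx : (LComod.cotensorFunctor x).IsEquivalence) : x.Invertible := by
  rw [x.isEquivalence_left_iff (CoOpp.antiEquiv R C) (CoOpp.antiEquiv R D)] at hx
  have h := hx.isEquivalence_left hR
  rwa [BiCoact.isEquivalence_left_iff _ (CoOpp.antiEquiv R D).symm (CoOpp.antiEquiv R C).symm,
    BiCoact.flip_flip] at h

end CoOpp


/-! ### Cohom modules as direct limits -/

section Limits

variable {R : Type u} [CommRing R]
variable {C : Type u} [AddCommGroup C] [Module R C] [Coalgebra R C]
variable {D : Type u} [AddCommGroup D] [Module R D] [Coalgebra R D]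
variable {M N X H : Type u} [AddCommGroup M] [Module R M] [AddCommGroup N] [Module R N]
  [AddCommGroup X] [Module R X] [AddCommGroup H] [Module R H]

/-- Functionals on a projective module `P` separate the elements of `Q ⊗ P`. -/
theorem TensorProduct.eq_zero_of_lTensor_dual {Q P : Type u} [AddCommGroup Q] [Module R Q]
    [AddCommGroup P] [Module R P] [Module.Projective R P] {t : Q ⊗[R] P}
    (h : ∀ g : P →ₗ[R] R, TensorProduct.rid R Q (g.lTensor Q t) = 0) : t = 0 := by
  obtain ⟨s, hs⟩ := (Module.projective_def' (R := R) (P := P)).1 inferInstance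
  classical
  have hinj : Function.Injective (s.lTensor Q) := by
    refine Function.LeftInverse.injective
      (g := (Finsupp.linearCombination R (id : P → P)).lTensor Q) fun t => ?_
    rw [← LinearMap.comp_apply, ← LinearMap.lTensor_comp, hs]; simp
  refine hinj ((TensorProduct.finsuppScalarRight R R Q P).injective (Finsupp.ext fun i => ?_))
  rw [TensorProduct.finsuppScalarRight_apply, ← LinearMap.comp_apply, ← LinearMap.lTensor_comp,
    map_zero, map_zero]
  exact h (Finsupp.lapply i ∘ₗ s)

/-- An element of `M ⊗ P` whose coordinates lie in `K` comes from `K ⊗ P`. -/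
theorem TensorProduct.mem_range_rTensor_subtype {P : Type u} [AddCommGroup P] [Module R P]
    [Module.Projective R P] {K : Submodule R M} {t : M ⊗[R] P}
    (h : ∀ g : P →ₗ[R] R, TensorProduct.rid R M (g.lTensor M t) ∈ K) :
    t ∈ LinearMap.range (K.subtype.rTensor P) := by
  have hex : Function.Exact K.subtype K.mkQ := by
    rw [LinearMap.exact_iff]; simp
  refine (rTensor_exact P hex K.mkQ_surjective t).1 (eq_zero_of_lTensor_dual fun g => ?_)
  have e : (TensorProduct.rid R (M ⧸ K)).toLinearMap ∘ₗ g.lTensor (M ⧸ K) ∘ₗ K.mkQ.rTensor P =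
      K.mkQ ∘ₗ (TensorProduct.rid R M).toLinearMap ∘ₗ g.lTensor M :=
    TensorProduct.ext' fun _ _ => by simp
  exact (LinearMap.congr_fun e t).trans ((Submodule.Quotient.mk_eq_zero K).2 (h g))

/-! ### Local finiteness of comodules -/

namespace RCoact

/-- The map `D^* → M`, `f ↦ (id ⊗ f) ρ(y)`. -/
def dualAction (m : RCoact R D M) (y : M) : Module.Dual R D →ₗ[R] M where
  toFun f := TensorProduct.rid R M (f.lTensor M (m.map y))
  map_add' f g := by rw [LinearMap.lTensor_add, LinearMap.add_apply, map_add]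
  map_smul' r f := by rw [LinearMap.lTensor_smul, LinearMap.smul_apply, map_smul]; rfl

theorem dualAction_apply (m : RCoact R D M) (y : M) (f : Module.Dual R D) :
    m.dualAction y f = TensorProduct.rid R M (f.lTensor M (m.map y)) := rfl

/-- Coassociativity turns a repeated action of functionals into the action of their convolution
product. -/
theorem dualAction_dualAction (m : RCoact R D M) (y : M) (f g : Module.Dual R D) :
    m.dualAction (m.dualAction y f) g = m.dualAction y
      (LinearMap.mul' R R ∘ₗ TensorProduct.map g f ∘ₗ Coalgebra.comul) := by
  have e1 : (TensorProduct.rid R M).toLinearMap ∘ₗ g.lTensor M ∘ₗ m.map ∘ₗ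
      (TensorProduct.rid R M).toLinearMap ∘ₗ f.lTensor M =
      (TensorProduct.rid R M).toLinearMap ∘ₗ
        (LinearMap.mul' R R ∘ₗ TensorProduct.map g f).lTensor M ∘ₗ
        (TensorProduct.assoc R M D D).toLinearMap ∘ₗ m.map.rTensor D := by
    refine TensorProduct.ext' fun z d => ?_
    simp only [LinearMap.comp_apply, LinearMap.rTensor_tmul, LinearMap.lTensor_tmul,
      LinearEquiv.coe_coe, rid_tmul, map_smul]
    generalize m.map z = s
    induction s using TensorProduct.induction_on with
    | zero => simp
    | tmul => simp [smul_smul, mul_comm]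
    | add a b ha hb => simp only [map_add, smul_add, add_tmul, ha, hb]
  have h1 := LinearMap.congr_fun e1 (m.map y)
  have h2 := m.coassoc_apply y
  simp only [dualAction_apply, LinearMap.lTensor_comp, LinearMap.comp_apply,
    LinearEquiv.coe_coe] at *
  rw [h1, h2]

theorem mem_range_dualAction (m : RCoact R D M) (y : M) :
    y ∈ LinearMap.range (m.dualAction y) :=
  ⟨Coalgebra.counit, m.counit_apply y⟩

/-- Since D is projective, membership of ρ(f · y) in the image of (D^* · y) ⊗ D may be tested with
functionals on D, and each one returns an element of D^* · y. -/
theorem isSubcomodule_range_dualAction [Module.Projective R D] (m : RCoact R D M) (y : M) :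
    m.IsSubcomodule (LinearMap.range (m.dualAction y)) := by
  rintro _ ⟨f, rfl⟩
  exact TensorProduct.mem_range_rTensor_subtype fun g =>
    ⟨_, (m.dualAction_dualAction y f g).symm⟩

/-- The element ρ(y) lies in the image of K ⊗ D for a finitely generated K, so D^* · y is contained
in K. -/
theorem finite_range_dualAction [IsNoetherianRing R] (m : RCoact R D M) (y : M) :
    Module.Finite R (LinearMap.range (m.dualAction y)) := by
  obtain ⟨K, hK, h⟩ := TensorProduct.exists_finite_submodule_left_of_setFinite {m.map y}
    (Set.finite_singleton _)
  obtain ⟨s, hs⟩ := h rfl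
  have hle : LinearMap.range (m.dualAction y) ≤ K := by
    rintro _ ⟨f, rfl⟩
    rw [dualAction_apply, ← hs]
    have e : (TensorProduct.rid R M).toLinearMap ∘ₗ f.lTensor M ∘ₗ K.subtype.rTensor D =
        K.subtype ∘ₗ (TensorProduct.rid R K).toLinearMap ∘ₗ f.lTensor K :=
      TensorProduct.ext' fun _ _ => by simp
    exact (LinearMap.congr_fun e s).symm ▸ Subtype.prop _
  exact Module.Finite.of_injective (Submodule.inclusion hle) (Submodule.inclusion_injective hle)

theorem IsSubcomodule.sup {m : RCoact R D M} {K L : Submodule R M} (hK : m.IsSubcomodule K)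
    (hL : m.IsSubcomodule L) : m.IsSubcomodule (K ⊔ L) := by
  have mono : ∀ {A B : Submodule R M}, A ≤ B →
      LinearMap.range (A.subtype.rTensor D) ≤ LinearMap.range (B.subtype.rTensor D) := by
    intro A B hAB
    have h : A.subtype = B.subtype ∘ₗ Submodule.inclusion hAB := rfl
    rw [h, LinearMap.rTensor_comp]
    exact LinearMap.range_comp_le_range _ _
  intro y hy
  obtain ⟨a, ha, b, hb, rfl⟩ := Submodule.mem_sup.1 hy
  rw [map_add]
  exact Submodule.add_mem _ (mono le_sup_left (hK a ha)) (mono le_sup_right (hL b hb))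

end RCoact

namespace FPSub

theorem isDirectedOrder [IsNoetherianRing R] (m : RCoact R D M) : IsDirectedOrder (FPSub m) where
  directed K L := by
    have h : Module.Finite R (K.1 ⊔ L.1 : Submodule R M) := inferInstance
    exact ⟨⟨K.1 ⊔ L.1, K.2.1.sup L.2.1, Module.finitePresentation_of_finite R _⟩,
      le_sup_left (a := K.1), le_sup_right (a := K.1)⟩

/-- Every element of a comodule lies in a finitely presented subcomodule. -/
theorem exists_mem [IsNoetherianRing R] [Module.Projective R D] (m : RCoact R D M) (y : M) :
    ∃ K : FPSub m, y ∈ K.1 :=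
  have := m.finite_range_dualAction y
  ⟨⟨_, m.isSubcomodule_range_dualAction y, Module.finitePresentation_of_finite R _⟩,
    m.mem_range_dualAction y⟩

end FPSub

namespace IsCohom

variable {x : RCoact R D X} {m : RCoact R D M} {η : M →ₗ[R] H ⊗[R] X}

/-- The cohom module of a finitely generated comodule is finitely generated. -/
theorem finite [Module.Flat R D] [Module.Flat R X] [Module.Finite R M] (hη : IsCohom x m η) :
    Module.Finite R H := by
  obtain ⟨S, hS⟩ := Module.Finite.fg_top (R := R) (M := M)
  obtain ⟨W, hW, h⟩ := TensorProduct.exists_finite_submodule_left_of_setFinite (η '' S)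
    (S.finite_toSet.image η)
  have hle : ∀ y, η y ∈ LinearMap.range (W.subtype.rTensor X) := by
    have : Submodule.span R (S : Set M) ≤ (LinearMap.range (W.subtype.rTensor X)).comap η :=
      Submodule.span_le.2 fun y hy => h ⟨y, hy, rfl⟩
    rw [hS] at this
    exact fun y => this trivial
  have hinj : Function.Injective (W.subtype.rTensor X) :=
    Module.Flat.rTensor_preserves_injective_linearMap _ W.injective_subtype
  let θ : M →ₗ[R] W ⊗[R] X := (LinearEquiv.ofInjective _ hinj).symm.toLinearMap ∘ₗ
    η.codRestrict _ hle
  have hθ : W.subtype.rTensor X ∘ₗ θ = η := LinearMap.ext fun y => congrArg Subtype.val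
    ((LinearEquiv.ofInjective _ hinj).apply_symm_apply (η.codRestrict _ hle y))
  -- The universal map already takes values in W ⊗ X with W finitely generated. The induced map H →
  -- W followed by the inclusion is the identity by uniqueness, so W is all of H.
  obtain ⟨g, hg⟩ := hη.exists_lift W θ <|
    RCoact.mem_com_of_injective (RCoact.rTensor_mem_com x W.subtype) hinj (hθ.symm ▸ hη.colinear)
  have hid : W.subtype ∘ₗ g = LinearMap.id := hη.hom_ext _ _ _ <| by
    rw [LinearMap.rTensor_comp, LinearMap.comp_assoc, hg, hθ, LinearMap.rTensor_id,
      LinearMap.id_comp]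
  exact Module.Finite.of_surjective W.subtype fun y => ⟨g y, LinearMap.congr_fun hid y⟩

/-- The isomorphism `h_D(X,M)^* ≅ Com_D(M,X)`. -/
def dualEquiv (hη : IsCohom x m η) : Module.Dual R H ≃ₗ[R] RCoact.com m x :=
  LinearEquiv.ofBijective
    { toFun := fun ψ => ⟨_, hη.dual_mem_com ψ⟩
      map_add' := fun ψ ψ' => Subtype.ext <| by
        change (TensorProduct.lid R X).toLinearMap ∘ₗ (ψ + ψ').rTensor X ∘ₗ η = _
        rw [LinearMap.rTensor_add, LinearMap.add_comp, LinearMap.comp_add]; rfl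
      map_smul' := fun r ψ => Subtype.ext <| by
        change (TensorProduct.lid R X).toLinearMap ∘ₗ (r • ψ).rTensor X ∘ₗ η = _
        rw [LinearMap.rTensor_smul, LinearMap.smul_comp, LinearMap.comp_smul]; rfl }
    ⟨fun _ _ h => hη.dual_ext (congrArg Subtype.val h), fun g => by
      obtain ⟨ψ, hψ⟩ := hη.exists_dual g.2
      exact ⟨ψ, Subtype.ext hψ⟩⟩

/-- The isomorphism `h_D(X,M) ≅ Com_D(M,X)^*` for `M` finitely generated. -/
def bidualEquiv [Module.IsReflexive R H] (hη : IsCohom x m η) :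
    H ≃ₗ[R] Module.Dual R (RCoact.com m x) :=
  Module.evalEquiv R H ≪≫ₗ hη.dualEquiv.symm.dualMap

theorem bidualEquiv_apply [Module.IsReflexive R H] (hη : IsCohom x m η) (y : H)
    (ψ : Module.Dual R H) : hη.bidualEquiv y (hη.dualEquiv ψ) = ψ y := by
  change hη.dualEquiv.symm (hη.dualEquiv ψ) y = ψ y
  rw [LinearEquiv.symm_apply_apply]

end IsCohom

section Cotensor

variable [Module.Projective R D]

/-- `X □_D N^*` consists of the elements of `X ⊗ N^*` that correspond to colinear maps. -/
theorem mem_cotensor_dual_iff [Module.Finite R N] [Module.Projective R X] {x : RCoact R D X}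
    {n : RCoact R D N} {t : X ⊗[R] Module.Dual R N} :
    t ∈ cotensor x n.dual ↔ contract R X N t ∈ RCoact.com n x := by
  have hr : ∀ y, contract R (X ⊗[R] D) N (x.map.rTensor _ t) y = x.map (contract R X N t y) := by
    intro y
    induction t using TensorProduct.induction_on with
    | zero => simp
    | tmul => simp
    | add a b ha hb => simp only [map_add, LinearMap.add_apply, ha, hb]
  have hl : ∀ y, contract R (X ⊗[R] D) N ((TensorProduct.assoc R X D (Module.Dual R N)).symm
      (n.dualMap.lTensor X t)) y = (contract R X N t).rTensor D (n.map y) := by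
    intro y
    clear hr
    induction t using TensorProduct.induction_on with
    | zero => simp
    | tmul d g =>
      have h1 : ∀ s : D ⊗[R] Module.Dual R N,
          contract R (X ⊗[R] D) N ((TensorProduct.assoc R X D (Module.Dual R N)).symm
            (d ⊗ₜ s)) y = d ⊗ₜ contract R D N s y := by
        intro s
        induction s using TensorProduct.induction_on with
        | zero => simp
        | tmul => simp
        | add a b ha hb => simp only [tmul_add, map_add, LinearMap.add_apply, ha, hb]
      rw [LinearMap.lTensor_tmul, h1, RCoact.contract_dualMap]
      simp only [LinearMap.comp_apply, LinearEquiv.coe_coe]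
      generalize n.map y = s
      induction s using TensorProduct.induction_on with
      | zero => simp
      | tmul => simp [smul_tmul']
      | add a b ha hb => simp only [tmul_add, map_add, ha, hb]
    | add a b ha hb => simp only [map_add, LinearMap.add_apply, LinearMap.rTensor_add, ha, hb]
  -- As X ⊗ D is projective, contraction on (X ⊗ D) ⊗ N^* is injective, so the cotensor equation may
  -- be evaluated at each y in N, where it becomes colinearity.
  rw [mem_cotensor, ← LinearEquiv.eq_symm_apply, RCoact.mem_com,
    ← (contract_injective (R := R) (V := X ⊗[R] D) (N := N)).eq_iff, LinearMap.ext_iff,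
    LinearMap.ext_iff]
  refine forall_congr' fun y => ?_
  rw [hr, LinearMap.comp_apply, LinearMap.comp_apply]
  exact Eq.congr_right (hl y)

/-- The isomorphism `X □_D N^* ≅ Com_D(N,X)`. -/
def cotensorDualEquiv [Module.Finite R N] [Module.Projective R X] (x : RCoact R D X)
    (n : RCoact R D N) : cotensor x n.dual ≃ₗ[R] RCoact.com n x :=
  LinearEquiv.ofBijective
    ((contract R X N).restrict fun _ ht => mem_cotensor_dual_iff.1 ht)
    ⟨fun _ _ h => Subtype.ext (contract_injective (congrArg Subtype.val h)), fun g => by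
      obtain ⟨t, ht⟩ := contract_surjective g.1
      exact ⟨⟨t, mem_cotensor_dual_iff.2 (ht ▸ g.2)⟩, Subtype.ext ht⟩⟩

theorem contract_lTensor_dualMap (f : M →ₗ[R] N) (t : X ⊗[R] Module.Dual R N) :
    contract R X M (f.dualMap.lTensor X t) = contract R X N t ∘ₗ f := by
  induction t using TensorProduct.induction_on with
  | zero => simp
  | tmul => ext; simp
  | add a b ha hb => simp only [map_add, LinearMap.add_comp, ha, hb]

namespace FPSub

open Classical in
/-- The isomorphism `lim Com_D(K,X)^* ≅ lim (X □_D K^*)^*`. -/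
def comLimitEquiv [Module.Projective R X] (m : RCoact R D M) (x : RCoact R D X) :
    ComLimit m x ≃ₗ[R] CotensorLimit m x :=
  Module.DirectLimit.congr (fun K => (cotensorDualEquiv x K.coact).dualMap) <| by
    intro K L hKL
    refine LinearMap.ext fun ξ => LinearMap.ext fun t => congrArg ξ (Subtype.ext ?_)
    exact (contract_lTensor_dualMap (Submodule.inclusion hKL) t.1).symm

theorem comLimitEquiv_toComLimit [Module.Projective R X] {m : RCoact R D M} (x : RCoact R D X)
    (K : FPSub m) (ξ : Module.Dual R (RCoact.com K.coact x)) :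
    comLimitEquiv m x (toComLimit x K ξ) =
      toCotensorLimit x K (ξ ∘ₗ (cotensorDualEquiv x K.coact).toLinearMap) :=
  Module.DirectLimit.congr_apply_of _ _ _

end FPSub

end Cotensor

end Limits


/-! ### The cohom module as the limit of the duals of Com_D(K,X) -/

section CohomLimit

variable {R : Type u} [CommRing R]
variable {D : Type u} [AddCommGroup D] [Module R D] [Coalgebra R D]
variable {M N X H H' : Type u} [AddCommGroup M] [Module R M] [AddCommGroup N] [Module R N]
  [AddCommGroup X] [Module R X] [AddCommGroup H] [Module R H] [AddCommGroup H'] [Module R H']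
variable {x : RCoact R D X} {m : RCoact R D M} {n : RCoact R D N}

/-- Naturality of h(M) ≅ Com_D(M,X)^*; it matches the maps between cohom modules with the transition
maps of the direct system. -/
theorem IsCohom.bidualEquiv_map {η : M →ₗ[R] H ⊗[R] X} {η' : N →ₗ[R] H' ⊗[R] X}
    (hη : IsCohom x m η) (hη' : IsCohom x n η') [Module.IsReflexive R H] [Module.IsReflexive R H']
    {a : H →ₗ[R] H'} {f : M →ₗ[R] N} (hf : f ∈ RCoact.com m n)
    (ha : a.rTensor X ∘ₗ η = η' ∘ₗ f) (y : H) :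
    hη'.bidualEquiv (a y) = (RCoact.precomp f hf x).dualMap (hη.bidualEquiv y) := by
  refine LinearMap.ext fun φ => ?_
  obtain ⟨ψ, rfl⟩ := hη'.dualEquiv.surjective φ
  rw [bidualEquiv_apply]
  have h1 : RCoact.precomp f hf x (hη'.dualEquiv ψ) = hη.dualEquiv (ψ ∘ₗ a) :=
    Subtype.ext (IsCohom.dual_comp ha ψ).symm
  rw [LinearMap.dualMap_apply, h1, bidualEquiv_apply]
  rfl

namespace FPSub

variable [Module.Projective R D] {η₀ : M →ₗ[R] H ⊗[R] X}
  {G : FPSub m → Type u} [∀ K, AddCommGroup (G K)] [∀ K, Module R (G K)]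
  {η : ∀ K : FPSub m, K.1 →ₗ[R] G K ⊗[R] X} {a : ∀ K, G K →ₗ[R] H}

open Classical in
/-- The map `lim Com_D(K,X)^* → h_D(X,M)`. -/
def fromComLimit (hη : ∀ K : FPSub m, IsCohom x K.coact (η K))
    [∀ K, Module.IsReflexive R (G K)]
    (ha : ∀ K, (a K).rTensor X ∘ₗ η K = η₀ ∘ₗ K.1.subtype) : ComLimit m x →ₗ[R] H :=
  Module.DirectLimit.lift R _ _ _ (fun K => a K ∘ₗ (hη K).bidualEquiv.symm.toLinearMap) <| by
    intro K L hKL ξ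
    obtain ⟨y, rfl⟩ := (hη K).bidualEquiv.surjective ξ
    have hb := (hη K).map_spec (hη L) _ (inclusion_mem_com hKL)
    have hc : a L ∘ₗ (hη K).map (hη L) _ (inclusion_mem_com hKL) = a K := by
      refine (hη K).hom_ext _ _ _ ?_
      rw [LinearMap.rTensor_comp, LinearMap.comp_assoc, hb, ← LinearMap.comp_assoc, ha, ha]
      rfl
    have h1 : comDualMap m x K L hKL ((hη K).bidualEquiv y) =
        (hη L).bidualEquiv ((hη K).map (hη L) _ (inclusion_mem_com hKL) y) :=
      ((hη K).bidualEquiv_map (hη L) (inclusion_mem_com hKL) hb y).symm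
    simp only [h1, LinearMap.comp_apply, LinearEquiv.coe_coe, LinearEquiv.symm_apply_apply]
    exact LinearMap.congr_fun hc y

theorem fromComLimit_apply (hη : ∀ K : FPSub m, IsCohom x K.coact (η K))
    [∀ K, Module.IsReflexive R (G K)]
    (ha : ∀ K, (a K).rTensor X ∘ₗ η K = η₀ ∘ₗ K.1.subtype) (K : FPSub m) (y : G K) :
    fromComLimit hη ha (toComLimit x K ((hη K).bidualEquiv y)) = a K y := by
  refine (Module.DirectLimit.lift_of _ _ _).trans ?_
  simp only [LinearMap.comp_apply, LinearEquiv.coe_coe, LinearEquiv.symm_apply_apply]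

/-- If `X` is injective as a comodule, then `h_D(X,M)` is the direct limit of the modules
`Com_D(K,X)^*`. -/
theorem fromComLimit_bijective (hR : IsQFRing R) (hx : x.HasExtensions)
    (hη : ∀ K : FPSub m, IsCohom x K.coact (η K)) (hη₀ : IsCohom x m η₀)
    [∀ K, Module.IsReflexive R (G K)]
    (ha : ∀ K, (a K).rTensor X ∘ₗ η K = η₀ ∘ₗ K.1.subtype) :
    Function.Bijective (fromComLimit hη ha) := by
  have := hR.1
  have := isDirectedOrder m
  constructor
  -- Exactness of h makes each h(K) → h(M) injective, which suffices over a directed family.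
  · exact Module.DirectLimit.lift_injective _ _ fun K =>
      (IsCohom.injective_of_injective hR hx (hη K) hη₀ (RCoact.subtype_mem_com m K.1 K.2.1) (ha K)
        K.1.injective_subtype).comp (hη K).bidualEquiv.symm.injective
  -- The quotient of h(M) by the range receives the zero map from each h(K). As the subcomodules K
  -- cover M, the projection composed with the universal map is zero on M, and uniqueness makes the
  -- projection zero.
  · rw [← LinearMap.range_eq_top, ← Submodule.ker_mkQ (LinearMap.range _), LinearMap.ker_eq_top]
    refine hη₀.hom_ext _ _ _ (LinearMap.ext fun y => ?_)
    obtain ⟨K, hK⟩ := exists_mem m y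
    have h1 : (LinearMap.range (fromComLimit hη ha)).mkQ ∘ₗ a K = 0 := LinearMap.ext fun z =>
      (Submodule.Quotient.mk_eq_zero _).2 ⟨_, fromComLimit_apply hη ha K z⟩
    have h2 := LinearMap.congr_fun (ha K) ⟨y, hK⟩
    have h3 := LinearMap.congr_fun (congrArg (LinearMap.rTensor X) h1) (η K ⟨y, hK⟩)
    rw [LinearMap.rTensor_comp, LinearMap.comp_apply] at h3
    rw [LinearMap.comp_apply] at h2
    rw [h2, LinearMap.rTensor_zero] at h3
    rw [LinearMap.rTensor_zero]
    exact h3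

/-- Injectivity makes X projective over R, hence flat. This gives finite generation, and so
reflexivity, of every h(K). -/
theorem exists_cohom_equiv (hR : IsQFRing R) (hx : x.HasExtensions)
    {h : RComod R D ⥤ ModuleCat.{u} R} (adj : h ⊣ RComod.tensorFunctor x) (M : RComod R D) :
    ∃ (k : ∀ K : FPSub M.coact,
          h.obj ⟨K.1, K.coact⟩ ≃ₗ[R] Module.Dual R (RCoact.com K.coact x))
        (e : ComLimit M.coact x ≃ₗ[R] h.obj M),
      (∀ K y ψ, k K y (x.adjDual adj ⟨K.1, K.coact⟩ ψ) = ψ y) ∧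
      ∀ K y, e (toComLimit x K (k K y)) = (h.map K.ι).hom y := by
  have := hx.projective hR
  have hη : ∀ K : FPSub M.coact, IsCohom x K.coact (H := h.obj ⟨K.1, K.coact⟩)
      (RComod.lin (adj.unit.app ⟨K.1, K.coact⟩)) := fun K => x.isCohom adj ⟨K.1, K.coact⟩
  have ha : ∀ K : FPSub M.coact, (h.map K.ι).hom.rTensor X ∘ₗ
      (RComod.lin (adj.unit.app ⟨K.1, K.coact⟩) : K.1 →ₗ[R] h.obj ⟨K.1, K.coact⟩ ⊗[R] X) =
      (RComod.lin (adj.unit.app M) : M.carrier →ₗ[R] h.obj M ⊗[R] X) ∘ₗ K.1.subtype := fun K =>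
    (congrArg RComod.lin (adj.unit.naturality K.ι)).symm
  have hfin : ∀ K : FPSub M.coact, Module.Finite R (h.obj ⟨K.1, K.coact⟩) := fun K => (hη K).finite
  have hrefl : ∀ K : FPSub M.coact, Module.IsReflexive R (h.obj ⟨K.1, K.coact⟩) := fun K =>
    hR.isReflexive _
  exact ⟨fun K => (hη K).bidualEquiv, LinearEquiv.ofBijective _
    (fromComLimit_bijective hR hx hη (x.isCohom adj M) ha),
    fun K => (hη K).bidualEquiv_apply, fromComLimit_apply hη ha⟩

end FPSub

end CohomLimit

end

/-! ### The main theorem -/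

theorem mainTheorem6 {R : Type u} [CommRing R] (hR : IsQFRing R)
    {C : Type u} [AddCommGroup C] [Module R C] [Coalgebra R C] [Module.Projective R C]
    {D : Type u} [AddCommGroup D] [Module R D] [Coalgebra R D] [Module.Projective R D]
    {X : Type u} [AddCommGroup X] [Module R X] (x : BiCoact R C D X) :
    -- the characterization of invertible bicomodules
    List.TFAE [x.Invertible, (LComod.cotensorFunctor x).IsEquivalence,
      x.RightCondition, x.LeftCondition] ∧
    -- if the equivalent conditions hold, `h ⊣ - ⊗ X` being the cohom functor:
    (x.RightCondition → ∀ (h : RComod R D ⥤ ModuleCat.{u} R)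
      (adj : h ⊣ RComod.tensorFunctor x.right),
      -- `- □_C X` is an equivalence with inverse `h_D(X,-)`
      (∃ e : RComod R C ≌ RComod R D,
        e.functor = RComod.cotensorFunctor x ∧ e.inverse = x.cohomFunctor adj) ∧
      -- `h_D(X,-) ≅ - □_D h_D(X,D)`
      Nonempty (x.cohomFunctor adj ≅ RComod.cotensorFunctor (x.cohomSelf adj)) ∧
      -- `h_D(X,M)` as a direct limit
      ∀ M : RComod R D,
        (∃ (k : ∀ K : FPSub M.coact,
              h.obj ⟨K.1, K.coact⟩ ≃ₗ[R] Module.Dual R (RCoact.com K.coact x.right))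
            (e : FPSub.ComLimit M.coact x.right ≃ₗ[R] h.obj M),
          (∀ K y ψ, k K y (x.right.adjDual adj ⟨K.1, K.coact⟩ ψ) = ψ y) ∧
          ∀ K y, e (FPSub.toComLimit x.right K (k K y)) = (h.map K.ι).hom y) ∧
        ∃ (c : ∀ K : FPSub M.coact,
              cotensor x.right K.coact.dual ≃ₗ[R] RCoact.com K.coact x.right)
            (e' : FPSub.ComLimit M.coact x.right ≃ₗ[R] FPSub.CotensorLimit M.coact x.right),
          (∀ K t, (c K t).1 = contract R X K.1 t.1) ∧
          ∀ K ξ, e' (FPSub.toComLimit x.right K ξ) =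
            FPSub.toCotensorLimit x.right K (ξ ∘ₗ (c K).toLinearMap)) := by
  refine ⟨?_, fun hc h adj => ?_⟩
  · tfae_have 1 ↔ 3 := BiCoact.invertible_iff_rightCondition hR
    tfae_have 2 ↔ 4 := BiCoact.isEquivalence_left_iff_leftCondition hR x
    tfae_have 1 → 2 := fun hx => hx.isEquivalence_left hR
    tfae_have 2 → 1 := BiCoact.invertible_of_isEquivalence_left hR
    tfae_finish
  · have hx := BiCoact.RightCondition.isInvertingBicomodule hc
    have := hx.hasExtensions.projective hR
    -- The equivalence is built from the two functors themselves, so both identifications hold by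
    -- definition.
    exact ⟨⟨hx.equivalence hR adj, rfl, rfl⟩, ⟨x.cohomIso hR hx.hasExtensions adj⟩, fun M =>
      ⟨FPSub.exists_cohom_equiv hR hx.hasExtensions adj M,
        fun K => cotensorDualEquiv x.right K.coact, FPSub.comLimitEquiv M.coact x.right,
        fun _ _ => rfl, FPSub.comLimitEquiv_toComLimit x.right⟩⟩
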